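/- Let $\mathbb I$ be a finite set and $C=(c_{ij})_{i,j\in\mathbb I}$ a symmetric generalized Cartan matrix ($c_{ii}=2$, $c_{ij}=c_{ji}\in\mathbb Z_{\le 0}$ for $i\ne j$). Let $v$ be an indeterminate, $[r]=\frac{v^r-v^{-r}}{v-v^{-1}}$, and let $\left[{m\atop r}\right]$ be the corresponding quantum binomial coefficients. Let $\widetilde{\mathbf U}$ be the $\mathbb Q(v)$-algebra with generators $E_i,F_i,\widetilde K_i^{\pm1},\widetilde K_i'^{\pm1}$ ($i\in\mathbb I$) and relations: the $\widetilde K_i,\widetilde K_j'$ pairwise commute; $$[E_i,F_j]=\delta_{ij}\frac{\widetilde K_i-\widetilde K_i'}{v-v^{-1}},$$ $$\widetilde K_iE_j=v^{c_{ij}}E_j\widetilde K_i,\quad \widetilde K_iF_j=v^{-c_{ij}}F_j\widetilde K_i,\quad \widetilde K_i'E_j=v^{-c_{ij}}E_j\widetilde K_i',\quad \widetilde K_i'F_j=v^{c_{ij}}F_j\widetilde K_i';$$ and for $i\neq j$ the quantum Serre relation $\sum_{r=0}^{1-c_{ij}}(-1)^r\left[{1-c_{ij}\atop r}\right]X_i^rX_jX_i^{1-c_{ij}-r}=0$,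 for $X=E$ and for $X=F$. Its comultiplication is the algebra homomorphism $\Delta:\widetilde{\mathbf U}\to\widetilde{\mathbf U}\otimes\widetilde{\mathbf U}$ with $$\Delta(E_i)=E_i\otimes1+\widetilde K_i\otimes E_i,\quad \Delta(F_i)=1\otimes F_i+F_i\otimes\widetilde K_i',\quad \Delta(\widetilde K_i)=\widetilde K_i\otimes\widetilde K_i,\quad \Delta(\widetilde K_i')=\widetilde K_i'\otimes\widetilde K_i'.$$ Let $\mathbf U$ be the $\mathbb Q(v)$-algebra generated by $E_i,F_i,K_i^{\pm1}$ ($i\in\mathbb I$) subject to the same relations with $\widetilde K_i,\widetilde K_i'$ replaced by $K_i,K_i^{-1}$. Let $\tau$ be a permutation of $\mathbb I$ with $\tau^2=\mathrm{id}$ and $c_{\tau i,\tau j}=c_{ij}$ for all $i,j$ ($\tau=\mathrm{id}$ is allowed), and let $\mathbb I_\tau\subseteq\mathbb I$ be a set of representatives of the $\tau$-orbits. Let $\widetilde{\mathbf U}^\imath$ be the subalgebra of $\widetilde{\mathbf U}$ generated by $$B_i=F_i+E_{\tau i}\widetilde K_i',\qquad \widetilde k_i^{\pm1}\ \text{ where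 }\ \widetilde k_i=\widetilde K_i\widetilde K'_{\tau i}\qquad(i\in\mathbb I).$$ For $\varsigma=(\varsigma_i)\in(\mathbb Q(v)^\times)^{\mathbb I}$ such that $\varsigma_i=\varsigma_{\tau i}$ whenever $c_{i,\tau i}=0$, let $\mathbf U^\imath_\varsigma$ be the subalgebra of $\mathbf U$ generated by $$B_i=F_i+\varsigma_iE_{\tau i}K_i^{-1}\ (i\in\mathbb I),\qquad k_j^{\pm1}\ \text{ where }\ k_j=K_jK_{\tau j}^{-1}\ (j\in\mathbb I_\tau).$$ **Proposition.** (1) For every such $\varsigma$, the algebra $\mathbf U^\imath_\varsigma$ is isomorphic to the quotient of $\widetilde{\mathbf U}^\imath$ by the two-sided ideal generated by $$\widetilde k_i-\varsigma_i\ (\text{for }\tau i=i),\qquad \widetilde k_i\widetilde k_{\tau i}-\varsigma_i\varsigma_{\tau i}\ (\text{for }\tau i\neq i).$$ There is an isomorphism from $\mathbf U^\imath_\varsigma$ to this quotient that sends $B_i\mapsto B_i$, $k_j\mapsto\varsigma_{\tau j}^{-1}\widetilde k_j$ and $k_j^{-1}\mapsto\varsigma_j^{-1}\widetilde k_{\tau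 j}$ for all $i\in\mathbb I$, $j\in\mathbb I_\tau$. (2) $\widetilde{\mathbf U}^\imath$ is a right coideal subalgebra of $\widetilde{\mathbf U}$, that is, $\Delta(\widetilde{\mathbf U}^\imath)\subseteq\widetilde{\mathbf U}^\imath\otimes\widetilde{\mathbf U}$. -/

import Mathlib

open scoped TensorProduct

noncomputable section

namespace IQG

/-! ## The ground field and quantum integers -/

/-- The field `ℚ(v)` of rational functions in one indeterminate. -/
abbrev Qv : Type := RatFunc ℚ

/-- The indeterminate `v`. -/
def v : Qv := RatFunc.X

/-- The quantum integer `[r] = (v ^ r - v ^ (-r)) / (v - v ^ (-1))`. -/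
def qInt (r : ℕ) : Qv := (v ^ r - v⁻¹ ^ r) / (v - v⁻¹)

/-- The quantum factorial `[r]! = [1][2]⋯[r]`. -/
def qFact (r : ℕ) : Qv := ∏ i ∈ Finset.range r, qInt (i + 1)

/-- The quantum binomial coefficient `[m][m-1]⋯[m-r+1] / [r]!`.  (If `r > m` the truncated
subtraction produces the factor `[0] = 0`, which is also a factor of the true product.) -/
def qBinom (m r : ℕ) : Qv := (∏ s ∈ Finset.range r, qInt (m - s)) / qFact r

/-- The quantum Serre expression `∑_{r=0}^{m} (-1)^r [m choose r] x^r y x^{m-r}`. -/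
def serre {A : Type*} [Ring A] [Algebra Qv A] (m : ℕ) (x y : A) : A :=
  ∑ r ∈ Finset.range (m + 1), ((-1) ^ r * qBinom m r) • (x ^ r * y * x ^ (m - r))

/-! ## Cartan data -/

/-- A symmetric generalized Cartan matrix indexed by `I`.  Equivalently `c i j = 2 δ i j - n i j`,
where `n i j` is the number of edges between `i` and `j` in a loopless multigraph on `I`, that is,
in the underlying graph of an acyclic quiver with vertex set `I`. -/
structure SymmetricGCM (I : Type*) where
  /-- the entries `c i j` -/
  entry : I → I → ℤ
  diag : ∀ i, entry i i = 2
  offDiag : ∀ i j, i ≠ j → entry i j ≤ 0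
  symm : ∀ i j, entry i j = entry j i

instance {I : Type*} : CoeFun (SymmetricGCM I) (fun _ => I → I → ℤ) := ⟨SymmetricGCM.entry⟩

/-! ## Defining relations -/

/-- The Drinfeld-Jimbo relations between families `E`, `F`, `K`, `K'` (here `L` stands for `K'`) of
elements of an algebra: the pairs (left-hand side, right-hand side) of the relations. -/
inductive DJRel {I : Type*} (C : SymmetricGCM I) {A : Type*} [Ring A] [Algebra Qv A]
    (E F K L : I → A) : A → A → Prop
  | EF_same (i : I) : DJRel C E F K L (E i * F i - F i * E i) ((v - v⁻¹)⁻¹ • (K i - L i))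
  | EF_diff (i j : I) (h : i ≠ j) : DJRel C E F K L (E i * F j - F j * E i) 0
  | KK (i j : I) : DJRel C E F K L (K i * K j) (K j * K i)
  | KL (i j : I) : DJRel C E F K L (K i * L j) (L j * K i)
  | LL (i j : I) : DJRel C E F K L (L i * L j) (L j * L i)
  | KE (i j : I) : DJRel C E F K L (K i * E j) (v ^ C i j • (E j * K i))
  | KF (i j : I) : DJRel C E F K L (K i * F j) (v ^ (-C i j) • (F j * K i))
  | LE (i j : I) : DJRel C E F K L (L i * E j) (v ^ (-C i j) • (E j * L i))
  | LF (i j : I) : DJRel C E F K L (L i * F j) (v ^ C i j • (F j * L i))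
  | serreE (i j : I) (h : i ≠ j) : DJRel C E F K L (serre (1 - C i j).toNat (E i) (E j)) 0
  | serreF (i j : I) (h : i ≠ j) : DJRel C E F K L (serre (1 - C i j).toNat (F i) (F j)) 0

/-! ## The quantum group `U` -/

/-- Generators of the quantum group `U`. -/
inductive UGen (I : Type*)
  | E (i : I)
  | F (i : I)
  | K (i : I)
  | Kinv (i : I)

/-- Defining relations of the quantum group `U`: `K i` is invertible with inverse `Kinv i`, and the
Drinfeld-Jimbo relations hold with `K' = K⁻¹`. -/
inductive URel {I : Type*} (C : SymmetricGCM I) :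
    FreeAlgebra Qv (UGen I) → FreeAlgebra Qv (UGen I) → Prop
  | K_Kinv (i : I) : URel C (FreeAlgebra.ι Qv (UGen.K i) * FreeAlgebra.ι Qv (UGen.Kinv i)) 1
  | Kinv_K (i : I) : URel C (FreeAlgebra.ι Qv (UGen.Kinv i) * FreeAlgebra.ι Qv (UGen.K i)) 1
  | dj (x y : FreeAlgebra Qv (UGen I))
      (h : DJRel C (fun i => FreeAlgebra.ι Qv (UGen.E i)) (fun i => FreeAlgebra.ι Qv (UGen.F i))
        (fun i => FreeAlgebra.ι Qv (UGen.K i)) (fun i => FreeAlgebra.ι Qv (UGen.Kinv i)) x y) :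
      URel C x y

/-- The quantum group `U` over `ℚ(v)`. -/
def U {I : Type*} (C : SymmetricGCM I) : Type _ := RingQuot (URel C)

instance {I : Type*} (C : SymmetricGCM I) : Ring (U C) := inferInstanceAs (Ring (RingQuot (URel C)))

instance {I : Type*} (C : SymmetricGCM I) : Algebra Qv (U C) :=
  inferInstanceAs (Algebra Qv (RingQuot (URel C)))

/-- The image in `U` of a generator. -/
def U.of {I : Type*} (C : SymmetricGCM I) (g : UGen I) : U C :=
  RingQuot.mkAlgHom Qv (URel C) (FreeAlgebra.ι Qv g)

/-- The generator `E i` of `U`. -/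
def U.E {I : Type*} (C : SymmetricGCM I) (i : I) : U C := U.of C (UGen.E i)
/-- The generator `F i` of `U`. -/
def U.F {I : Type*} (C : SymmetricGCM I) (i : I) : U C := U.of C (UGen.F i)
/-- The generator `K i` of `U`. -/
def U.K {I : Type*} (C : SymmetricGCM I) (i : I) : U C := U.of C (UGen.K i)
/-- The inverse of the generator `K i` of `U`. -/
def U.Kinv {I : Type*} (C : SymmetricGCM I) (i : I) : U C := U.of C (UGen.Kinv i)

/-! ## The quantum group `Ũ` with enlarged Cartan part -/

/-- Generators of `Ũ`; `L i` stands for `K' i`. -/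
inductive DGen (I : Type*)
  | E (i : I)
  | F (i : I)
  | K (i : I)
  | Kinv (i : I)
  | L (i : I)
  | Linv (i : I)

/-- Defining relations of `Ũ`: `K i` and `K' i` are invertible and the Drinfeld-Jimbo relations
hold. -/
inductive DRel {I : Type*} (C : SymmetricGCM I) :
    FreeAlgebra Qv (DGen I) → FreeAlgebra Qv (DGen I) → Prop
  | K_Kinv (i : I) : DRel C (FreeAlgebra.ι Qv (DGen.K i) * FreeAlgebra.ι Qv (DGen.Kinv i)) 1
  | Kinv_K (i : I) : DRel C (FreeAlgebra.ι Qv (DGen.Kinv i) * FreeAlgebra.ι Qv (DGen.K i)) 1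
  | L_Linv (i : I) : DRel C (FreeAlgebra.ι Qv (DGen.L i) * FreeAlgebra.ι Qv (DGen.Linv i)) 1
  | Linv_L (i : I) : DRel C (FreeAlgebra.ι Qv (DGen.Linv i) * FreeAlgebra.ι Qv (DGen.L i)) 1
  | dj (x y : FreeAlgebra Qv (DGen I))
      (h : DJRel C (fun i => FreeAlgebra.ι Qv (DGen.E i)) (fun i => FreeAlgebra.ι Qv (DGen.F i))
        (fun i => FreeAlgebra.ι Qv (DGen.K i)) (fun i => FreeAlgebra.ι Qv (DGen.L i)) x y) :
      DRel C x y

/-- The algebra `Ũ` over `ℚ(v)` (the quantum group with doubled Cartan part). -/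
def UTilde {I : Type*} (C : SymmetricGCM I) : Type _ := RingQuot (DRel C)

instance {I : Type*} (C : SymmetricGCM I) : Ring (UTilde C) :=
  inferInstanceAs (Ring (RingQuot (DRel C)))

instance {I : Type*} (C : SymmetricGCM I) : Algebra Qv (UTilde C) :=
  inferInstanceAs (Algebra Qv (RingQuot (DRel C)))

namespace UTilde

variable {I : Type*} (C : SymmetricGCM I)

/-- The image in `Ũ` of a generator. -/
def of (g : DGen I) : UTilde C := RingQuot.mkAlgHom Qv (DRel C) (FreeAlgebra.ι Qv g)

/-- The generator `E i` of `Ũ`. -/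
def E (i : I) : UTilde C := of C (DGen.E i)
/-- The generator `F i` of `Ũ`. -/
def F (i : I) : UTilde C := of C (DGen.F i)
/-- The generator `K̃ i` of `Ũ`. -/
def K (i : I) : UTilde C := of C (DGen.K i)
/-- The inverse of the generator `K̃ i` of `Ũ`. -/
def Kinv (i : I) : UTilde C := of C (DGen.Kinv i)
/-- The generator `K̃' i` of `Ũ`. -/
def L (i : I) : UTilde C := of C (DGen.L i)
/-- The inverse of the generator `K̃' i` of `Ũ`. -/
def Linv (i : I) : UTilde C := of C (DGen.Linv i)

end UTilde

/-! ## Auxiliary facts: the comultiplication is well defined -/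

section Aux

theorem v_ne_zero : v ≠ 0 := RatFunc.X_ne_zero

theorem v_pow_ne_one {n : ℕ} (hn : n ≠ 0) : v ^ n ≠ 1 := by
  intro h
  have h1 : (algebraMap (Polynomial ℚ) Qv) (Polynomial.X ^ n) = algebraMap (Polynomial ℚ) Qv 1 := by
    simpa [v] using h
  have h2 := RatFunc.algebraMap_injective ℚ h1
  have h3 := congrArg Polynomial.natDegree h2
  simp at h3
  exact hn h3

theorem v_sub_inv_ne_zero : v - v⁻¹ ≠ 0 := by
  intro h
  apply v_pow_ne_one (n := 2) (by norm_num)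
  have := v_ne_zero
  field_simp at h
  linear_combination h

theorem qInt_zero : qInt 0 = 0 := by simp [qInt]

theorem qInt_ne_zero {n : ℕ} (hn : n ≠ 0) : qInt n ≠ 0 := by
  have hv := v_ne_zero
  refine div_ne_zero ?_ v_sub_inv_ne_zero
  intro h
  apply v_pow_ne_one (n := 2 * n) (by omega)
  rw [inv_pow] at h
  field_simp at h
  linear_combination h

theorem qBinom_zero_right (m : ℕ) : qBinom m 0 = 1 := by simp [qBinom, qFact]

theorem qBinom_succ_right (m r : ℕ) :
    qBinom m (r + 1) = qBinom m r * (qInt (m - r) / qInt (r + 1)) := by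
  simp only [qBinom, qFact, Finset.prod_range_succ]
  rw [mul_div_mul_comm]

theorem qBinom_eq_zero {m r : ℕ} (h : m < r) : qBinom m r = 0 := by
  unfold qBinom
  rw [Finset.prod_eq_zero (Finset.mem_range.2 h) (by simp [qInt_zero]), zero_div]

theorem qBinom_succ_succ (m r : ℕ) :
    qBinom (m + 1) (r + 1) = qBinom m r * (qInt (m + 1) / qInt (r + 1)) := by
  simp only [qBinom, qFact, Finset.prod_range_succ' (fun s => qInt (m + 1 - s)),
    Finset.prod_range_succ (fun s => qInt (s + 1))]
  rw [← mul_div_mul_comm]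
  simp

/-- The two quantum Pascal identities, `w` being `v` or `v⁻¹`. -/
theorem pascal (w : Qv) (hw : w = v ∨ w = v⁻¹) (m r : ℕ) :
    w ^ (r + 1) * qBinom (m + 1) (r + 1) = qBinom m (r + 1) + w ^ (m + 1) * qBinom m r := by
  rcases lt_or_ge m r with h | h
  · rw [qBinom_eq_zero h, qBinom_eq_zero (show m < r + 1 by omega),
      qBinom_eq_zero (show m + 1 < r + 1 by omega)]
    simp
  · obtain ⟨d, rfl⟩ := Nat.exists_eq_add_of_le h
    rw [qBinom_succ_succ, qBinom_succ_right, Nat.add_sub_cancel_left]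
    have h1 := qInt_ne_zero (Nat.succ_ne_zero r)
    have key : w ^ (r + 1) * qInt (r + d + 1) = qInt d + w ^ (r + d + 1) * qInt (r + 1) := by
      have hv := v_ne_zero
      have h2 := v_sub_inv_ne_zero
      have e : v ^ (r + 1) * v⁻¹ ^ (r + 1) = 1 := by
        rw [← mul_pow, mul_inv_cancel₀ hv, one_pow]
      have e3 : v⁻¹ ^ (r + d + 1) = v⁻¹ ^ (r + 1) * v⁻¹ ^ d := by ring
      have e4 : v ^ (r + d + 1) = v ^ (r + 1) * v ^ d := by ring
      unfold qInt
      rw [mul_div_assoc', mul_div_assoc', ← add_div]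
      congr 1
      rcases hw with rfl | rfl
      · rw [e3, e4]
        linear_combination (v ^ d - v⁻¹ ^ d) * e
      · rw [e3, e4]
        linear_combination (v ^ d - v⁻¹ ^ d) * e
    field_simp
    linear_combination qBinom (r + d) r * key

variable {A : Type*} [Ring A] [Algebra Qv A]

/-- Iterated skew commutators. -/
def skew (w t : Qv) (x y : A) : ℕ → A
  | 0 => y
  | k + 1 => skew w t x y k * x - (t * w ^ (2 * k)) • (x * skew w t x y k)

theorem skew_eq_sum (w t : Qv) (hw : w = v ∨ w = v⁻¹) (x y : A) (m : ℕ) :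
    skew w t x y m = ∑ r ∈ Finset.range (m + 1),
      ((-1) ^ r * w ^ ((r : ℤ) * (m - 1)) * t ^ r * qBinom m r) • (x ^ r * y * x ^ (m - r)) := by
  have hw0 : w ≠ 0 := by
    rcases hw with rfl | rfl
    · exact v_ne_zero
    · exact inv_ne_zero v_ne_zero
  induction m with
  | zero => simp [skew, qBinom_zero_right]
  | succ m ih =>
    rw [skew, ih, Finset.sum_range_succ' _ (m + 1), Finset.sum_mul, Finset.mul_sum, Finset.smul_sum]
    have hA : ∑ r ∈ Finset.range (m + 1),
        ((-1) ^ r * w ^ ((r : ℤ) * (m - 1)) * t ^ r * qBinom m r) • (x ^ r * y * x ^ (m - r)) * x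
        = (∑ r ∈ Finset.range (m + 1), ((-1) ^ (r + 1) * w ^ (((r : ℤ) + 1) * (m - 1))
            * t ^ (r + 1) * qBinom m (r + 1)) • (x ^ (r + 1) * y * x ^ (m - r))) + y * x ^ (m + 1) := by
      have h1 : ∀ r ∈ Finset.range (m + 1),
          ((-1) ^ r * w ^ ((r : ℤ) * (m - 1)) * t ^ r * qBinom m r) • (x ^ r * y * x ^ (m - r)) * x
          = ((-1) ^ r * w ^ ((r : ℤ) * (m - 1)) * t ^ r * qBinom m r) •
              (x ^ r * y * x ^ (m + 1 - r)) := by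
        intro r hr
        have : m + 1 - r = m - r + 1 := by have := Finset.mem_range.1 hr; omega
        rw [this, pow_succ, smul_mul_assoc]
        simp only [mul_assoc]
      rw [Finset.sum_congr rfl h1, Finset.sum_range_succ' _ m, Finset.sum_range_succ _ m]
      rw [qBinom_eq_zero (Nat.lt_succ_self m)]
      simp [qBinom_zero_right]
    rw [hA, add_sub_right_comm, ← Finset.sum_sub_distrib]
    congr 1
    · refine Finset.sum_congr rfl fun r hr => ?_
      rw [Nat.add_sub_add_right, mul_smul_comm, smul_smul]
      have h2 : x * (x ^ r * y * x ^ (m - r)) = x ^ (r + 1) * y * x ^ (m - r) := by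
        rw [pow_succ' x r]; simp only [mul_assoc]
      rw [h2, ← sub_smul]
      congr 1
      have hp := pascal w hw m r
      have e1 : w ^ (((r + 1 : ℕ) : ℤ) * (((m + 1 : ℕ) : ℤ) - 1))
          = w ^ (((r : ℤ) + 1) * (m - 1)) * w ^ (r + 1) := by
        rw [← zpow_natCast w (r + 1), ← zpow_add₀ hw0]; congr 1; push_cast; ring
      have e2 : w ^ (2 * m) * w ^ ((r : ℤ) * (m - 1))
          = w ^ (((r : ℤ) + 1) * (m - 1)) * w ^ (m + 1) := by
        rw [← zpow_natCast w (2 * m), ← zpow_natCast w (m + 1), ← zpow_add₀ hw0, ← zpow_add₀ hw0]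
        congr 1; push_cast; ring
      rw [e1]
      linear_combination (-((-1) ^ r * t ^ (r + 1) * qBinom m r)) * e2
        + ((-1) ^ r * t ^ (r + 1) * w ^ (((r : ℤ) + 1) * (m - 1))) * hp
    · simp [qBinom_zero_right]

theorem serre_eq_skew (m : ℕ) (x y : A) : serre m x y = skew v (v ^ (1 - (m : ℤ))) x y m := by
  rw [skew_eq_sum _ _ (Or.inl rfl), serre]
  refine Finset.sum_congr rfl fun r _ => ?_
  congr 2
  rw [mul_assoc, ← zpow_natCast (v ^ (1 - (m : ℤ))), ← zpow_mul, ← zpow_add₀ v_ne_zero]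
  ring_nf
  simp

theorem serre_eq_skew_inv (m : ℕ) (x y : A) :
    serre m x y = skew v⁻¹ (v ^ ((m : ℤ) - 1)) x y m := by
  rw [skew_eq_sum _ _ (Or.inr rfl), serre]
  refine Finset.sum_congr rfl fun r _ => ?_
  congr 2
  rw [mul_assoc, ← zpow_natCast (v ^ ((m : ℤ) - 1)), ← zpow_mul, inv_zpow', ← zpow_add₀ v_ne_zero]
  ring_nf
  simp

theorem skew_add_left (w t : Qv) (a b y : A) (hab : a * b = w ^ 2 • (b * a))
    (hy : y * b = t • (b * y)) (k : ℕ) :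
    skew w t (a + b) y k = skew w t a y k ∧
      skew w t a y k * b = (t * w ^ (2 * k)) • (b * skew w t a y k) := by
  induction k with
  | zero => simpa [skew] using hy
  | succ k ih =>
    obtain ⟨h1, h2⟩ := ih
    constructor
    · rw [skew, skew, h1, mul_add, add_mul, h2, smul_add]
      abel
    · rw [skew]
      set T := skew w t a y k with hT
      have e1 : T * a * b = (w ^ 2 * (t * w ^ (2 * k))) • (b * (T * a)) := by
        rw [mul_assoc, hab, mul_smul_comm, ← mul_assoc, h2, smul_mul_assoc, smul_smul, mul_assoc]
      have e2 : a * T * b = (w ^ 2 * (t * w ^ (2 * k))) • (b * (a * T)) := by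
        rw [mul_assoc, h2, mul_smul_comm, ← mul_assoc, hab, smul_mul_assoc, smul_smul, mul_assoc b,
          mul_comm (w ^ 2)]
      rw [sub_mul, e1, smul_mul_assoc, e2, mul_sub, smul_sub, mul_smul_comm, smul_smul, smul_smul]
      congr 1
      · congr 1; ring
      · congr 1; ring

theorem skew_add_right (w t : Qv) (x y z : A) (k : ℕ) :
    skew w t x (y + z) k = skew w t x y k + skew w t x z k := by
  induction k with
  | zero => rfl
  | succ k ih => rw [skew, skew, skew, ih, add_mul, mul_add, smul_add]; abel

/-- Additivity of the quantum Serre expression on skew-primitive sums. -/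
theorem serre_add (m : ℕ) (a b a' b' : A) (hba : b * a = v ^ (2 : ℤ) • (a * b))
    (hba' : b * a' = v ^ (1 - (m : ℤ)) • (a' * b)) (hb'a : b' * a = v ^ (1 - (m : ℤ)) • (a * b')) :
    serre m (a + b) (a' + b') = serre m a a' + serre m b b' := by
  have hv := v_ne_zero
  have hadd : serre m (a + b) (a' + b') = serre m (a + b) a' + serre m (a + b) b' := by
    simp only [serre_eq_skew, skew_add_right]
  rw [hadd]
  congr 1
  · rw [serre_eq_skew_inv, serre_eq_skew_inv]
    refine (skew_add_left _ _ _ _ _ ?_ ?_ m).1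
    · rw [hba, smul_smul, ← zpow_natCast v⁻¹ 2, inv_zpow', ← zpow_add₀ hv]
      simp
    · rw [hba', smul_smul, ← zpow_add₀ hv]
      simp
  · rw [serre_eq_skew, serre_eq_skew, add_comm a b]
    refine (skew_add_left _ _ _ _ _ ?_ hb'a m).1
    rw [hba]
    norm_cast

theorem serre_map {B : Type*} [Ring B] [Algebra Qv B] (f : A →ₐ[Qv] B) (m : ℕ) (x y : A) :
    f (serre m x y) = serre m (f x) (f y) := by
  simp [serre]

theorem serre_tmul_left {B : Type*} [Ring B] [Algebra Qv B] (m : ℕ) (k k' : A)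
    (h : k * k' = k' * k) (x y : B) :
    serre m (k ⊗ₜ[Qv] x) (k' ⊗ₜ[Qv] y) = (k ^ m * k') ⊗ₜ[Qv] serre m x y := by
  rw [serre, serre, TensorProduct.tmul_sum]
  refine Finset.sum_congr rfl fun r hr => ?_
  have hr' : r + (m - r) = m := by have := Finset.mem_range.1 hr; omega
  have hc : Commute k' (k ^ (m - r)) := (Commute.pow_left (show Commute k k' from h) _).symm
  rw [TensorProduct.tmul_smul, Algebra.TensorProduct.tmul_pow, Algebra.TensorProduct.tmul_pow,
    Algebra.TensorProduct.tmul_mul_tmul, Algebra.TensorProduct.tmul_mul_tmul, mul_assoc, hc.eq,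
    ← mul_assoc, ← pow_add, hr']

theorem serre_tmul_right {B : Type*} [Ring B] [Algebra Qv B] (m : ℕ) (k k' : B)
    (h : k * k' = k' * k) (x y : A) :
    serre m (x ⊗ₜ[Qv] k) (y ⊗ₜ[Qv] k') = serre m x y ⊗ₜ[Qv] (k ^ m * k') := by
  rw [serre, serre, TensorProduct.sum_tmul]
  refine Finset.sum_congr rfl fun r hr => ?_
  have hr' : r + (m - r) = m := by have := Finset.mem_range.1 hr; omega
  have hc : Commute k' (k ^ (m - r)) := (Commute.pow_left (show Commute k k' from h) _).symm
  rw [← TensorProduct.smul_tmul', Algebra.TensorProduct.tmul_pow, Algebra.TensorProduct.tmul_pow,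
    Algebra.TensorProduct.tmul_mul_tmul, Algebra.TensorProduct.tmul_mul_tmul, mul_assoc (k ^ r),
    hc.eq, ← mul_assoc (k ^ r), ← pow_add, hr']

theorem DJRel.map {I : Type*} {C : SymmetricGCM I} {B : Type*} [Ring B] [Algebra Qv B]
    (f : A →ₐ[Qv] B) {E F K L : I → A} {x y : A} (h : DJRel C E F K L x y) :
    DJRel C (fun i => f (E i)) (fun i => f (F i)) (fun i => f (K i)) (fun i => f (L i))
      (f x) (f y) := by
  cases h with
  | EF_same i =>
    simpa using DJRel.EF_same (C := C) (E := fun i => f (E i)) (F := fun i => f (F i))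
      (K := fun i => f (K i)) (L := fun i => f (L i)) i
  | EF_diff i j h =>
    simpa using DJRel.EF_diff (C := C) (E := fun i => f (E i)) (F := fun i => f (F i))
      (K := fun i => f (K i)) (L := fun i => f (L i)) i j h
  | KK i j =>
    simpa using DJRel.KK (C := C) (E := fun i => f (E i)) (F := fun i => f (F i))
      (K := fun i => f (K i)) (L := fun i => f (L i)) i j
  | KL i j =>
    simpa using DJRel.KL (C := C) (E := fun i => f (E i)) (F := fun i => f (F i))
      (K := fun i => f (K i)) (L := fun i => f (L i)) i j
  | LL i j =>
    simpa using DJRel.LL (C := C) (E := fun i => f (E i)) (F := fun i => f (F i))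
      (K := fun i => f (K i)) (L := fun i => f (L i)) i j
  | KE i j => rw [map_mul, map_smul, map_mul]; exact DJRel.KE i j
  | KF i j => rw [map_mul, map_smul, map_mul]; exact DJRel.KF i j
  | LE i j => rw [map_mul, map_smul, map_mul]; exact DJRel.LE i j
  | LF i j => rw [map_mul, map_smul, map_mul]; exact DJRel.LF i j
  | serreE i j h => rw [serre_map, map_zero]; exact DJRel.serreE i j h
  | serreF i j h => rw [serre_map, map_zero]; exact DJRel.serreF i j h

end Aux

namespace UTilde

variable {I : Type*} (C : SymmetricGCM I)

/-- The images of the generators of `Ũ` under a map given by six families. -/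
def genMap {A : Type*} (e f k kinv l linv : I → A) : DGen I → A
  | DGen.E i => e i
  | DGen.F i => f i
  | DGen.K i => k i
  | DGen.Kinv i => kinv i
  | DGen.L i => l i
  | DGen.Linv i => linv i

/-- The universal property of `Ũ`. -/
def lift {A : Type*} [Ring A] [Algebra Qv A] (e f k kinv l linv : I → A)
    (h1 : ∀ i, k i * kinv i = 1) (h2 : ∀ i, kinv i * k i = 1)
    (h3 : ∀ i, l i * linv i = 1) (h4 : ∀ i, linv i * l i = 1)
    (h : ∀ x y, DJRel C e f k l x y → x = y) : UTilde C →ₐ[Qv] A :=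
  RingQuot.liftAlgHom Qv ⟨FreeAlgebra.lift Qv (genMap e f k kinv l linv), by
    intro x y hxy
    cases hxy with
    | K_Kinv i => simpa [genMap] using h1 i
    | Kinv_K i => simpa [genMap] using h2 i
    | L_Linv i => simpa [genMap] using h3 i
    | Linv_L i => simpa [genMap] using h4 i
    | dj x y hd =>
      have := hd.map (FreeAlgebra.lift Qv (genMap e f k kinv l linv))
      simp only [FreeAlgebra.lift_ι_apply, genMap] at this
      exact h _ _ this⟩

theorem lift_of {A : Type*} [Ring A] [Algebra Qv A] (e f k kinv l linv : I → A)
    (h1 : ∀ i, k i * kinv i = 1) (h2 : ∀ i, kinv i * k i = 1)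
    (h3 : ∀ i, l i * linv i = 1) (h4 : ∀ i, linv i * l i = 1)
    (h : ∀ x y, DJRel C e f k l x y → x = y) (g : DGen I) :
    lift C e f k kinv l linv h1 h2 h3 h4 h (of C g) = genMap e f k kinv l linv g := by
  unfold lift of
  erw [RingQuot.liftAlgHom_mkAlgHom_apply]
  simp

theorem rel {x y : UTilde C} (h : DJRel C (E C) (F C) (K C) (L C) x y) : x = y := by
  have key : ∀ a b : FreeAlgebra Qv (DGen I), DRel C a b →
      RingQuot.mkAlgHom Qv (DRel C) a = RingQuot.mkAlgHom Qv (DRel C) b :=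
    fun a b hab => RingQuot.mkAlgHom_rel Qv hab
  let φ : FreeAlgebra Qv (DGen I) →ₐ[Qv] UTilde C := RingQuot.mkAlgHom Qv (DRel C)
  have hφ : ∀ a b, DJRel C (fun i => FreeAlgebra.ι Qv (DGen.E i))
      (fun i => FreeAlgebra.ι Qv (DGen.F i)) (fun i => FreeAlgebra.ι Qv (DGen.K i))
      (fun i => FreeAlgebra.ι Qv (DGen.L i)) a b → φ a = φ b :=
    fun a b hab => key a b (DRel.dj a b hab)
  have hE : ∀ i, E C i = φ (FreeAlgebra.ι Qv (DGen.E i)) := fun _ => rfl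
  have hF : ∀ i, F C i = φ (FreeAlgebra.ι Qv (DGen.F i)) := fun _ => rfl
  have hK : ∀ i, K C i = φ (FreeAlgebra.ι Qv (DGen.K i)) := fun _ => rfl
  have hL : ∀ i, L C i = φ (FreeAlgebra.ι Qv (DGen.L i)) := fun _ => rfl
  cases h with
  | EF_same i =>
    simpa only [hE, hF, hK, hL, map_mul, map_sub, map_smul] using
      hφ _ _ (DJRel.EF_same i)
  | EF_diff i j h =>
    simpa only [hE, hF, hK, hL, map_mul, map_sub, map_zero] using
      hφ _ _ (DJRel.EF_diff i j h)
  | KK i j =>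
    simpa only [hE, hF, hK, hL, map_mul] using
      hφ _ _ (DJRel.KK i j)
  | KL i j =>
    simpa only [hE, hF, hK, hL, map_mul] using
      hφ _ _ (DJRel.KL i j)
  | LL i j =>
    simpa only [hE, hF, hK, hL, map_mul] using
      hφ _ _ (DJRel.LL i j)
  | KE i j =>
    simpa only [hE, hF, hK, hL, map_mul, map_smul] using
      hφ _ _ (DJRel.KE i j)
  | KF i j =>
    simpa only [hE, hF, hK, hL, map_mul, map_smul] using
      hφ _ _ (DJRel.KF i j)
  | LE i j =>
    simpa only [hE, hF, hK, hL, map_mul, map_smul] using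
      hφ _ _ (DJRel.LE i j)
  | LF i j =>
    simpa only [hE, hF, hK, hL, map_mul, map_smul] using
      hφ _ _ (DJRel.LF i j)
  | serreE i j h =>
    simpa only [hE, hF, hK, hL, serre_map, map_zero] using
      hφ _ _ (DJRel.serreE i j h)
  | serreF i j h =>
    simpa only [hE, hF, hK, hL, serre_map, map_zero] using
      hφ _ _ (DJRel.serreF i j h)

theorem K_Kinv (i : I) : K C i * Kinv C i = 1 := by
  have h : RingQuot.mkAlgHom Qv (DRel C) _ = RingQuot.mkAlgHom Qv (DRel C) _ :=
    RingQuot.mkAlgHom_rel Qv (DRel.K_Kinv i)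
  rw [map_mul, map_one] at h
  exact h

theorem Kinv_K (i : I) : Kinv C i * K C i = 1 := by
  have h : RingQuot.mkAlgHom Qv (DRel C) _ = RingQuot.mkAlgHom Qv (DRel C) _ :=
    RingQuot.mkAlgHom_rel Qv (DRel.Kinv_K i)
  rw [map_mul, map_one] at h
  exact h

theorem L_Linv (i : I) : L C i * Linv C i = 1 := by
  have h : RingQuot.mkAlgHom Qv (DRel C) _ = RingQuot.mkAlgHom Qv (DRel C) _ :=
    RingQuot.mkAlgHom_rel Qv (DRel.L_Linv i)
  rw [map_mul, map_one] at h
  exact h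

theorem Linv_L (i : I) : Linv C i * L C i = 1 := by
  have h : RingQuot.mkAlgHom Qv (DRel C) _ = RingQuot.mkAlgHom Qv (DRel C) _ :=
    RingQuot.mkAlgHom_rel Qv (DRel.Linv_L i)
  rw [map_mul, map_one] at h
  exact h

theorem toNat_cast {i j : I} (h : i ≠ j) : 1 - (((1 - C i j).toNat : ℕ) : ℤ) = C i j := by
  have := C.offDiag i j h
  omega

/-- The elements `Δ(E i)`, `Δ(F i)`, `Δ(K̃ i)`, `Δ(K̃' i)` satisfy the relations of `Ũ`. -/
theorem comul_rel (x y : UTilde C ⊗[Qv] UTilde C)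
    (h : DJRel C (fun i => E C i ⊗ₜ[Qv] 1 + K C i ⊗ₜ[Qv] E C i)
      (fun i => 1 ⊗ₜ[Qv] F C i + F C i ⊗ₜ[Qv] L C i)
      (fun i => K C i ⊗ₜ[Qv] K C i) (fun i => L C i ⊗ₜ[Qv] L C i) x y) : x = y := by
  have hv := v_ne_zero
  have KK := fun i j => rel C (DJRel.KK i j)
  have KL := fun i j => rel C (DJRel.KL i j)
  have LL := fun i j => rel C (DJRel.LL i j)
  have KE := fun i j => rel C (DJRel.KE i j)
  have KF := fun i j => rel C (DJRel.KF i j)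
  have LE := fun i j => rel C (DJRel.LE i j)
  have LF := fun i j => rel C (DJRel.LF i j)
  have cross : ∀ i j, (K C i * F C j) ⊗ₜ[Qv] (E C i * L C j)
      = (F C j * K C i) ⊗ₜ[Qv] (L C j * E C i) := by
    intro i j
    rw [KF, LE, TensorProduct.tmul_smul, ← TensorProduct.smul_tmul', C.symm j i]
  have EFgen : ∀ i j, (E C i ⊗ₜ[Qv] 1 + K C i ⊗ₜ[Qv] E C i) * (1 ⊗ₜ[Qv] F C j + F C j ⊗ₜ[Qv] L C j)
      - (1 ⊗ₜ[Qv] F C j + F C j ⊗ₜ[Qv] L C j) * (E C i ⊗ₜ[Qv] 1 + K C i ⊗ₜ[Qv] E C i)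
      = (E C i * F C j - F C j * E C i) ⊗ₜ[Qv] L C j
        + K C i ⊗ₜ[Qv] (E C i * F C j - F C j * E C i) := by
    intro i j
    simp only [mul_add, add_mul, Algebra.TensorProduct.tmul_mul_tmul, one_mul, mul_one,
      TensorProduct.sub_tmul, TensorProduct.tmul_sub, cross]
    abel
  cases h with
  | EF_same i =>
    rw [EFgen, rel C (DJRel.EF_same i), TensorProduct.tmul_smul, ← TensorProduct.smul_tmul',
      ← smul_add, TensorProduct.sub_tmul, TensorProduct.tmul_sub]
    congr 1
    abel
  | EF_diff i j h =>
    rw [EFgen, rel C (DJRel.EF_diff i j h)]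
    simp
  | KK i j => simp only [Algebra.TensorProduct.tmul_mul_tmul, KK i j]
  | KL i j => simp only [Algebra.TensorProduct.tmul_mul_tmul, KL i j]
  | LL i j => simp only [Algebra.TensorProduct.tmul_mul_tmul, LL i j]
  | KE i j =>
    simp only [mul_add, add_mul, Algebra.TensorProduct.tmul_mul_tmul, one_mul, mul_one, KE i j,
      KK i j, TensorProduct.tmul_smul, ← TensorProduct.smul_tmul', smul_add]
  | KF i j =>
    simp only [mul_add, add_mul, Algebra.TensorProduct.tmul_mul_tmul, one_mul, mul_one, KF i j,
      KL i j, TensorProduct.tmul_smul, ← TensorProduct.smul_tmul', smul_add]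
  | LE i j =>
    simp only [mul_add, add_mul, Algebra.TensorProduct.tmul_mul_tmul, one_mul, mul_one, LE i j,
      ← KL j i, TensorProduct.tmul_smul, ← TensorProduct.smul_tmul', smul_add]
  | LF i j =>
    simp only [mul_add, add_mul, Algebra.TensorProduct.tmul_mul_tmul, one_mul, mul_one, LF i j,
      LL i j, TensorProduct.tmul_smul, ← TensorProduct.smul_tmul', smul_add]
  | serreE i j h =>
    have hm := toNat_cast C h
    rw [serre_add]
    · rw [serre_tmul_left _ _ _ (KK i j), rel C (DJRel.serreE i j h), TensorProduct.tmul_zero,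
        add_zero]
      have := serre_map (Algebra.TensorProduct.includeLeft : UTilde C →ₐ[Qv] UTilde C ⊗[Qv] UTilde C)
        (1 - C i j).toNat (E C i) (E C j)
      rw [rel C (DJRel.serreE i j h), map_zero] at this
      exact this.symm
    · rw [Algebra.TensorProduct.tmul_mul_tmul, Algebra.TensorProduct.tmul_mul_tmul, KE, C.diag,
        one_mul, mul_one, ← TensorProduct.smul_tmul']
    · rw [Algebra.TensorProduct.tmul_mul_tmul, Algebra.TensorProduct.tmul_mul_tmul, KE, hm,
        one_mul, mul_one, ← TensorProduct.smul_tmul']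
    · rw [Algebra.TensorProduct.tmul_mul_tmul, Algebra.TensorProduct.tmul_mul_tmul, KE, hm,
        one_mul, mul_one, ← TensorProduct.smul_tmul', C.symm j i]
  | serreF i j h =>
    have hm := toNat_cast C h
    rw [serre_add]
    · rw [serre_tmul_right _ _ _ (LL i j), rel C (DJRel.serreF i j h), TensorProduct.zero_tmul,
        add_zero]
      have := serre_map (Algebra.TensorProduct.includeRight :
        UTilde C →ₐ[Qv] UTilde C ⊗[Qv] UTilde C) (1 - C i j).toNat (F C i) (F C j)
      rw [rel C (DJRel.serreF i j h), map_zero] at this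
      exact this.symm
    · rw [Algebra.TensorProduct.tmul_mul_tmul, Algebra.TensorProduct.tmul_mul_tmul, LF, C.diag,
        one_mul, mul_one, TensorProduct.tmul_smul]
    · rw [Algebra.TensorProduct.tmul_mul_tmul, Algebra.TensorProduct.tmul_mul_tmul, LF, hm,
        one_mul, mul_one, TensorProduct.tmul_smul]
    · rw [Algebra.TensorProduct.tmul_mul_tmul, Algebra.TensorProduct.tmul_mul_tmul, LF, hm,
        one_mul, mul_one, TensorProduct.tmul_smul, C.symm j i]

/-- The comultiplication `Δ : Ũ → Ũ ⊗ Ũ`, the algebra homomorphism with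
`Δ(E i) = E i ⊗ 1 + K̃ i ⊗ E i`, `Δ(F i) = 1 ⊗ F i + F i ⊗ K̃' i`, `Δ(K̃ i) = K̃ i ⊗ K̃ i`,
`Δ(K̃' i) = K̃' i ⊗ K̃' i`. -/
def comul : UTilde C →ₐ[Qv] UTilde C ⊗[Qv] UTilde C :=
  lift C (fun i => E C i ⊗ₜ[Qv] 1 + K C i ⊗ₜ[Qv] E C i)
    (fun i => 1 ⊗ₜ[Qv] F C i + F C i ⊗ₜ[Qv] L C i)
    (fun i => K C i ⊗ₜ[Qv] K C i) (fun i => Kinv C i ⊗ₜ[Qv] Kinv C i)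
    (fun i => L C i ⊗ₜ[Qv] L C i) (fun i => Linv C i ⊗ₜ[Qv] Linv C i)
    (fun i => by
      rw [Algebra.TensorProduct.tmul_mul_tmul, K_Kinv, Algebra.TensorProduct.one_def])
    (fun i => by
      rw [Algebra.TensorProduct.tmul_mul_tmul, Kinv_K, Algebra.TensorProduct.one_def])
    (fun i => by
      rw [Algebra.TensorProduct.tmul_mul_tmul, L_Linv, Algebra.TensorProduct.one_def])
    (fun i => by
      rw [Algebra.TensorProduct.tmul_mul_tmul, Linv_L, Algebra.TensorProduct.one_def])
    (comul_rel C)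

theorem comul_E (i : I) : comul C (E C i) = E C i ⊗ₜ[Qv] 1 + K C i ⊗ₜ[Qv] E C i :=
  lift_of ..

theorem comul_F (i : I) : comul C (F C i) = 1 ⊗ₜ[Qv] F C i + F C i ⊗ₜ[Qv] L C i :=
  lift_of ..

theorem comul_K (i : I) : comul C (K C i) = K C i ⊗ₜ[Qv] K C i :=
  lift_of ..

theorem comul_L (i : I) : comul C (L C i) = L C i ⊗ₜ[Qv] L C i :=
  lift_of ..

end UTilde

/-! ## Quasi-split `ı`quantum groups -/

/-- An involution of the Cartan matrix `C`: a permutation `τ` of `I` with `τ² = id` and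
`c (τ i) (τ j) = c i j`.  The identity is allowed. -/
structure IsInvolution {I : Type*} (C : SymmetricGCM I) (τ : I → I) : Prop where
  involutive : Function.Involutive τ
  entry_eq : ∀ i j, C (τ i) (τ j) = C i j

/-- `J` is a set of representatives of the orbits `{i, τ i}` of the involution `τ`. -/
def IsOrbitReps {I : Type*} (τ : I → I) (J : Set I) : Prop :=
  ∀ i, ∃! j, j ∈ J ∧ (j = i ∨ j = τ i)

section Universal

variable {I : Type*} (C : SymmetricGCM I) (τ : I → I)

/-- `B i = F i + E (τ i) K̃' i` in `Ũ`. -/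
def BTilde (i : I) : UTilde C := UTilde.F C i + UTilde.E C (τ i) * UTilde.L C i

/-- `k̃ i = K̃ i K̃' (τ i)` in `Ũ`. -/
def kTilde (i : I) : UTilde C := UTilde.K C i * UTilde.L C (τ i)

/-- The inverse of `k̃ i` in `Ũ`. -/
def kTildeInv (i : I) : UTilde C := UTilde.Linv C (τ i) * UTilde.Kinv C i

/-- The universal `ı`quantum group `Ũ^ı`: the subalgebra of `Ũ` generated by the `B i` and the
`k̃ i^{±1}`, for `i ∈ I`. -/
def UiTilde : Subalgebra Qv (UTilde C) :=
  Algebra.adjoin Qv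
    (Set.range (BTilde C τ) ∪ Set.range (kTilde C τ) ∪ Set.range (kTildeInv C τ))

/-- `B i` as an element of `Ũ^ı`. -/
def UiTilde.B (i : I) : UiTilde C τ :=
  ⟨BTilde C τ i, Algebra.subset_adjoin (Or.inl (Or.inl ⟨i, rfl⟩))⟩

/-- `k̃ i` as an element of `Ũ^ı`. -/
def UiTilde.k (i : I) : UiTilde C τ :=
  ⟨kTilde C τ i, Algebra.subset_adjoin (Or.inl (Or.inr ⟨i, rfl⟩))⟩

/-- The two-sided ideal of `Ũ^ı` generated by `k̃ i - ς i` for `τ i = i` and by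
`k̃ i k̃ (τ i) - ς i ς (τ i)` for `τ i ≠ i`. -/
def reductionIdeal (ς : I → Qv) : TwoSidedIdeal (UiTilde C τ) :=
  TwoSidedIdeal.span
    ({x | ∃ i, τ i = i ∧ x = UiTilde.k C τ i - algebraMap Qv (UiTilde C τ) (ς i)} ∪
     {x | ∃ i, τ i ≠ i ∧
        x = UiTilde.k C τ i * UiTilde.k C τ (τ i) - algebraMap Qv (UiTilde C τ) (ς i * ς (τ i))})

/-- The quotient algebra of `Ũ^ı` by the two-sided ideal `reductionIdeal`. -/
abbrev CentralReduction (ς : I → Qv) : Type _ := (reductionIdeal C τ ς).ringCon.Quotient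

/-- The quotient map from `Ũ^ı` to its central reduction. -/
def CentralReduction.mk (ς : I → Qv) : UiTilde C τ →ₐ[Qv] CentralReduction C τ ς :=
  (reductionIdeal C τ ς).ringCon.mkₐ Qv

end Universal

section Parameters

variable {I : Type*} (C : SymmetricGCM I) (τ : I → I) (ς : I → Qv) (J : Set I)

/-- `B i = F i + ς i E (τ i) K i ^ (-1)` in `U`. -/
def BElt (i : I) : U C := U.F C i + ς i • (U.E C (τ i) * U.Kinv C i)

/-- `k j = K j K (τ j) ^ (-1)` in `U`. -/
def kElt (j : I) : U C := U.K C j * U.Kinv C (τ j)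

/-- The inverse `K (τ j) K j ^ (-1)` of `k j` in `U`. -/
def kEltInv (j : I) : U C := U.K C (τ j) * U.Kinv C j

/-- The `ı`quantum group `U^ı_ς`: the subalgebra of `U` generated by the `B i` (`i ∈ I`) and the
`k j^{±1}` (`j ∈ J`), where `J` is a set of representatives of the `τ`-orbits. -/
def Ui : Subalgebra Qv (U C) :=
  Algebra.adjoin Qv (Set.range (BElt C τ ς) ∪ kElt C τ '' J ∪ kEltInv C τ '' J)

/-- `B i` as an element of `U^ı_ς`. -/
def Ui.B (i : I) : Ui C τ ς J :=
  ⟨BElt C τ ς i, Algebra.subset_adjoin (Or.inl (Or.inl ⟨i, rfl⟩))⟩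

/-- `k j` as an element of `U^ı_ς`. -/
def Ui.k (j : J) : Ui C τ ς J :=
  ⟨kElt C τ j, Algebra.subset_adjoin (Or.inl (Or.inr ⟨j, j.2, rfl⟩))⟩

/-- `k j ^ (-1)` as an element of `U^ı_ς`. -/
def Ui.kInv (j : J) : Ui C τ ς J :=
  ⟨kEltInv C τ j, Algebra.subset_adjoin (Or.inr ⟨j, j.2, rfl⟩)⟩

end Parameters

/-- A subalgebra `S` of `Ũ` is a right coideal subalgebra if `Δ(S) ⊆ S ⊗ Ũ`, the latter being the
image of `S ⊗ Ũ` in `Ũ ⊗ Ũ`. -/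
def IsRightCoideal {I : Type*} (C : SymmetricGCM I) (S : Subalgebra Qv (UTilde C)) : Prop :=
  ∀ x ∈ S, UTilde.comul C x ∈
    (Algebra.TensorProduct.map S.val (AlgHom.id Qv (UTilde C))).range

end IQG

end

/-!
The isomorphism is induced by a homomorphism `Ũ^ı → U`. The specialization `Ũ → U`, `K̃' i ↦ (K i)⁻¹`
sends `B i` to the element with all parameters equal to `1`, so it is composed with a *twist*
`Θ : Ũ^ı → Ũ` that rescales the summand `E (τ i) K̃' i` of `B i` by `ς i` and `k̃ i` by `ς (τ i)`.
In general this is not the restriction of a rescaling automorphism of `Ũ`. Instead, `Θ` is `(φ ⊗ id)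
Δ` for a linear functional `φ` on `Ũ` that is multiplicative with respect to left multiplication by
`B i` and `k̃ i`, and takes the values `0` and `ς (τ i)` on them (`exists_functional`,
`exists_isTwist`). By the coideal property, `Θ` is multiplicative on `Ũ^ı`, and it is injective
because a twist with the inverse parameters is a left inverse (`exists_twistHom`).

The functional `φ` is constructed on a Verma module, the quotient of the free algebra on the `F i` by
the quantum Serre relations. On the free algebra it is determined by
`φ (F i u) = - φ (E (τ i) K̃' i u)`. The point is that it vanishes on the ideal of the Serre relations:
a right ideal that contains the `B i`, and modulo which the `k̃ i` are scalars, contains the quantum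
Serre expressions in the `F i` (`PreDJ.serre_F_mem`). For `τ i ∉ {i, j}` the Serre expression of `B i`
and `B j` is the sum of those of their summands. For `j = τ i` there are corrections, computed in
`skew_add_left_perturbed`. For `τ i = i` the Serre expressions of the summands satisfy three-term
recursions, in terms of powers of `v` and of `v⁻¹` respectively, and they add up because both are
continuants, with mutually reversed entries (`serre_add_serre_eq_deformedSerre`).

The image of the composite `Ũ^ı → U` is `U^ı_ς` (`range_specialize_comp`), and its kernel contains the
reduction ideal. For the reverse inclusion, the kernel of the specialization `Ũ → U` is generated by
the elements `K̃ i K̃' i - 1`, so it is killed by a linear endomorphism `normalize` of `Ũ` that multiplies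
the homogeneous components with respect to a suitable grading by monomials in the `K̃ i K̃' i`. On the
image under `Θ` of a product of generators of `Ũ^ı` these monomials are `τ`-symmetric, and hence are
images under `Θ` of units of `Ũ^ı` that are congruent to `1` modulo the reduction ideal. Therefore
`normalize (Θ a) = Θ a'` with `a'` congruent to `a`; if `a` is in the kernel, then `Θ a' = 0`, so
`a' = 0`, and `a` is in the reduction ideal (`mk_eq_zero_of_specialize_eq_zero`).
-/

open scoped TensorProduct

noncomputable section

namespace IQG

/-! ### Iterated skew commutators -/

/-- Together with `intAlgebraQv`, lets the tactic `module` treat numerals as scalars in `Qv`. -/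
instance natAlgebraQv : Algebra ℕ Qv := Semiring.toNatAlgebra

/-- The counterpart of `natAlgebraQv` for integers. -/
instance intAlgebraQv : Algebra ℤ Qv := Ring.toIntAlgebra _

section SkewIdentities

variable {A : Type*} [Ring A] [Algebra Qv A]

theorem skew_smul_right (w t r : Qv) (x y : A) (k : ℕ) :
    skew w t x (r • y) k = r • skew w t x y k := by
  induction k with
  | zero => rfl
  | succ k ih => rw [skew, skew, ih, smul_mul_assoc, mul_smul_comm]; module

theorem skew_smul_left (w t r : Qv) (x y : A) (k : ℕ) :
    skew w t (r • x) y k = r ^ k • skew w t x y k := by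
  induction k with
  | zero => simp [skew]
  | succ k ih =>
    rw [skew, skew, ih]
    simp only [smul_mul_assoc, mul_smul_comm]
    module

theorem serre_eq_skew_of (w : Qv) (hw : w = v ∨ w = v⁻¹) (m : ℕ) (x y : A) :
    serre m x y = skew w (w ^ (1 - (m : ℤ))) x y m := by
  rcases hw with rfl | rfl
  · exact serre_eq_skew m x y
  · rw [serre_eq_skew_inv, inv_zpow', neg_sub]

/-- An element that `q`-commutes with `x` and `y` also `q`-commutes with their iterated skew
commutators. -/
theorem qcomm_skew {w t α β : Qv} {x y z : A} (hx : z * x = α • (x * z))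
    (hy : z * y = β • (y * z)) (m : ℕ) :
    z * skew w t x y m = (α ^ m * β) • (skew w t x y m * z) := by
  induction m with
  | zero => simpa [skew] using hy
  | succ k ih =>
    have e1 : z * (skew w t x y k * x) = (α ^ (k + 1) * β) • (skew w t x y k * x * z) := by
      rw [← mul_assoc, ih, smul_mul_assoc, mul_assoc, hx, mul_smul_comm, mul_assoc]; module
    have e2 : z * (x * skew w t x y k) = (α ^ (k + 1) * β) • (x * skew w t x y k * z) := by
      rw [← mul_assoc, hx, smul_mul_assoc, mul_assoc, ih, mul_smul_comm, mul_assoc]; module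
    rw [skew, mul_sub, mul_smul_comm, e1, e2, sub_mul, smul_mul_assoc]; module

/-- Elements `l`, `l'` that `q`-commute with `x` and `y` in a compatible way can be moved out of an
iterated skew commutator. -/
theorem skew_mul_mul (w t α β : Qv) (x y l l' : A) (hlx : l * x = α • (x * l))
    (hly : l * y = β • (y * l)) (hlx' : l' * x = β • (x * l')) (hll : l * l' = l' * l) (k : ℕ) :
    ∃ r : Qv, skew w t (x * l) (y * l') k = r • (skew w t x y k * (l ^ k * l')) := by
  have hlk : ∀ k, l * skew w t x y k = (α ^ k * β) • (skew w t x y k * l) := fun k =>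
    qcomm_skew hlx hly k
  have hpow : ∀ k, l ^ k * l' * x = (α ^ k * β) • (x * (l ^ k * l')) := by
    intro k
    induction k with
    | zero => simpa using hlx'
    | succ k ih =>
      rw [pow_succ', mul_assoc l, mul_assoc l, ih, mul_smul_comm, ← mul_assoc l, hlx,
        smul_mul_assoc, mul_assoc x]; module
  have hll' : ∀ k, l ^ k * l' * l = l ^ (k + 1) * l' := by
    intro k; rw [mul_assoc, ← hll, ← mul_assoc, pow_succ]
  induction k with
  | zero => exact ⟨1, by simp [skew]⟩
  | succ k ih =>
    obtain ⟨r, hr⟩ := ih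
    refine ⟨r * (α ^ k * β), ?_⟩
    rw [skew, skew, hr]
    set T := skew w t x y k with hT
    have e1 : r • (T * (l ^ k * l')) * (x * l) =
        (r * (α ^ k * β)) • (T * x * (l ^ (k + 1) * l')) := by
      rw [smul_mul_assoc, mul_assoc T, ← mul_assoc _ x, hpow, smul_mul_assoc, mul_assoc x, hll',
        mul_smul_comm, mul_assoc T]; module
    have e2 : x * l * (r • (T * (l ^ k * l'))) =
        (r * (α ^ k * β)) • (x * T * (l ^ (k + 1) * l')) := by
      rw [mul_smul_comm, mul_assoc x, ← mul_assoc l, hlk, smul_mul_assoc, mul_assoc T l,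
        ← mul_assoc l, ← pow_succ', mul_smul_comm, mul_assoc x]; module
    rw [e1, e2, sub_mul, smul_mul_assoc]; module

/-- The quantum Serre expression of the elements `x l`, `y l'` vanishes with that of `x`, `y`. -/
theorem serre_mul_mul_eq_zero (m : ℕ) (α β : Qv) (x y l l' : A) (hlx : l * x = α • (x * l))
    (hly : l * y = β • (y * l)) (hlx' : l' * x = β • (x * l')) (hll : l * l' = l' * l)
    (h : serre m x y = 0) : serre m (x * l) (y * l') = 0 := by
  rw [serre_eq_skew] at h ⊢
  obtain ⟨r, hr⟩ := skew_mul_mul v (v ^ (1 - (m : ℤ))) α β x y l l' hlx hly hlx' hll m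
  rw [hr, h, zero_mul, smul_zero]

/-! ### Deformed skew commutators -/

/-- One step of an iterated skew commutator, when `a` and `b` commute up to a scalar, a central
term `ξ` and a term `p` that itself commutes with everything up to scalars: the `p` terms cancel. -/
theorem skew_step {w s : Qv} {a b T G ξ p : A} (hab : a * b = w ^ 2 • (b * a - ξ + p))
    (hT : T * b = s • (b * T) + G) (hp : T * p = s ^ 2 • (p * T)) (hξ : T * ξ = ξ * T) :
    (T * a - s • (a * T)) * b = (s * w ^ 2) • (b * (T * a - s • (a * T))) +
      ((w ^ 2 • (G * a) - s • (a * G)) - (w ^ 2 * (1 - s ^ 2)) • (ξ * T)) := by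
  have e1 : T * a * b = w ^ 2 • (s • (b * (T * a)) + G * a - ξ * T + s ^ 2 • (p * T)) := by
    rw [mul_assoc, hab, mul_smul_comm, mul_add, mul_sub, ← mul_assoc, hT, hp, hξ, add_mul,
      smul_mul_assoc, mul_assoc]
  have e2 : a * T * b = s • (w ^ 2 • (b * (a * T) - ξ * T + p * T)) + a * G := by
    rw [mul_assoc, hT, mul_add, mul_smul_comm, ← mul_assoc, hab, smul_mul_assoc, add_mul, sub_mul,
      mul_assoc]
  rw [sub_mul, smul_mul_assoc, e1, e2, mul_sub, mul_smul_comm]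
  module

/-- The coefficients of the three-term recursion satisfied by the deformed skew commutators. -/
def skewCoeff (w t : Qv) : ℕ → Qv
  | 0 => 0
  | k + 1 => w ^ 2 * (skewCoeff w t k - 1 + (t * w ^ (2 * k)) ^ 2)

section Deformed

variable {w t : Qv} {a b y ξ p : A}

theorem skew_comm_of (hya : ξ * a = a * ξ) (hyy : ξ * y = y * ξ) (k : ℕ) :
    skew w t a y k * ξ = ξ * skew w t a y k := by
  induction k with
  | zero => exact hyy.symm
  | succ k ih =>
    rw [skew, sub_mul, mul_sub, smul_mul_assoc, mul_smul_comm, mul_assoc, ← hya, ← mul_assoc, ih,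
      mul_assoc a, ih, ← mul_assoc a, ← hya, mul_assoc, mul_assoc]

theorem skew_qcomm_of (hpa : a * p = w ^ 4 • (p * a)) (hpy : y * p = t ^ 2 • (p * y)) (k : ℕ) :
    skew w t a y k * p = (t * w ^ (2 * k)) ^ 2 • (p * skew w t a y k) := by
  induction k with
  | zero => simpa [skew] using hpy
  | succ k ih =>
    rw [skew, sub_mul, mul_sub, smul_mul_assoc, mul_smul_comm, mul_assoc, hpa, mul_smul_comm,
      ← mul_assoc, ih, mul_assoc a, ih, mul_smul_comm, ← mul_assoc a, hpa]
    simp only [smul_mul_assoc, mul_assoc]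
    module

/-- Skew commutation of `b` with the iterated skew commutators of `a` and `y`. -/
theorem skew_mul_eq (hab : a * b = w ^ 2 • (b * a - ξ + p)) (hyb : y * b = t • (b * y))
    (hξa : ξ * a = a * ξ) (hξy : ξ * y = y * ξ) (hpa : a * p = w ^ 4 • (p * a))
    (hpy : y * p = t ^ 2 • (p * y)) (k : ℕ) :
    skew w t a y (k + 1) * b = (t * w ^ (2 * (k + 1))) • (b * skew w t a y (k + 1)) +
      skewCoeff w t (k + 1) • (ξ * skew w t a y k) := by
  induction k with
  | zero =>
    have h := skew_step (G := 0) (s := t) (T := y) hab (by simpa using hyb) hpy hξy.symm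
    simp only [skew, skewCoeff, mul_zero, pow_zero, mul_one, zero_add, zero_mul,
      smul_zero] at h ⊢
    rw [h]
    module
  | succ k ih =>
    have h := skew_step hab ih (skew_qcomm_of hpa hpy (k + 1)) (skew_comm_of hξa hξy (k + 1))
    rw [skew, h, skewCoeff.eq_2 w t (k + 1)]
    have e : w ^ 2 • (skewCoeff w t (k + 1) • (ξ * skew w t a y k) * a) -
        (t * w ^ (2 * (k + 1))) • (a * (skewCoeff w t (k + 1) • (ξ * skew w t a y k)))
        = (w ^ 2 * skewCoeff w t (k + 1)) • (ξ * skew w t a y (k + 1)) := by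
      rw [skew, mul_smul_comm, smul_mul_assoc, ← mul_assoc a, ← hξa, mul_sub, mul_smul_comm]
      simp only [mul_assoc]
      module
    rw [e, ← skew]
    module

/-- The three-term recursion for skew commutators in terms of `a + b`. -/
theorem skew_recursion (hab : a * b = w ^ 2 • (b * a - ξ + p)) (hyb : y * b = t • (b * y))
    (hξa : ξ * a = a * ξ) (hξy : ξ * y = y * ξ) (hpa : a * p = w ^ 4 • (p * a))
    (hpy : y * p = t ^ 2 • (p * y)) (k : ℕ) :
    skew w t a y (k + 2) = skew w t a y (k + 1) * (a + b) -
      (t * w ^ (2 * (k + 1))) • ((a + b) * skew w t a y (k + 1)) -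
      skewCoeff w t (k + 1) • (ξ * skew w t a y k) := by
  have h := skew_mul_eq hab hyb hξa hξy hpa hpy k
  rw [skew, mul_add (skew w t a y (k + 1)), h, add_mul]
  module

theorem skew_one_eq (hyb : y * b = t • (b * y)) :
    skew w t a y 1 = y * (a + b) - t • ((a + b) * y) := by
  rw [mul_add, hyb, add_mul]
  simp only [skew, mul_zero, pow_zero, mul_one]
  module

end Deformed

/-- A closed form of the coefficients `skewCoeff`, multiplied by the denominator `1 - w ^ 2`. -/
theorem one_sub_mul_skewCoeff (w t : Qv) (k : ℕ) :
    (1 - w ^ 2) * w ^ 2 * skewCoeff w t k =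
      - w ^ 2 * (1 - w ^ (2 * k)) * (w ^ 2 - t ^ 2 * w ^ (2 * k)) := by
  induction k with
  | zero => simp [skewCoeff]
  | succ k ih =>
    rw [skewCoeff]
    linear_combination w ^ 2 * ih

theorem one_sub_sq_ne_zero (w : Qv) (hw : w = v ∨ w = v⁻¹) : 1 - w ^ 2 ≠ 0 := by
  have h := v_pow_ne_one (n := 2) (by norm_num)
  rcases hw with rfl | rfl
  · exact fun h' => h (by linear_combination -h')
  · intro h'
    rw [inv_pow] at h'
    have hv := v_ne_zero
    field_simp at h'
    exact h (by linear_combination h')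

/-- The recursion coefficients have a symmetry under `k ↦ m - k` and `w ↦ w⁻¹`. -/
theorem skewCoeff_symm (w : Qv) (hw : w = v ∨ w = v⁻¹) (k l : ℕ) :
    skewCoeff w (w ^ (1 - ((k + l : ℕ) : ℤ))) l =
      - w ^ 2 * skewCoeff w⁻¹ (w⁻¹ ^ (1 - ((k + l : ℕ) : ℤ))) k := by
  have hw0 : w ≠ 0 := by
    rcases hw with rfl | rfl
    · exact v_ne_zero
    · exact inv_ne_zero v_ne_zero
  have h1 := one_sub_mul_skewCoeff w (w ^ (1 - ((k + l : ℕ) : ℤ))) l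
  have h2 := one_sub_mul_skewCoeff w⁻¹ (w⁻¹ ^ (1 - ((k + l : ℕ) : ℤ))) k
  have hne := one_sub_sq_ne_zero w hw
  have e1 : (w ^ (1 - ((k + l : ℕ) : ℤ))) ^ 2 * w ^ (2 * l) = w ^ 2 * (w⁻¹) ^ (2 * k) := by
    rw [← zpow_natCast w (2 * l), ← zpow_natCast w⁻¹ (2 * k), inv_zpow',
      ← zpow_natCast (w ^ (1 - ((k + l : ℕ) : ℤ))) 2, ← zpow_mul, ← zpow_natCast w 2,
      ← zpow_add₀ hw0, ← zpow_add₀ hw0]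
    congr 1; push_cast; ring
  have e2 : (w⁻¹ ^ (1 - ((k + l : ℕ) : ℤ))) ^ 2 * w⁻¹ ^ (2 * k) = w⁻¹ ^ 2 * w ^ (2 * l) := by
    rw [inv_zpow', ← zpow_natCast w (2 * l), ← zpow_natCast w⁻¹ (2 * k), inv_zpow',
      ← zpow_natCast (w ^ (-(1 - ((k + l : ℕ) : ℤ)))) 2, ← zpow_mul, ← zpow_natCast w⁻¹ 2,
      inv_zpow', ← zpow_add₀ hw0, ← zpow_add₀ hw0]
    congr 1; push_cast; ring
  rw [e1] at h1
  rw [e2] at h2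
  generalize skewCoeff w (w ^ (1 - ((k + l : ℕ) : ℤ))) l = g at *
  generalize skewCoeff w⁻¹ (w⁻¹ ^ (1 - ((k + l : ℕ) : ℤ))) k = g' at *
  generalize w⁻¹ ^ (2 * k) = α at *
  generalize w ^ (2 * l) = β at *
  have hne' : (1 - w ^ 2) * w ^ 2 ≠ 0 := mul_ne_zero hne (pow_ne_zero _ hw0)
  apply mul_left_cancel₀ hne'
  have h3 : (w ^ 2 - 1) * g' = -((1 - α) * (1 - β)) := by
    have : w ^ 4 * w ^ 2 * ((1 - w⁻¹ ^ 2) * w⁻¹ ^ 2 * g') =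
      w ^ 4 * w ^ 2 * (-w⁻¹ ^ 2 * (1 - α) * (w⁻¹ ^ 2 - w⁻¹ ^ 2 * β)) := by rw [h2]
    field_simp at this ⊢
    linear_combination this
  linear_combination h1 - w ^ 4 * h3

/-- The last coefficient vanishes, so that the quantum Serre expression itself skew commutes with
`b`. -/
theorem skewCoeff_self (w : Qv) (hw : w = v ∨ w = v⁻¹) (m : ℕ) :
    skewCoeff w (w ^ (1 - (m : ℤ))) m = 0 := by
  have := skewCoeff_symm w hw 0 m
  simpa [skewCoeff] using this

/-! ### Continuants -/

/-- The continuant: the determinant of the tridiagonal matrix with diagonal `d 0, …, d (n - 1)` and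
products `e 1, …, e (n - 1)` of opposite off-diagonal entries. -/
def continuant {R : Type*} [Ring R] (d e : ℕ → R) : ℕ → R
  | 0 => 1
  | 1 => d 0
  | n + 2 => d (n + 1) * continuant d e (n + 1) - e (n + 1) * continuant d e n

theorem continuant_congr {R : Type*} [Ring R] {d e d' e' : ℕ → R} (n : ℕ)
    (hd : ∀ k < n, d k = d' k) (he : ∀ k, 0 < k → k < n → e k = e' k) :
    continuant d e n = continuant d' e' n := by
  induction n using Nat.strong_induction_on with
  | _ n ih =>
    match n with
    | 0 => rfl
    | 1 => exact hd 0 one_pos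
    | n + 2 =>
      rw [continuant, continuant, hd (n + 1) (by omega), he (n + 1) (by omega) (by omega),
        ih (n + 1) (by omega) (fun k hk => hd k (by omega)) (fun k h0 hk => he k h0 (by omega)),
        ih n (by omega) (fun k hk => hd k (by omega)) (fun k h0 hk => he k h0 (by omega))]

/-- Expansion of the continuant along its first instead of its last diagonal entry. -/
theorem continuant_succ_left {R : Type*} [Ring R] (d e : ℕ → R) (n : ℕ) :
    continuant d e (n + 2) = continuant (fun k => d (k + 1)) (fun k => e (k + 1)) (n + 1) * d 0 -
      continuant (fun k => d (k + 2)) (fun k => e (k + 2)) n * e 1 := by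
  induction n using Nat.strong_induction_on with
  | _ n ih =>
    match n with
    | 0 => simp [continuant]
    | 1 => simp only [continuant]; noncomm_ring
    | n + 2 =>
      rw [continuant, ih (n + 1) (by omega), ih n (by omega),
        continuant.eq_3 (fun k => d (k + 1)) _ (n + 1), continuant.eq_3 (fun k => d (k + 2)) _ n]
      noncomm_ring

/-- A continuant with commuting entries is unchanged when the sequence of its entries is
reversed. -/
theorem continuant_reverse {R : Type*} [Ring R] (d e : ℕ → R)
    (hdd : ∀ i j, Commute (d i) (d j)) (hde : ∀ i j, Commute (d i) (e j))
    (hee : ∀ i j, Commute (e i) (e j)) (n : ℕ) :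
    continuant (fun k => d (n - 1 - k)) (fun k => e (n - k)) n = continuant d e n := by
  induction n using Nat.strong_induction_on generalizing d e with
  | _ n ih =>
    match n with
    | 0 => rfl
    | 1 => rfl
    | n + 2 =>
      have hc : ∀ (x : R), (∀ i, Commute x (d i)) → (∀ i, Commute x (e i)) → ∀ s n,
          Commute x (continuant (fun k => d (k + s)) (fun k => e (k + s)) n) := by
        intro x hx hx' s n
        induction n using Nat.strong_induction_on with
        | _ n ih =>
          match n with
          | 0 => exact Commute.one_right x
          | 1 => exact hx _
          | n + 2 =>
            exact ((hx _).mul_right (ih (n + 1) (by omega))).sub_right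
              ((hx' _).mul_right (ih n (by omega)))
      rw [continuant_succ_left d e, continuant.eq_3,
        ← (hc (d 0) (hdd 0) (hde 0) 1 (n + 1)).eq,
        ← (hc (e 1) (fun i => (hde i 1).symm) (hee 1) 2 n).eq,
        ← ih (n + 1) (by omega) (fun k => d (k + 1)) (fun k => e (k + 1))
          (fun _ _ => hdd _ _) (fun _ _ => hde _ _) (fun _ _ => hee _ _),
        ← ih n (by omega) (fun k => d (k + 2)) (fun k => e (k + 2))
          (fun _ _ => hdd _ _) (fun _ _ => hde _ _) (fun _ _ => hee _ _)]
      congr 1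
      · congr 1
        · congr 1; omega
        · apply continuant_congr
          · intro k hk; congr 1; omega
          · intro k h0 hk; congr 1; omega
      · congr 1
        · congr 1; omega
        · apply continuant_congr
          · intro k hk; congr 1; omega
          · intro k h0 hk; congr 1; omega

end SkewIdentities

/-! ### The deformed quantum Serre expression -/

section SkewIdentities

variable {A : Type*} [Ring A] [Algebra Qv A]

/-- The operators `T ↦ T x - w ^ (1 - m + 2k) x T` on an algebra, whose composite for `k < m` is
the quantum Serre expression of degree `m`. -/
def skewOp (w : Qv) (x : A) (m k : ℕ) : Module.End Qv A :=
  LinearMap.mulRight Qv x - (w ^ (1 - (m : ℤ)) * w ^ (2 * k)) • LinearMap.mulLeft Qv x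

/-- The off-diagonal entries of the continuant expressing the deformed Serre relation. -/
def skewPerturbation (w : Qv) (ξ : A) (m k : ℕ) : Module.End Qv A :=
  skewCoeff w (w ^ (1 - (m : ℤ))) k • LinearMap.mulLeft Qv ξ

/-- The deformed quantum Serre expression, in which `x ^ r y x ^ (m - r)` is accompanied by terms
of lower degree with powers of `ξ` as coefficients. -/
def deformedSerre (w : Qv) (ξ x : A) (m : ℕ) : Module.End Qv A :=
  continuant (skewOp w x m) (skewPerturbation w ξ m) m

/-- Solution of the three-term recursion `skew_recursion`. -/
theorem skew_eq_continuant {w : Qv} {m : ℕ} {a b y ξ p : A}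
    (hab : a * b = w ^ 2 • (b * a - ξ + p)) (hyb : y * b = w ^ (1 - (m : ℤ)) • (b * y))
    (hξa : ξ * a = a * ξ) (hξy : ξ * y = y * ξ) (hpa : a * p = w ^ 4 • (p * a))
    (hpy : y * p = (w ^ (1 - (m : ℤ))) ^ 2 • (p * y)) (k : ℕ) :
    skew w (w ^ (1 - (m : ℤ))) a y k =
      continuant (skewOp w (a + b) m) (skewPerturbation w ξ m) k y := by
  induction k using Nat.strong_induction_on with
  | _ k ih =>
    match k with
    | 0 => rfl
    | 1 =>
      rw [skew_one_eq hyb]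
      simp [continuant, skewOp]
    | k + 2 =>
      rw [skew_recursion hab hyb hξa hξy hpa hpy, ih (k + 1) (by omega), ih k (by omega),
        continuant]
      rfl

/-- The two expansions of the deformed Serre expression, along `v` and along `v⁻¹`, agree: they are
continuants with reversed entries. -/
theorem deformedSerre_inv (w : Qv) (hw : w = v ∨ w = v⁻¹) (ξ x : A) (hξ : ξ * x = x * ξ) (m : ℕ) :
    deformedSerre w⁻¹ (-(w ^ 2 • ξ)) x m = deformedSerre w ξ x m := by
  have hw0 : w ≠ 0 := by
    rcases hw with rfl | rfl
    · exact v_ne_zero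
    · exact inv_ne_zero v_ne_zero
  have hLR : Commute (LinearMap.mulLeft Qv x) (LinearMap.mulRight Qv x) :=
    LinearMap.commute_mulLeft_right x x
  have hLξ : Commute (LinearMap.mulLeft Qv x) (LinearMap.mulLeft Qv ξ) := by
    ext T; simp [← mul_assoc, hξ]
  have hRξ : Commute (LinearMap.mulRight Qv x) (LinearMap.mulLeft Qv ξ) :=
    (LinearMap.commute_mulLeft_right ξ x).symm
  have hdL : ∀ i, Commute (skewOp w x m i) (LinearMap.mulLeft Qv x) := fun i =>
    hLR.symm.sub_left ((Commute.refl _).smul_left _)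
  have hdR : ∀ i, Commute (skewOp w x m i) (LinearMap.mulRight Qv x) := fun i =>
    (Commute.refl _).sub_left (hLR.smul_left _)
  have hdξ : ∀ i, Commute (skewOp w x m i) (LinearMap.mulLeft Qv ξ) := fun i =>
    hRξ.sub_left (hLξ.smul_left _)
  rw [deformedSerre, deformedSerre, ← continuant_reverse (skewOp w x m) (skewPerturbation w ξ m)
    (fun i j => (hdR i).sub_right ((hdL i).smul_right _))
    (fun i j => (hdξ i).smul_right _) (fun i j => ((Commute.refl _).smul_right _).smul_left _)]
  apply continuant_congr
  · intro k hk
    rw [skewOp, skewOp]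
    congr 2
    rw [← zpow_natCast, ← zpow_natCast, inv_zpow', inv_zpow', ← zpow_add₀ hw0, ← zpow_add₀ hw0]
    congr 1
    push_cast [Nat.cast_sub (show k ≤ m - 1 by omega), Nat.cast_sub (show 1 ≤ m by omega)]
    ring
  · intro k h0 hk
    rw [skewPerturbation, skewPerturbation]
    have h := skewCoeff_symm w hw k (m - k)
    rw [Nat.add_sub_cancel' hk.le] at h
    rw [h]
    ext T
    simp only [LinearMap.smul_apply, LinearMap.mulLeft_apply, neg_mul, smul_mul_assoc]
    module

/-- The deformed Serre expression of `a + b` and `y + y'` splits as a sum of quantum Serre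
expressions, when `a` and `b` commute up to a scalar and an additive correction. -/
theorem serre_add_serre_eq_deformedSerre {m : ℕ} {a b y y' ξ p : A}
    (hab : a * b = v⁻¹ ^ 2 • (b * a - ξ + p))
    (hyb : y * b = v⁻¹ ^ (1 - (m : ℤ)) • (b * y)) (hya : y' * a = v ^ (1 - (m : ℤ)) • (a * y'))
    (hξa : ξ * a = a * ξ) (hξb : ξ * b = b * ξ) (hξy : ξ * y = y * ξ) (hξy' : ξ * y' = y' * ξ)
    (hpa : a * p = v⁻¹ ^ 4 • (p * a)) (hpb : b * p = v ^ 4 • (p * b))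
    (hpy : y * p = (v⁻¹ ^ (1 - (m : ℤ))) ^ 2 • (p * y))
    (hpy' : y' * p = (v ^ (1 - (m : ℤ))) ^ 2 • (p * y')) :
    serre m a y + serre m b y' = deformedSerre v⁻¹ ξ (a + b) m (y + y') := by
  have hv := v_ne_zero
  rw [serre_eq_skew_of v⁻¹ (Or.inr rfl), serre_eq_skew_of v (Or.inl rfl), map_add]
  congr 1
  · exact skew_eq_continuant hab hyb hξa hξy hpa hpy m
  · rw [← deformedSerre_inv v⁻¹ (Or.inr rfl) ξ (a + b) (by rw [mul_add, add_mul, hξa, hξb]),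
      inv_inv, add_comm a b]
    refine skew_eq_continuant (p := -(v⁻¹ ^ 2 • p)) ?_ hya ?_ ?_ ?_ ?_ m
    · rw [hab]
      simp only [smul_add, smul_sub, smul_neg, smul_smul]
      have : v ^ 2 * v⁻¹ ^ 2 = 1 := by rw [← mul_pow, mul_inv_cancel₀ hv, one_pow]
      rw [this]
      module
    · rw [neg_mul, mul_neg, smul_mul_assoc, mul_smul_comm, hξb]
    · rw [neg_mul, mul_neg, smul_mul_assoc, mul_smul_comm, hξy']
    · rw [neg_mul, mul_neg, smul_mul_assoc, mul_smul_comm, hpb]; module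
    · rw [neg_mul, mul_neg, smul_mul_assoc, mul_smul_comm, hpy']; module

/-! ### Skew commutators with a perturbed commutation relation -/

theorem geom_sum_step (q : Qv) (k : ℕ) :
    ∑ j ∈ Finset.range (k + 2), q ^ j = q * ∑ j ∈ Finset.range (k + 1), q ^ j + 1 := by
  rw [Finset.sum_range_succ', Finset.mul_sum]
  simp [pow_succ']

/-- If `y b - t b y = κ + p` where `κ` and `p` commute with `a`, `b` up to suitable scalars, then
for `t = w ^ (1 - m)` and `m ≥ 2` the correction terms involving `p` in the expansion of the `m`-th
skew commutator cancel. -/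
theorem skew_add_left_perturbed {w : Qv} (hw : w ≠ 0) {m : ℕ} {a b y κ p : A}
    (hab : a * b = w ^ 2 • (b * a))
    (hyb : y * b = w ^ (1 - (m : ℤ)) • (b * y) + (κ + p))
    (hκa : κ * a = (w⁻¹ ^ 2 * w ^ (1 - (m : ℤ))) • (a * κ))
    (hκb : κ * b = (w⁻¹ ^ 2 * w ^ (1 - (m : ℤ))) • (b * κ))
    (hpa : p * a = (w⁻¹ ^ 2 * (w ^ (1 - (m : ℤ)))⁻¹) • (a * p))
    (hpb : p * b = (w ^ 2 * w ^ (1 - (m : ℤ))) • (b * p)) (hm : 2 ≤ m) :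
    ∃ r : Qv, skew w (w ^ (1 - (m : ℤ))) (a + b) y m =
      skew w (w ^ (1 - (m : ℤ))) a y m + r • ((a + b) ^ (m - 1) * κ) := by
  have hvanish : ((w ^ (1 - (m : ℤ)))⁻¹ - w ^ (1 - (m : ℤ)) * w ^ (2 * (m - 1))) = 0 := by
    rw [sub_eq_zero, ← zpow_neg, ← zpow_natCast w, ← zpow_add₀ hw]
    congr 1
    push_cast [Nat.cast_sub (show 1 ≤ m by omega)]
    ring
  have ht : w ^ (1 - (m : ℤ)) ≠ 0 := zpow_ne_zero _ hw
  generalize w ^ (1 - (m : ℤ)) = t at *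
  -- the coefficient of the term `a ^ k p` is a multiple of `P k`, and `P (m - 1) = 0`
  set P : ℕ → Qv := fun k => ∏ s ∈ Finset.range k, (t⁻¹ - t * w ^ (2 * (s + 1))) with hP
  have hPs : ∀ k, P (k + 1) = P k * (t⁻¹ - t * w ^ (2 * (k + 1))) := fun k =>
    Finset.prod_range_succ _ _
  have hw2 : w ^ 2 * w⁻¹ ^ 2 = 1 := by rw [← mul_pow, mul_inv_cancel₀ hw, one_pow]
  have hab' : a * b = w ^ 2 • (b * a - 0 + 0) := by rw [hab]; simp
  have hpow : ∀ k, a ^ k * b = w ^ (2 * k) • (b * a ^ k) := by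
    intro k
    induction k with
    | zero => simp
    | succ k ih =>
      rw [pow_succ, mul_assoc, hab, mul_smul_comm, ← mul_assoc, ih, smul_mul_assoc, mul_assoc,
        ← pow_succ]
      module
  have h1 : ∀ k, skew w t a y (k + 1) * b = (t * w ^ (2 * (k + 1))) • (b * skew w t a y (k + 1)) +
      ((t⁻¹ - t) * P k) • (a ^ (k + 1) * p) := by
    intro k
    induction k with
    | zero =>
      have h := skew_step hab' hyb (by simp) (by simp)
      simp only [skew, mul_zero, pow_zero, mul_one]
      rw [h, add_mul, mul_add, hκa, hpa]
      simp only [smul_add, smul_smul, zero_add, mul_one, pow_one, hP, Finset.range_zero,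
        Finset.prod_empty, zero_mul, smul_zero, sub_zero]
      rw [← mul_assoc (w ^ 2), ← mul_assoc (w ^ 2), hw2]
      module
    | succ k ih =>
      have h := skew_step hab' ih (by simp) (by simp)
      rw [skew, h, hPs]
      have e1 : a ^ (k + 1) * p * a = (w⁻¹ ^ 2 * t⁻¹) • (a ^ (k + 2) * p) := by
        rw [mul_assoc, hpa, mul_smul_comm, ← mul_assoc, ← pow_succ]
      have e2 : a * (a ^ (k + 1) * p) = a ^ (k + 2) * p := by rw [← mul_assoc, ← pow_succ']
      rw [smul_mul_assoc, mul_smul_comm, e1, e2]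
      simp only [smul_smul, zero_mul, smul_zero, sub_zero]
      have e3 : w ^ 2 * ((t⁻¹ - t) * P k * (w⁻¹ ^ 2 * t⁻¹)) = (t⁻¹ - t) * P k * t⁻¹ := by
        linear_combination (t⁻¹ - t) * P k * t⁻¹ * hw2
      rw [e3]
      module
  have h2 : ∀ k, ∃ r : Qv, skew w t (a + b) y (k + 1) = skew w t a y (k + 1) +
      r • ((a + b) ^ k * κ) +
      ((∑ j ∈ Finset.range (k + 1), (w⁻¹ ^ 2) ^ j) * P k) • (a ^ k * p) := by
    intro k
    induction k with
    | zero =>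
      refine ⟨1, ?_⟩
      simp only [skew, mul_zero, pow_zero, mul_one, mul_add, add_mul, hyb, hP, Finset.range_zero,
        Finset.prod_empty, zero_add, Finset.range_one, Finset.sum_singleton, one_mul]
      module
    | succ k ih =>
      obtain ⟨r, hr⟩ := ih
      refine ⟨r * (w⁻¹ ^ 2 * t - t * w ^ (2 * (k + 1))), ?_⟩
      rw [skew, hr, hPs]
      set T := skew w t a y (k + 1) with hT
      have hTs : skew w t a y (k + 2) = T * a - (t * w ^ (2 * (k + 1))) • (a * T) := rfl
      rw [hTs]
      have e1 : T * (a + b) = T * a + ((t * w ^ (2 * (k + 1))) • (b * T) +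
          ((t⁻¹ - t) * P k) • (a ^ (k + 1) * p)) := by rw [mul_add, hT, h1]
      have e2 : (a + b) ^ k * κ * (a + b) = (w⁻¹ ^ 2 * t) • ((a + b) ^ (k + 1) * κ) := by
        rw [mul_assoc, mul_add κ, hκa, hκb, ← smul_add, ← add_mul, mul_smul_comm, ← mul_assoc,
          ← pow_succ]
      have e3 : (a + b) * ((a + b) ^ k * κ) = (a + b) ^ (k + 1) * κ := by
        rw [← mul_assoc, ← pow_succ']
      have e4 : a ^ k * p * (a + b) = (w⁻¹ ^ 2 * t⁻¹) • (a ^ (k + 1) * p) +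
          (w ^ 2 * t * w ^ (2 * k)) • (b * a ^ k * p) := by
        rw [mul_add, mul_assoc, hpa, mul_assoc, hpb, mul_smul_comm, mul_smul_comm, ← mul_assoc,
          ← mul_assoc, ← pow_succ, hpow, smul_mul_assoc, smul_smul]
      have e5 : (a + b) * (a ^ k * p) = a ^ (k + 1) * p + b * a ^ k * p := by
        rw [add_mul, ← mul_assoc, ← pow_succ', ← mul_assoc]
      have e6 : (a + b) * T = a * T + b * T := add_mul _ _ _
      clear hr
      generalize a + b = x at *
      rw [add_mul, add_mul, mul_add x, mul_add x, smul_mul_assoc, smul_mul_assoc, mul_smul_comm,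
        mul_smul_comm, e1, e2, e3, e4, e5, e6]
      have e7 : (∑ j ∈ Finset.range (k + 2), (w⁻¹ ^ 2) ^ j) * (P k * (t⁻¹ - t * w ^ (2 * (k + 1))))
          = (∑ j ∈ Finset.range (k + 1), (w⁻¹ ^ 2) ^ j) * P k *
            (w⁻¹ ^ 2 * t⁻¹ - t * w ^ (2 * (k + 1))) + (t⁻¹ - t) * P k := by
        have hs := geom_sum_step (w⁻¹ ^ 2) k
        have hs' := Finset.sum_range_succ (fun j => (w⁻¹ ^ 2) ^ j) (k + 1)
        have hq : (w⁻¹ ^ 2) ^ (k + 1) * w ^ (2 * (k + 1)) = 1 := by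
          rw [← pow_mul, ← mul_pow, inv_mul_cancel₀ hw, one_pow]
        linear_combination P k * t⁻¹ * hs - P k * t * w ^ (2 * (k + 1)) * hs' - P k * t * hq
      rw [show k + 1 + 1 = k + 2 from rfl, e7]
      module
  obtain ⟨r, hr⟩ := h2 (m - 1)
  refine ⟨r, ?_⟩
  rw [show m - 1 + 1 = m by omega] at hr
  have hP0 : P (m - 1) = 0 := by
    obtain ⟨n, hn⟩ := Nat.exists_eq_add_of_le hm
    have e : m - 1 = n + 1 := by omega
    rw [e] at hvanish ⊢
    rw [hPs, hvanish, mul_zero]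
  rw [hr, hP0, mul_zero, zero_smul, add_zero]

end SkewIdentities

/-! ### The Drinfeld-Jimbo relations without the Serre relations -/

section PreDJ

variable {I : Type*} {A : Type*} [Ring A] [Algebra Qv A]

/-- The Drinfeld-Jimbo relations without the quantum Serre relations. -/
structure PreDJ (C : SymmetricGCM I) (E F K L : I → A) : Prop where
  EF_same : ∀ i, E i * F i = F i * E i + (v - v⁻¹)⁻¹ • (K i - L i)
  EF_diff : ∀ i j, i ≠ j → E i * F j = F j * E i
  KK : ∀ i j, K i * K j = K j * K i
  KL : ∀ i j, K i * L j = L j * K i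
  LL : ∀ i j, L i * L j = L j * L i
  KE : ∀ i j, K i * E j = v ^ C i j • (E j * K i)
  KF : ∀ i j, K i * F j = v ^ (-C i j) • (F j * K i)
  LE : ∀ i j, L i * E j = v ^ (-C i j) • (E j * L i)
  LF : ∀ i j, L i * F j = v ^ C i j • (F j * L i)

/-- The symmetry exchanging `E` with `F` and `K` with `K'`. -/
theorem PreDJ.swap {C : SymmetricGCM I} {E F K L : I → A} (h : PreDJ C E F K L) :
    PreDJ C F E L K where
  EF_same i := by
    rw [h.EF_same i, add_assoc, ← smul_add]; simp
  EF_diff i j hij := (h.EF_diff j i hij.symm).symm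
  KK := h.LL
  KL i j := (h.KL j i).symm
  LL := h.KK
  KE := h.LF
  KF := h.LE
  LE := h.KF
  LF := h.KE

theorem skew_mem {w t : Qv} {x y : A} {N : Submodule Qv A} (hN : ∀ T ∈ N, ∀ S, T * S ∈ N)
    (hx : x ∈ N) (hy : y ∈ N) (k : ℕ) : skew w t x y k ∈ N := by
  induction k with
  | zero => exact hy
  | succ k ih => exact N.sub_mem (hN _ ih _) (N.smul_mem _ (hN _ hx _))

theorem continuant_mem {w : Qv} {ξ x y : A} {N : Submodule Qv A} (hN : ∀ T ∈ N, ∀ S, T * S ∈ N)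
    (hx : x ∈ N) (hy : y ∈ N) (hξ : ∀ T ∈ N, ξ * T ∈ N) (m k : ℕ) :
    continuant (skewOp w x m) (skewPerturbation w ξ m) k y ∈ N := by
  have hd : ∀ k, ∀ T ∈ N, skewOp w x m k T ∈ N := fun k T hT =>
    N.sub_mem (hN _ hT _) (N.smul_mem _ (hN _ hx _))
  induction k using Nat.strong_induction_on with
  | _ k ih =>
    match k with
    | 0 => exact hy
    | 1 => exact hd 0 y hy
    | k + 2 =>
      exact N.sub_mem (hd _ _ (ih (k + 1) (by omega))) (N.smul_mem _ (hξ _ (ih k (by omega))))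

theorem skew_eq_zero {w t : Qv} {x y : A} (h : y * x = t • (x * y)) {m : ℕ} (hm : 1 ≤ m) :
    skew w t x y m = 0 := by
  obtain ⟨n, rfl⟩ := Nat.exists_eq_add_of_le' hm
  clear hm
  induction n with
  | zero => simp [skew, h]
  | succ n ih => rw [skew, ih]; simp

theorem mul_skew {w t : Qv} {x y z : A} (h : z * x = x * z) (m : ℕ) :
    z * skew w t x y m = skew w t x (z * y) m := by
  induction m with
  | zero => rfl
  | succ n ih => rw [skew, skew, mul_sub, mul_smul_comm, ← mul_assoc, ih, ← mul_assoc, h, mul_assoc,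
      ih]

theorem skew_mul {w t : Qv} {x y z : A} (h : z * x = x * z) (m : ℕ) :
    skew w t x y m * z = skew w t x (y * z) m := by
  induction m with
  | zero => rfl
  | succ n ih => rw [skew, skew, sub_mul, smul_mul_assoc, mul_assoc, ← h, ← mul_assoc, ih,
      mul_assoc x, ih]

namespace PreDJ

variable {C : SymmetricGCM I} {E F K L : I → A} (h : PreDJ C E F K L)
include h

theorem E_mul_L_mul_F {i j : I} (k : I) (hij : j ≠ i) :
    E i * L k * F j = v ^ C k j • (F j * (E i * L k)) := by
  rw [mul_assoc, h.LF, mul_smul_comm, ← mul_assoc, h.EF_diff i j hij.symm, mul_assoc]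

theorem E_mul_L_mul_F_same (i k : I) :
    E i * L k * F i = v ^ C k i • (F i * (E i * L k)) +
      (v ^ C k i * (v - v⁻¹)⁻¹) • (K i * L k - L k * L i) := by
  rw [mul_assoc, h.LF, mul_smul_comm, ← mul_assoc, h.EF_same, add_mul, smul_mul_assoc, sub_mul,
    mul_assoc, h.LL i k, smul_add, smul_smul]

/-- The commutation relation of the two summands of `B i` for `τ i = i`, in the form required by the
lemmas on deformed skew commutators. -/
theorem F_mul_E_mul_L (i : I) (s : Qv) :
    F i * (s • (E i * L i)) = v⁻¹ ^ 2 • ((s • (E i * L i)) * F i -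
      (s * v ^ 2 * (v - v⁻¹)⁻¹) • (K i * L i) + (s * v ^ 2 * (v - v⁻¹)⁻¹) • (L i * L i)) := by
  rw [smul_mul_assoc, h.E_mul_L_mul_F_same, C.diag, mul_smul_comm]
  have hv : v⁻¹ ^ 2 * v ^ 2 = 1 := by rw [← mul_pow, inv_mul_cancel₀ v_ne_zero, one_pow]
  have e : (v : Qv) ^ (2 : ℤ) = v ^ 2 := by norm_cast
  rw [e, smul_sub (v ^ 2 * (v - v⁻¹)⁻¹)]
  have : ∀ x y z : A, v⁻¹ ^ 2 • (s • (v ^ 2 • x + ((v ^ 2 * (v - v⁻¹)⁻¹) • y -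
      (v ^ 2 * (v - v⁻¹)⁻¹) • z)) - (s * v ^ 2 * (v - v⁻¹)⁻¹) • y +
      (s * v ^ 2 * (v - v⁻¹)⁻¹) • z) = (v⁻¹ ^ 2 * v ^ 2) • (s • x) := by
    intro x y z; module
  rw [this, hv, one_smul]

theorem KL_mul_E (i j : I) : K i * L i * E j = E j * (K i * L i) := by
  rw [mul_assoc, h.LE, mul_smul_comm, ← mul_assoc, h.KE, smul_mul_assoc, smul_smul,
    ← zpow_add₀ v_ne_zero, neg_add_cancel, zpow_zero, one_smul, mul_assoc]

theorem KL_mul_F (i j : I) : K i * L i * F j = F j * (K i * L i) := by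
  rw [mul_assoc, h.LF, mul_smul_comm, ← mul_assoc, h.KF, smul_mul_assoc, smul_smul,
    ← zpow_add₀ v_ne_zero, add_neg_cancel, zpow_zero, one_smul, mul_assoc]

theorem KL_mul_L (i j : I) : K i * L i * L j = L j * (K i * L i) := by
  rw [mul_assoc, h.LL, ← mul_assoc, h.KL, mul_assoc]

theorem F_mul_LL (i j : I) : F j * (L i * L i) = (v⁻¹ ^ C i j) ^ 2 • (L i * L i * F j) := by
  have e : (v⁻¹ ^ C i j) ^ 2 * (v ^ C i j * v ^ C i j) = 1 := by
    rw [inv_zpow, ← mul_inv_cancel₀ (mul_ne_zero (zpow_ne_zero (C i j) v_ne_zero)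
      (zpow_ne_zero (C i j) v_ne_zero))]
    ring
  rw [mul_assoc (L i), h.LF, mul_smul_comm, ← mul_assoc (L i), h.LF, smul_mul_assoc,
    smul_smul, smul_smul, mul_assoc _ _ (_ ^ _), e, one_smul, mul_assoc]

theorem E_mul_LL (i j : I) : E j * (L i * L i) = (v ^ C i j) ^ 2 • (L i * L i * E j) := by
  have e : (v ^ C i j) ^ 2 * (v ^ (-C i j) * v ^ (-C i j)) = 1 := by
    rw [zpow_neg, ← mul_inv_cancel₀ (mul_ne_zero (zpow_ne_zero (C i j) v_ne_zero)
      (zpow_ne_zero (C i j) v_ne_zero))]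
    ring
  rw [mul_assoc (L i), h.LE, mul_smul_comm, ← mul_assoc (L i), h.LE, smul_mul_assoc,
    smul_smul, smul_smul, mul_assoc _ _ (_ ^ _), e, one_smul, mul_assoc]

/-- The quantum Serre expressions in the `F i` commute with the `E k`. For `k = i` this is the
vanishing `skewCoeff_self`, applied to the commutation of `F i` with `E i K' i`. -/
theorem E_mul_serre_F (hL : ∀ i, ∃ l, L i * l = 1) {i j : I} (hij : i ≠ j) (k : I) :
    E k * serre (1 - C i j).toNat (F i) (F j) = serre (1 - C i j).toNat (F i) (F j) * E k := by
  have hm := UTilde.toNat_cast C hij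
  have hm1 : 1 ≤ (1 - C i j).toNat := by have := C.offDiag i j hij; omega
  rcases eq_or_ne k j with rfl | hkj
  · have hz : E k * F i = F i * E k := h.EF_diff k i hij.symm
    have hK : serre (1 - C i k).toNat (F i) (K k) = 0 := by
      rw [serre_eq_skew_of v⁻¹ (Or.inr rfl)]
      exact skew_eq_zero (by rw [h.KF, hm, inv_zpow', C.symm]) hm1
    have hL : serre (1 - C i k).toNat (F i) (L k) = 0 := by
      rw [serre_eq_skew_of v (Or.inl rfl)]
      exact skew_eq_zero (by rw [h.LF, hm, C.symm]) hm1
    rw [serre_eq_skew] at hK hL ⊢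
    have hKL : K k - L k = K k + (-1 : Qv) • L k := by simp [sub_eq_add_neg]
    rw [mul_skew hz, skew_mul hz, h.EF_same, skew_add_right, skew_smul_right, hKL,
      skew_add_right, skew_smul_right, hK, hL]
    simp
  · rcases eq_or_ne k i with rfl | hki
    · obtain ⟨l, hl⟩ := hL k
      obtain ⟨n, hn⟩ := Nat.exists_eq_add_of_le' hm1
      have e1 := skew_mul_eq (w := v⁻¹) (t := v⁻¹ ^ (1 - ((1 - C k j).toNat : ℤ))) (y := F j)
        (h.F_mul_E_mul_L k 1) ?_ ?_ ?_ ?_ ?_ n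
      · rw [← hn, skewCoeff_self v⁻¹ (Or.inr rfl), zero_smul, add_zero,
          ← serre_eq_skew_of v⁻¹ (Or.inr rfl), one_smul] at e1
        have e2 : L k * serre (1 - C k j).toNat (F k) (F j) =
            ((v ^ C k k) ^ (1 - C k j).toNat * v ^ C k j) •
              (serre (1 - C k j).toNat (F k) (F j) * L k) := by
          rw [serre_eq_skew]
          exact qcomm_skew (h.LF k k) (h.LF k j) _
        have e3 : v⁻¹ ^ (1 - ((1 - C k j).toNat : ℤ)) * v⁻¹ ^ (2 * (1 - C k j).toNat) *
            ((v ^ C k k) ^ (1 - C k j).toNat * v ^ C k j) = 1 := by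
          have hx : (v : Qv) ^ C k j ≠ 0 := zpow_ne_zero _ v_ne_zero
          have hy : ((v : Qv) ^ 2) ^ (1 - C k j).toNat ≠ 0 :=
            pow_ne_zero _ (pow_ne_zero _ v_ne_zero)
          rw [hm, C.diag, pow_mul, inv_zpow, inv_pow, inv_pow, zpow_ofNat]
          field_simp
        rw [mul_assoc, e2, mul_smul_comm, smul_smul, e3, one_smul, ← mul_assoc, ← mul_assoc] at e1
        have := congrArg (· * l) e1
        simp only [mul_assoc, hl, mul_one] at this
        rw [this]
      · rw [one_smul, h.E_mul_L_mul_F k hij.symm, smul_smul, hm, inv_zpow,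
          inv_mul_cancel₀ (zpow_ne_zero _ v_ne_zero), one_smul]
      · rw [smul_mul_assoc, mul_smul_comm, h.KL_mul_F]
      · rw [smul_mul_assoc, mul_smul_comm, h.KL_mul_F]
      · have e4 : (v⁻¹ ^ (2 : ℤ)) ^ 2 = v⁻¹ ^ 4 := by rw [zpow_ofNat, ← pow_mul]
        rw [smul_mul_assoc, mul_smul_comm, h.F_mul_LL, C.diag, e4, smul_comm]
      · rw [smul_mul_assoc, mul_smul_comm, h.F_mul_LL, hm, smul_comm]
    · rw [serre_eq_skew, mul_skew (h.EF_diff k i hki), skew_mul (h.EF_diff k i hki),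
        h.EF_diff k j hkj]

end PreDJ

end PreDJ

/-! ### Quantum Serre expressions modulo the `B i` -/

section PreDJ

variable {I : Type*} {A : Type*} [Ring A] [Algebra Qv A]

namespace PreDJ

variable {C : SymmetricGCM I} {E F K L : I → A} {τ : I → I}

/-- The relations between the summands `E (τ i) K' i` of the elements `B i` reduce their quantum
Serre expressions to those of the `E i`. -/
theorem serre_EL_eq_zero (h : PreDJ C E F K L) (hτ : IsInvolution C τ) (s : I → Qv) {i j : I}
    (hE : serre (1 - C (τ i) (τ j)).toNat (E (τ i)) (E (τ j)) = 0) :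
    serre (1 - C i j).toNat (s i • (E (τ i) * L i)) (s j • (E (τ j) * L j)) = 0 := by
  rw [hτ.entry_eq] at hE
  have e : C j (τ i) = C i (τ j) := by
    rw [← hτ.entry_eq i (τ j), hτ.involutive j, C.symm]
  have h0 : serre (1 - C i j).toNat (E (τ i) * L i) (E (τ j) * L j) = 0 :=
    serre_mul_mul_eq_zero _ _ _ _ _ _ _ (h.LE i (τ i)) (h.LE i (τ j))
      (by rw [h.LE j (τ i), e]) (h.LL i j) hE
  rw [serre_eq_skew] at h0 ⊢
  rw [skew_smul_left, skew_smul_right, h0, smul_zero, smul_zero]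

theorem KL_mul_EL (h : PreDJ C E F K L) (i j k : I) :
    K i * L i * (E j * L k) = E j * L k * (K i * L i) := by
  rw [← mul_assoc, h.KL_mul_E, mul_assoc, h.KL_mul_L, ← mul_assoc]

theorem EL_mul_LL (h : PreDJ C E F K L) (i j k : I) :
    E j * L k * (L i * L i) = (v ^ C i j) ^ 2 • (L i * L i * (E j * L k)) := by
  have e : L k * (L i * L i) = L i * L i * L k := by
    rw [← mul_assoc, h.LL k i, mul_assoc, h.LL k i, mul_assoc]
  rw [mul_assoc, e, ← mul_assoc, h.E_mul_LL, smul_mul_assoc, mul_assoc]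

section Membership

variable (h : PreDJ C E F K L) (hτ : IsInvolution C τ) (s z : I → Qv) (N : Submodule Qv A)
  (hN : ∀ T ∈ N, ∀ S, T * S ∈ N) (hB : ∀ i, F i + s i • (E (τ i) * L i) ∈ N)
  (hk : ∀ i T, K i * L (τ i) * T - z i • T ∈ N)
  (hE : ∀ i j, i ≠ j → serre (1 - C i j).toNat (E i) (E j) = 0)

include h hτ hN hB hE in
/-- For `τ i ∉ {i, j}` the summands of `B i` and `B j` skew commute, so that the quantum Serre
expression of `B i` and `B j` is the sum of those of the summands. -/
theorem serre_F_mem_of_ne {i j : I} (hij : i ≠ j) (hi : τ i ≠ i) (hj : τ i ≠ j) :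
    serre (1 - C i j).toNat (F i) (F j) ∈ N := by
  have hm := UTilde.toNat_cast C hij
  have hji : τ j ≠ i := fun e => hj (by rw [← e, hτ.involutive])
  have hX := h.serre_EL_eq_zero hτ s (hE (τ i) (τ j) (hτ.involutive.injective.ne hij))
  have hadd := serre_add (1 - C i j).toNat (F i) (s i • (E (τ i) * L i)) (F j)
    (s j • (E (τ j) * L j)) ?_ ?_ ?_
  · rw [hX, add_zero] at hadd
    rw [← hadd, serre_eq_skew]
    exact skew_mem hN (hB i) (hB j) _
  · rw [smul_mul_assoc, h.E_mul_L_mul_F i hi.symm, C.diag, mul_smul_comm, smul_comm]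
  · rw [smul_mul_assoc, h.E_mul_L_mul_F i hj.symm, hm, mul_smul_comm, smul_comm]
  · rw [smul_mul_assoc, h.E_mul_L_mul_F j hji.symm, hm, mul_smul_comm, smul_comm, C.symm]

include h hτ hN hB hk hE in
/-- For `τ i = i` the quantum Serre expression of the `F`'s is a deformed Serre expression in `B i`
and `B j`, whose coefficients are powers of `K i K' i`. -/
theorem serre_F_mem_of_fixed {i j : I} (hij : i ≠ j) (hi : τ i = i) :
    serre (1 - C i j).toNat (F i) (F j) ∈ N := by
  have hm := UTilde.toNat_cast C hij
  have hji : τ j ≠ i := fun e => hij (by rw [← hi, ← e, hτ.involutive])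
  have hc : C i (τ j) = C i j := by rw [← hτ.entry_eq i j, hi]
  have hX := h.serre_EL_eq_zero hτ s (hE (τ i) (τ j) (hτ.involutive.injective.ne hij))
  have hBi := hB i
  rw [hi] at hX hBi
  have hv : ∀ c : ℤ, v⁻¹ ^ c * v ^ c = 1 := fun c => by
    rw [inv_zpow, inv_mul_cancel₀ (zpow_ne_zero _ v_ne_zero)]
  have e4 : (v⁻¹ ^ (2 : ℤ)) ^ 2 = v⁻¹ ^ 4 := by rw [zpow_ofNat, ← pow_mul]
  have e4' : (v ^ (2 : ℤ)) ^ 2 = v ^ 4 := by rw [zpow_ofNat, ← pow_mul]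
  have hadd := serre_add_serre_eq_deformedSerre (m := (1 - C i j).toNat) (y := F j)
    (y' := s j • (E (τ j) * L j)) (h.F_mul_E_mul_L i (s i)) ?_ ?_ ?_ ?_ ?_ ?_ ?_ ?_ ?_ ?_
  · rw [hX, add_zero] at hadd
    rw [hadd]
    refine continuant_mem hN hBi (hB j) ?_ _ _
    intro T hT
    have h1 := hk i T
    rw [hi] at h1
    have h2 : K i * L i * T ∈ N := by
      have := N.add_mem h1 (N.smul_mem (z i) hT)
      rwa [sub_add_cancel] at this
    rw [smul_mul_assoc]
    exact N.smul_mem _ h2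
  · rw [smul_mul_assoc, h.E_mul_L_mul_F i hij.symm, hm, smul_comm (s i), smul_smul, hv, one_smul,
      mul_smul_comm]
  · rw [smul_mul_assoc, h.E_mul_L_mul_F j hji.symm, hm, mul_smul_comm, smul_comm, C.symm]
  · rw [smul_mul_assoc, mul_smul_comm, h.KL_mul_F]
  · rw [smul_mul_assoc, mul_smul_comm, mul_smul_comm, smul_mul_assoc, h.KL_mul_EL]
  · rw [smul_mul_assoc, mul_smul_comm, h.KL_mul_F]
  · rw [smul_mul_assoc, mul_smul_comm, mul_smul_comm, smul_mul_assoc, h.KL_mul_EL]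
  · rw [smul_mul_assoc, mul_smul_comm, h.F_mul_LL, C.diag, e4, smul_comm]
  · rw [smul_mul_assoc, mul_smul_comm, mul_smul_comm, smul_mul_assoc, h.EL_mul_LL, C.diag, e4']
    module
  · rw [smul_mul_assoc, mul_smul_comm, h.F_mul_LL, hm, smul_comm]
  · rw [smul_mul_assoc, mul_smul_comm, mul_smul_comm, smul_mul_assoc, h.EL_mul_LL, hc, hm]
    module

include h hτ hN hB hk hE in
/-- For `j = τ i ≠ i` the quantum Serre expression of `B i` and `B j` differs from that of the `F`'s
by a right multiple of the power of `B i` with exponent `-c i (τ i)`. This power is trivial exactly if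
`c i (τ i) = 0`, the case in which conditions on the parameters are needed. -/
theorem serre_F_mem_of_swapped {i : I} (hi : τ i ≠ i) (hs : C i (τ i) = 0 → s i = s (τ i))
    (hz : C i (τ i) = 0 → z i = z (τ i)) :
    serre (1 - C i (τ i)).toNat (F i) (F (τ i)) ∈ N := by
  have hm := UTilde.toNat_cast C hi.symm
  have hττ := hτ.involutive i
  have hX := h.serre_EL_eq_zero hτ s (hE (τ i) (τ (τ i)) (hτ.involutive.injective.ne hi.symm))
  have hc : C (τ i) i = C i (τ i) := C.symm _ _
  have hBi := hB i
  have hBt := hB (τ i)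
  have hκN := hk (τ i) 1
  rw [hττ] at hX hBt hκN
  -- the two commutation relations whose correction terms deform the Serre relation
  have h1 := h.E_mul_L_mul_F_same (τ i) i
  have h2 := h.E_mul_L_mul_F_same i (τ i)
  rw [hc] at h2
  have hv : ∀ c : ℤ, v⁻¹ ^ c * v ^ c = 1 := fun c => by
    rw [inv_zpow, inv_mul_cancel₀ (zpow_ne_zero _ v_ne_zero)]
  have hFX : F (τ i) * (s i • (E (τ i) * L i)) =
      v⁻¹ ^ C i (τ i) • ((s i • (E (τ i) * L i)) * F (τ i)) +
      ((-(s i * (v - v⁻¹)⁻¹)) • (K (τ i) * L i) + (s i * (v - v⁻¹)⁻¹) • (L i * L (τ i))) := by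
    rw [smul_mul_assoc, h1, mul_smul_comm]
    have : ∀ x y z : A, v⁻¹ ^ C i (τ i) • (s i • (v ^ C i (τ i) • x +
        (v ^ C i (τ i) * (v - v⁻¹)⁻¹) • (y - z))) + ((-(s i * (v - v⁻¹)⁻¹)) • y +
        (s i * (v - v⁻¹)⁻¹) • z) = s i • x := by
      intro x y z
      have e1 : v⁻¹ ^ C i (τ i) • (s i • (v ^ C i (τ i) • x +
        (v ^ C i (τ i) * (v - v⁻¹)⁻¹) • (y - z))) =
        (v⁻¹ ^ C i (τ i) * v ^ C i (τ i)) • (s i • (x + (v - v⁻¹)⁻¹ • (y - z))) := by module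
      rw [e1, hv]
      module
    rw [this]
  have hXF : (s (τ i) • (E i * L (τ i))) * F i =
      v ^ C i (τ i) • (F i * (s (τ i) • (E i * L (τ i)))) +
      ((v ^ C i (τ i) * s (τ i) * (v - v⁻¹)⁻¹) • (K i * L (τ i)) +
        (-(v ^ C i (τ i) * s (τ i) * (v - v⁻¹)⁻¹)) • (L i * L (τ i))) := by
    rw [smul_mul_assoc, h2, mul_smul_comm, h.LL (τ i) i]
    module
  rcases Nat.lt_or_ge (1 - C i (τ i)).toNat 2 with hlt | hge
  · -- if `c i (τ i) = 0`, the correction terms cancel modulo the submodule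
    have h0 : C i (τ i) = 0 := by have := C.offDiag i (τ i) hi.symm; omega
    have hser : ∀ x y : A, serre (1 - C i (τ i)).toNat x y = y * x - x * y := by
      intro x y
      rw [serre_eq_skew, h0]
      simp [skew]
    rw [hser] at hX ⊢
    rw [h0, zpow_zero, one_smul] at hFX hXF
    set B := F i + s i • (E (τ i) * L i) with hBdef
    set B' := F (τ i) + s (τ i) • (E i * L (τ i)) with hBdef'
    have key : F (τ i) * F i - F i * F (τ i) = (B' * B - B * B') +
        (s i * (v - v⁻¹)⁻¹) • ((K (τ i) * L i * 1 - z (τ i) • 1) -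
          (K i * L (τ i) * 1 - z i • 1)) := by
      rw [hBdef, hBdef']
      rw [add_mul, add_mul, mul_add, mul_add, mul_add, mul_add, hFX, hXF, ← hs h0, hz h0]
      rw [← hs h0] at hX
      have hX' := sub_eq_zero.1 hX
      rw [hX', mul_one, mul_one]
      module
    rw [key]
    exact N.add_mem (N.sub_mem (hN _ hBt _) (hN _ hBi _))
      (N.smul_mem _ (N.sub_mem hκN (hk i 1)))
  · have hv' := v_ne_zero
    have hvi : (v⁻¹ : Qv) ≠ 0 := inv_ne_zero hv'
    -- commutation of the correction terms with the two summands of `B i`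
    have q1 : (v⁻¹⁻¹ ^ 2 * v⁻¹ ^ C i (τ i) : Qv) = v ^ (2 - C i (τ i)) := by
      rw [inv_inv, inv_zpow', zpow_sub₀ hv', zpow_neg, zpow_ofNat, div_eq_mul_inv]
    have q2 : (v⁻¹⁻¹ ^ 2 * (v⁻¹ ^ C i (τ i))⁻¹ : Qv) = v ^ (2 + C i (τ i)) := by
      rw [inv_inv, inv_zpow', zpow_neg, inv_inv, zpow_add₀ hv', zpow_ofNat]
    have q3 : (v⁻¹ ^ 2 * v⁻¹ ^ C i (τ i) : Qv) = v ^ (-2 - C i (τ i)) := by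
      rw [inv_zpow', zpow_sub₀ hv', zpow_neg, zpow_neg, zpow_ofNat, inv_pow, div_eq_mul_inv]
    have q4 : (v⁻¹ ^ 2 * v ^ C i (τ i) : Qv) = v ^ (-2 + C i (τ i)) := by
      rw [zpow_add₀ hv', zpow_neg, zpow_ofNat, inv_pow]
    have q5 : (v⁻¹ ^ 2 * (v ^ C i (τ i))⁻¹ : Qv) = v ^ (-2 - C i (τ i)) := by
      rw [zpow_sub₀ hv', zpow_neg, zpow_ofNat, inv_pow, div_eq_mul_inv]
    have q6 : (v ^ 2 * v ^ C i (τ i) : Qv) = v ^ (2 + C i (τ i)) := by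
      rw [zpow_add₀ hv', zpow_ofNat]
    have d' : C (τ i) (τ i) = 2 := C.diag _
    have move : ∀ {α β : ℤ} {k l x : A}, k * x = v ^ α • (x * k) → l * x = v ^ β • (x * l) →
        k * l * x = v ^ (α + β) • (x * (k * l)) := by
      intro α β k l x h1 h2
      rw [mul_assoc, h2, mul_smul_comm, ← mul_assoc, h1, smul_mul_assoc, smul_smul,
        ← zpow_add₀ hv', add_comm, mul_assoc]
    have moveX : ∀ {α β : ℤ} {k x y : A} (r : Qv), k * x = v ^ α • (x * k) →
        k * y = v ^ β • (y * k) → k * (r • (x * y)) = v ^ (α + β) • ((r • (x * y)) * k) := by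
      intro α β k x y r h1 h2
      rw [mul_smul_comm, ← mul_assoc, h1, smul_mul_assoc, mul_assoc, h2, mul_smul_comm,
        smul_mul_assoc, mul_assoc, zpow_add₀ hv']
      module
    have hLX : ∀ k, L k * (s i • (E (τ i) * L i)) =
        v ^ (-C k (τ i) + 0) • ((s i • (E (τ i) * L i)) * L k) := fun k =>
      moveX _ (h.LE k (τ i)) (by rw [zpow_zero, one_smul, h.LL])
    have hKX : ∀ k, K k * (s i • (E (τ i) * L i)) =
        v ^ (C k (τ i) + 0) • ((s i • (E (τ i) * L i)) * K k) := fun k =>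
      moveX _ (h.KE k (τ i)) (by rw [zpow_zero, one_smul, h.KL])
    have scal : ∀ {k x : A} {α : Qv} (r : Qv), k * x = α • (x * k) →
        (r • k) * x = α • (x * (r • k)) := by
      intro k x α r hkx
      rw [smul_mul_assoc, hkx, mul_smul_comm, smul_comm]
    have hXFi : (s i • (E (τ i) * L i)) * F i = v ^ 2 • (F i * (s i • (E (τ i) * L i))) := by
      rw [smul_mul_assoc, h.E_mul_L_mul_F i hi.symm, C.diag, mul_smul_comm, smul_comm, zpow_ofNat]
    obtain ⟨r, hr⟩ := skew_add_left_perturbed (w := v⁻¹) (m := (1 - C i (τ i)).toNat)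
      (a := F i) (b := s i • (E (τ i) * L i)) (y := F (τ i))
      (κ := (-(s i * (v - v⁻¹)⁻¹)) • (K (τ i) * L i))
      (p := (s i * (v - v⁻¹)⁻¹) • (L i * L (τ i))) hvi
      (by rw [hXFi, smul_smul, ← mul_pow, inv_mul_cancel₀ hv', one_pow, one_smul])
      (by rw [hm]; exact hFX)
      (by
        rw [hm, q1]
        refine scal _ ((move (h.KF _ _) (h.LF _ _)).trans ?_)
        rw [hc, C.diag]; congr 2; ring)
      (by
        rw [hm, q1]
        refine scal _ ((move (hKX _) (hLX _)).trans ?_)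
        rw [d']; congr 2; ring)
      (by
        rw [hm, q2]
        refine scal _ ((move (h.LF _ _) (h.LF _ _)).trans ?_)
        rw [hc, C.diag])
      (by
        rw [hm, q3]
        refine scal _ ((move (hLX _) (hLX _)).trans ?_)
        rw [d']; congr 2; ring) hge
    obtain ⟨r', hr'⟩ := skew_add_left_perturbed (w := v) (m := (1 - C i (τ i)).toNat)
      (a := s i • (E (τ i) * L i)) (b := F i) (y := s (τ i) • (E i * L (τ i)))
      (κ := (v ^ C i (τ i) * s (τ i) * (v - v⁻¹)⁻¹) • (K i * L (τ i)))
      (p := (-(v ^ C i (τ i) * s (τ i) * (v - v⁻¹)⁻¹)) • (L i * L (τ i))) hv'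
      hXFi
      (by rw [hm]; exact hXF)
      (by
        rw [hm, q4]
        refine scal _ ((move (hKX _) (hLX _)).trans ?_)
        rw [d']; congr 2; ring)
      (by
        rw [hm, q4]
        refine scal _ ((move (h.KF _ _) (h.LF _ _)).trans ?_)
        rw [hc, C.diag])
      (by
        rw [hm, q5]
        refine scal _ ((move (hLX _) (hLX _)).trans ?_)
        rw [d']; congr 2; ring)
      (by
        rw [hm, q6]
        refine scal _ ((move (h.LF _ _) (h.LF _ _)).trans ?_)
        rw [hc, C.diag]) hge
    rw [add_comm (s i • (E (τ i) * L i)) (F i), ← serre_eq_skew_of v (Or.inl rfl),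
      ← serre_eq_skew_of v (Or.inl rfl), hX, zero_add] at hr'
    rw [← serre_eq_skew_of v⁻¹ (Or.inr rfl), ← serre_eq_skew_of v⁻¹ (Or.inr rfl)] at hr
    obtain ⟨n, hn⟩ := Nat.exists_eq_add_of_le hge
    have hpow : ∀ S, (F i + s i • (E (τ i) * L i)) ^ ((1 - C i (τ i)).toNat - 1) * S ∈ N := by
      intro S
      rw [show (1 - C i (τ i)).toNat - 1 = n + 1 by omega, pow_succ', mul_assoc]
      exact hN _ hBi _
    have hser : ∀ y, serre (1 - C i (τ i)).toNat (F i + s i • (E (τ i) * L i)) y =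
        skew v (v ^ (1 - ((1 - C i (τ i)).toNat : ℤ))) (F i + s i • (E (τ i) * L i)) y
          (1 - C i (τ i)).toNat := fun y => serre_eq_skew _ _ _
    have hsum := skew_mem (w := v) (t := v ^ (1 - ((1 - C i (τ i)).toNat : ℤ))) hN hBi hBt
      (1 - C i (τ i)).toNat
    rw [skew_add_right, ← hser, ← hser, hr, hr', add_assoc] at hsum
    have := N.sub_mem hsum (N.add_mem
      (N.smul_mem r (hpow ((-(s i * (v - v⁻¹)⁻¹)) • (K (τ i) * L i))))
      (N.smul_mem r' (hpow ((v ^ C i (τ i) * s (τ i) * (v - v⁻¹)⁻¹) • (K i * L (τ i))))))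
    rwa [add_sub_cancel_right] at this

include h hτ hN hB hk hE in
/-- A right ideal that contains the elements `B i = F i + s i E (τ i) K' i` and modulo which the
elements `k i` act from the left as scalars contains the quantum Serre expressions in the `F i`. -/
theorem serre_F_mem (hs : ∀ i, C i (τ i) = 0 → s i = s (τ i))
    (hz : ∀ i, C i (τ i) = 0 → z i = z (τ i)) {i j : I} (hij : i ≠ j) :
    serre (1 - C i j).toNat (F i) (F j) ∈ N := by
  by_cases hi : τ i = i
  · exact h.serre_F_mem_of_fixed hτ s z N hN hB hk hE hij hi
  · by_cases hj : τ i = j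
    · subst hj
      exact h.serre_F_mem_of_swapped hτ s z N hN hB hk hE hi (hs i) (hz i)
    · exact h.serre_F_mem_of_ne hτ s N hN hB hE hij hi hj

end Membership

end PreDJ

end PreDJ

theorem PreDJ.map {I : Type*} {A B : Type*} [Ring A] [Algebra Qv A] [Ring B] [Algebra Qv B]
    {C : SymmetricGCM I} {E F K L : I → A} (h : PreDJ C E F K L) (f : A →ₐ[Qv] B) :
    PreDJ C (fun i => f (E i)) (fun i => f (F i)) (fun i => f (K i)) (fun i => f (L i)) where
  EF_same i := by simp only [← map_mul, h.EF_same, map_add, map_smul, map_sub]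
  EF_diff i j hij := by rw [← map_mul, h.EF_diff i j hij, map_mul]
  KK i j := by rw [← map_mul, h.KK, map_mul]
  KL i j := by rw [← map_mul, h.KL, map_mul]
  LL i j := by rw [← map_mul, h.LL, map_mul]
  KE i j := by rw [← map_mul, h.KE, map_smul, map_mul]
  KF i j := by rw [← map_mul, h.KF, map_smul, map_mul]
  LE i j := by rw [← map_mul, h.LE, map_smul, map_mul]
  LF i j := by rw [← map_mul, h.LF, map_smul, map_mul]

theorem PreDJ.eq_of_djRel {I : Type*} {A : Type*} [Ring A] [Algebra Qv A]
    {C : SymmetricGCM I} {E F K L : I → A} (h : PreDJ C E F K L)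
    (hE : ∀ i j, i ≠ j → serre (1 - C i j).toNat (E i) (E j) = 0)
    (hF : ∀ i j, i ≠ j → serre (1 - C i j).toNat (F i) (F j) = 0) (x y : A)
    (hxy : DJRel C E F K L x y) : x = y := by
  cases hxy with
  | EF_same i => rw [h.EF_same, add_sub_cancel_left]
  | EF_diff i j hij => rw [h.EF_diff i j hij, sub_self]
  | KK i j => exact h.KK i j
  | KL i j => exact h.KL i j
  | LL i j => exact h.LL i j
  | KE i j => exact h.KE i j
  | KF i j => exact h.KF i j
  | LE i j => exact h.LE i j
  | LF i j => exact h.LF i j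
  | serreE i j hij => exact hE i j hij
  | serreF i j hij => exact hF i j hij

/-! ### Operators on words -/

namespace Verma

variable {I : Type*}

/-- The free algebra on the `F i`, with the words in `I` as a basis. -/
abbrev Words (I : Type*) : Type _ := List I →₀ Qv

/-- The diagonal operator with eigenvalue `c v ^ (μ j₁ + ⋯ + μ jₙ)` on the word `j₁ ⋯ jₙ`. -/
def diag (c : Qv) (μ : I → ℤ) : Module.End Qv (Words I) :=
  Finsupp.linearCombination Qv fun w => Finsupp.single w (c * v ^ (w.map μ).sum)

/-- Left multiplication by `F i`. -/
def opF (i : I) : Module.End Qv (Words I) := Finsupp.lmapDomain Qv Qv (List.cons i)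

open Classical in
/-- The action of `E i` on a word, determined by the commutators of `E i` with the `F j`. -/
def wordE (C : SymmetricGCM I) (z : I → Qv) (i : I) : List I → Words I
  | [] => 0
  | j :: w => opF j (wordE C z i w) + if i = j then
      (v - v⁻¹)⁻¹ • (diag (z i) (fun k => -C i k) - diag 1 (fun k => C i k)) (Finsupp.single w 1)
      else 0

/-- The operator `E i` on the Verma module whose highest weight sends `K i` to `z i` and `K' i`
to `1`. -/
def opE (C : SymmetricGCM I) (z : I → Qv) (i : I) : Module.End Qv (Words I) :=
  Finsupp.linearCombination Qv (wordE C z i)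

/-- The operator `K i`. -/
def opK (C : SymmetricGCM I) (z : I → Qv) (i : I) : Module.End Qv (Words I) :=
  diag (z i) (fun k => -C i k)

/-- The operator `K' i`. -/
def opL (C : SymmetricGCM I) (i : I) : Module.End Qv (Words I) :=
  diag 1 (fun k => C i k)

theorem end_ext {M : Type*} [AddCommGroup M] [Module Qv M] {f g : Words I →ₗ[Qv] M}
    (h : ∀ w, f (Finsupp.single w 1) = g (Finsupp.single w 1)) : f = g :=
  Finsupp.lhom_ext' fun w => LinearMap.ext_ring (h w)

theorem diag_single (c : Qv) (μ : I → ℤ) (w : List I) :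
    diag c μ (Finsupp.single w 1) = (c * v ^ (w.map μ).sum) • Finsupp.single w 1 := by
  simp [diag]

theorem opF_single (i : I) (w : List I) :
    opF i (Finsupp.single w 1) = Finsupp.single (i :: w) 1 := by
  simp [opF]

theorem opE_single (C : SymmetricGCM I) (z : I → Qv) (i : I) (w : List I) :
    opE C z i (Finsupp.single w 1) = wordE C z i w := by
  simp [opE]

theorem diag_mul_diag (c c' : Qv) (μ μ' : I → ℤ) :
    diag c μ * diag c' μ' = diag (c * c') (fun k => μ k + μ' k) := by
  refine end_ext fun w => ?_
  rw [Module.End.mul_apply, diag_single, map_smul, diag_single, diag_single, smul_smul,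
    List.sum_map_add, zpow_add₀ v_ne_zero]
  congr 1; ring

theorem diag_one_zero : diag 1 (fun _ : I => 0) = 1 := by
  refine end_ext fun w => ?_
  rw [diag_single]; simp

theorem diag_mul_opF (c : Qv) (μ : I → ℤ) (i : I) :
    diag c μ * opF i = v ^ μ i • (opF i * diag c μ) := by
  refine end_ext fun w => ?_
  rw [LinearMap.smul_apply, Module.End.mul_apply, Module.End.mul_apply, opF_single, diag_single,
    diag_single, map_smul, opF_single, smul_smul, List.map_cons, List.sum_cons,
    zpow_add₀ v_ne_zero]
  congr 1; ring

theorem opE_mul_opF_same (C : SymmetricGCM I) (z : I → Qv) (i : I) :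
    opE C z i * opF i = opF i * opE C z i + (v - v⁻¹)⁻¹ • (opK C z i - opL C i) := by
  refine end_ext fun w => ?_
  rw [Module.End.mul_apply, opF_single, opE_single, wordE, if_pos rfl, LinearMap.add_apply,
    Module.End.mul_apply, opE_single, LinearMap.smul_apply, opK, opL]

theorem opE_mul_opF_of_ne (C : SymmetricGCM I) (z : I → Qv) {i j : I} (hij : i ≠ j) :
    opE C z i * opF j = opF j * opE C z i := by
  refine end_ext fun w => ?_
  rw [Module.End.mul_apply, opF_single, opE_single, wordE, if_neg hij, add_zero,
    Module.End.mul_apply, opE_single]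

theorem diag_mul_opE (C : SymmetricGCM I) (z : I → Qv) (c : Qv) (μ : I → ℤ) (i : I) :
    diag c μ * opE C z i = v ^ (-μ i) • (opE C z i * diag c μ) := by
  refine end_ext fun w => ?_
  induction w with
  | nil =>
    rw [LinearMap.smul_apply, Module.End.mul_apply, Module.End.mul_apply, diag_single, map_smul,
      opE_single, wordE, map_zero, smul_zero, smul_zero]
  | cons j w ih =>
    rw [← opF_single, ← Module.End.mul_apply, ← Module.End.mul_apply]
    rw [LinearMap.smul_apply, Module.End.mul_apply, Module.End.mul_apply] at ih
    have hcd : ∀ (c' : Qv) (μ' : I → ℤ), Commute (diag c μ) (diag c' μ') := by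
      intro c' μ'
      rw [Commute, SemiconjBy, diag_mul_diag, diag_mul_diag, mul_comm]
      congr 1; funext k; ring
    have hsub : diag c μ * (opK C z i - opL C i) = (opK C z i - opL C i) * diag c μ :=
      LinearMap.ext fun u => by
        have h1 := LinearMap.congr_fun (hcd (z i) (fun k => -C i k)).eq u
        have h2 := LinearMap.congr_fun (hcd 1 (fun k => C i k)).eq u
        simp only [Module.End.mul_apply, LinearMap.sub_apply, map_sub] at h1 h2 ⊢
        rw [opK, opL, h1, h2]
    have hvv : (v : Qv) ^ (-μ i) * v ^ μ i = 1 := by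
      rw [← zpow_add₀ v_ne_zero, neg_add_cancel, zpow_zero]
    by_cases hij : i = j
    · subst hij
      rw [mul_assoc, opE_mul_opF_same, smul_mul_assoc, mul_assoc, diag_mul_opF, mul_smul_comm,
        ← mul_assoc (opE C z i), opE_mul_opF_same, mul_add, ← mul_assoc, diag_mul_opF,
        smul_smul, hvv, one_smul, add_mul, smul_mul_assoc, mul_smul_comm, smul_mul_assoc, hsub,
        LinearMap.add_apply, LinearMap.add_apply,
        LinearMap.smul_apply, mul_assoc, Module.End.mul_apply, Module.End.mul_apply, ih, map_smul,
        smul_smul, mul_comm, hvv, one_smul, mul_assoc, Module.End.mul_apply,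
        Module.End.mul_apply]
    · rw [mul_assoc, opE_mul_opF_of_ne C z hij, ← mul_assoc, diag_mul_opF, smul_mul_assoc,
        smul_mul_assoc, mul_assoc (opE C z i), diag_mul_opF, mul_smul_comm, ← mul_assoc (opE C z i),
        opE_mul_opF_of_ne C z hij, LinearMap.smul_apply, LinearMap.smul_apply,
        LinearMap.smul_apply, mul_assoc, mul_assoc, Module.End.mul_apply, Module.End.mul_apply,
        Module.End.mul_apply, Module.End.mul_apply, ih, map_smul, smul_smul, smul_smul, mul_comm]

theorem preDJ (C : SymmetricGCM I) (z : I → Qv) : PreDJ C (opE C z) opF (opK C z) (opL C) where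
  EF_same := opE_mul_opF_same C z
  EF_diff i j hij := opE_mul_opF_of_ne C z hij
  KK i j := by
    rw [opK, opK, diag_mul_diag, diag_mul_diag, mul_comm]; congr 1; funext k; ring
  KL i j := by
    rw [opK, opL, diag_mul_diag, diag_mul_diag, mul_comm]; congr 1; funext k; ring
  LL i j := by
    rw [opL, opL, diag_mul_diag, diag_mul_diag, mul_comm]; congr 1; funext k; ring
  KE i j := by rw [opK, diag_mul_opE, neg_neg]
  KF i j := diag_mul_opF _ _ _
  LE i j := diag_mul_opE _ _ _ _ _
  LF i j := diag_mul_opF _ _ _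

theorem opK_mul_inv (C : SymmetricGCM I) (z : I → Qv) (hz : ∀ i, z i ≠ 0) (i : I) :
    opK C z i * diag (z i)⁻¹ (fun k => C i k) = 1 := by
  rw [opK, diag_mul_diag, mul_inv_cancel₀ (hz i), ← diag_one_zero]
  congr 1; funext k; ring

theorem opK_inv_mul (C : SymmetricGCM I) (z : I → Qv) (hz : ∀ i, z i ≠ 0) (i : I) :
    diag (z i)⁻¹ (fun k => C i k) * opK C z i = 1 := by
  rw [opK, diag_mul_diag, inv_mul_cancel₀ (hz i), ← diag_one_zero]
  congr 1; funext k; ring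

theorem opL_mul_inv (C : SymmetricGCM I) (i : I) :
    opL C i * diag 1 (fun k => -C i k) = 1 := by
  rw [opL, diag_mul_diag, mul_one, ← diag_one_zero]
  congr 1; funext k; ring

theorem opL_inv_mul (C : SymmetricGCM I) (i : I) :
    diag 1 (fun k => -C i k) * opL C i = 1 := by
  rw [opL, diag_mul_diag, mul_one, ← diag_one_zero]
  congr 1; funext k; ring

/-- The quantum Serre expressions in the `E i` act by zero: they commute with the `F k` and kill
the highest weight vector. -/
theorem serre_opE (C : SymmetricGCM I) (z : I → Qv) (hz : ∀ i, z i ≠ 0) {i j : I} (hij : i ≠ j) :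
    serre (1 - C i j).toNat (opE C z i) (opE C z j) = 0 := by
  refine end_ext fun w => ?_
  rw [LinearMap.zero_apply]
  induction w with
  | nil =>
    have hnil : ∀ i, opE C z i (Finsupp.single [] 1) = 0 := fun i => by rw [opE_single, wordE]
    rw [serre_eq_skew]
    generalize (1 - C i j).toNat = m
    generalize v ^ (1 - (m : ℤ)) = t
    induction m with
    | zero => exact hnil j
    | succ m ih =>
      rw [skew, LinearMap.sub_apply, LinearMap.smul_apply, Module.End.mul_apply,
        Module.End.mul_apply, hnil, ih, map_zero, map_zero, smul_zero, sub_zero]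
  | cons k w ih =>
    rw [← opF_single, ← Module.End.mul_apply,
      ← (preDJ C z).swap.E_mul_serre_F (fun i => ⟨_, opK_mul_inv C z hz i⟩) hij k,
      Module.End.mul_apply, ih, map_zero]

end Verma

/-! ### The functional on words -/

namespace Verma

variable {I : Type*}

/-- The span of the words of length at most `n`. -/
def filtration (I : Type*) (n : ℕ) : Submodule Qv (Words I) :=
  Finsupp.supported Qv Qv {w | w.length ≤ n}

theorem single_mem_filtration {n : ℕ} {w : List I} (h : w.length ≤ n) :
    (Finsupp.single w 1 : Words I) ∈ filtration I n :=
  Finsupp.single_mem_supported Qv 1 h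

theorem filtration_le {n : ℕ} {N : Submodule Qv (Words I)}
    (h : ∀ w : List I, w.length ≤ n → Finsupp.single w 1 ∈ N) : filtration I n ≤ N := by
  rw [filtration, Finsupp.supported_eq_span_single, Submodule.span_le]
  rintro _ ⟨w, hw, rfl⟩
  exact h w hw

theorem diag_mem_filtration (c : Qv) (μ : I → ℤ) {n : ℕ} :
    filtration I n ≤ (filtration I n).comap (diag c μ) :=
  filtration_le fun w hw => by
    rw [Submodule.mem_comap, diag_single]
    exact Submodule.smul_mem _ _ (single_mem_filtration hw)

theorem opF_mem_filtration (i : I) {n : ℕ} :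
    filtration I n ≤ (filtration I (n + 1)).comap (opF i) :=
  filtration_le fun w hw => by
    rw [Submodule.mem_comap, opF_single]
    exact single_mem_filtration (Nat.succ_le_succ hw)

theorem opE_mem_filtration (C : SymmetricGCM I) (z : I → Qv) (i : I) {n : ℕ} :
    filtration I n ≤ (filtration I n).comap (opE C z i) := by
  refine filtration_le fun w hw => ?_
  rw [Submodule.mem_comap, opE_single]
  induction w generalizing n with
  | nil => exact Submodule.zero_mem _
  | cons j w ih =>
    rw [wordE]
    refine Submodule.add_mem _ ?_ ?_
    · obtain ⟨m, rfl⟩ : ∃ m, n = m + 1 :=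
        Nat.exists_eq_add_of_le' (le_trans (Nat.succ_pos _) hw)
      exact opF_mem_filtration j (ih (Nat.le_of_succ_le_succ hw))
    · have hw' : w.length ≤ n := le_trans (Nat.le_succ _) hw
      split_ifs
      · exact Submodule.smul_mem _ _ (Submodule.sub_mem _
          (diag_mem_filtration _ _ (single_mem_filtration hw'))
          (diag_mem_filtration _ _ (single_mem_filtration hw')))
      · exact Submodule.zero_mem _

section Functional

variable (C : SymmetricGCM I) (τ : I → I) (s z : I → Qv)

/-- The recursion `φ (F i u) = -s i φ (E (τ i) K' i u)`, applied `n` times. It computes `φ` on words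
of length at most `n`, since `E (τ i) K' i` does not increase the length. -/
def stage : ℕ → Words I →ₗ[Qv] Qv
  | 0 => Finsupp.lapply []
  | n + 1 => Finsupp.linearCombination Qv fun w => match w with
    | [] => 1
    | i :: w => -s i * stage n (opE C z (τ i) (opL C i (Finsupp.single w 1)))

theorem stage_succ_nil (n : ℕ) : stage C τ s z (n + 1) (Finsupp.single [] 1) = 1 := by
  simp [stage]

theorem stage_succ_cons (n : ℕ) (i : I) (w : List I) :
    stage C τ s z (n + 1) (Finsupp.single (i :: w) 1) =
      -s i * stage C τ s z n (opE C z (τ i) (opL C i (Finsupp.single w 1))) := by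
  simp [stage]

theorem stage_stable (n : ℕ) : ∀ u ∈ filtration I n,
    stage C τ s z (n + 1) u = stage C τ s z n u := by
  induction n with
  | zero =>
    refine filtration_le (N := LinearMap.eqLocus _ _) fun w hw => ?_
    obtain rfl : w = [] := List.length_eq_zero_iff.1 (Nat.le_zero.1 hw)
    rw [LinearMap.mem_eqLocus, stage_succ_nil]
    simp [stage]
  | succ n ih =>
    refine filtration_le (N := LinearMap.eqLocus _ _) fun w hw => ?_
    rw [LinearMap.mem_eqLocus]
    cases w with
    | nil => rw [stage_succ_nil, stage_succ_nil]
    | cons i w =>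
      rw [stage_succ_cons, stage_succ_cons, ih]
      exact opE_mem_filtration C z _ (diag_mem_filtration _ _
        (single_mem_filtration (Nat.le_of_succ_le_succ hw)))

/-- The linear functional on the free algebra with `φ(1) = 1` that vanishes on the images
of the operators `F i + s i E (τ i) K' i`. -/
def phi : Words I →ₗ[Qv] Qv :=
  Finsupp.linearCombination Qv fun w => stage C τ s z w.length (Finsupp.single w 1)

theorem phi_single (w : List I) :
    phi C τ s z (Finsupp.single w 1) = stage C τ s z w.length (Finsupp.single w 1) := by
  simp [phi]

theorem phi_eq_stage (n : ℕ) : ∀ u ∈ filtration I n, phi C τ s z u = stage C τ s z n u := by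
  refine filtration_le (N := LinearMap.eqLocus _ _) fun w hw => ?_
  rw [LinearMap.mem_eqLocus, phi_single]
  induction n, hw using Nat.le_induction with
  | base => rfl
  | succ n hn ih => rw [ih, stage_stable _ _ _ _ _ _ (single_mem_filtration hn)]

theorem phi_nil : phi C τ s z (Finsupp.single [] 1) = 1 := by
  rw [phi_single]; simp [stage]

theorem phi_opF (i : I) (u : Words I) :
    phi C τ s z (opF i u) = -s i * phi C τ s z (opE C z (τ i) (opL C i u)) := by
  have : phi C τ s z ∘ₗ opF i = (-s i) • (phi C τ s z ∘ₗ opE C z (τ i) ∘ₗ opL C i) := by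
    refine end_ext fun w => ?_
    rw [LinearMap.comp_apply, opF_single, phi_single, List.length_cons, stage_succ_cons,
      ← phi_eq_stage]
    · rfl
    · exact opE_mem_filtration C z _ (diag_mem_filtration _ _ (single_mem_filtration le_rfl))
  exact LinearMap.congr_fun this u

variable {C τ} (hτ : IsInvolution C τ)
include hτ

theorem phi_opK_opL (i : I) (u : Words I) :
    phi C τ s z (opK C z i (opL C (τ i) u)) = z i * phi C τ s z u := by
  have hP := preDJ C z
  have key : ∀ n, ∀ u ∈ filtration I n,
      phi C τ s z (opK C z i (opL C (τ i) u)) = z i * phi C τ s z u := by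
    intro n
    have base : phi C τ s z (opK C z i (opL C (τ i) (Finsupp.single [] 1))) =
        z i * phi C τ s z (Finsupp.single [] 1) := by
      rw [opL, opK, diag_single, map_smul, diag_single, map_smul, map_smul]
      simp
    induction n with
    | zero =>
      refine filtration_le (N := LinearMap.eqLocus
        (phi C τ s z ∘ₗ opK C z i ∘ₗ opL C (τ i)) (z i • phi C τ s z)) fun w hw => ?_
      obtain rfl : w = [] := List.length_eq_zero_iff.1 (Nat.le_zero.1 hw)
      exact base
    | succ n ih =>
      refine filtration_le (N := LinearMap.eqLocus
        (phi C τ s z ∘ₗ opK C z i ∘ₗ opL C (τ i)) (z i • phi C τ s z)) fun w hw => ?_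
      cases w with
      | nil => exact base
      | cons j w =>
        -- both `F j` and `E (τ j) K' j` commute with `k i` up to the same scalar
        have hF : opK C z i * opL C (τ i) * opF j =
            (v ^ (-C i j) * v ^ C (τ i) j) • (opF j * (opK C z i * opL C (τ i))) := by
          rw [mul_assoc, hP.LF, mul_smul_comm, ← mul_assoc, hP.KF, smul_mul_assoc, smul_smul,
            mul_comm, mul_assoc]
        have hX : opE C z (τ j) * opL C j * (opK C z i * opL C (τ i)) =
            (v ^ (C i j) * v ^ (-C (τ i) j)) •
              (opK C z i * opL C (τ i) * (opE C z (τ j) * opL C j)) := by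
          have e1 : C (τ i) (τ j) = C i j := hτ.entry_eq i j
          have e2 : C i (τ j) = C (τ i) j := by
            rw [← hτ.entry_eq i (τ j), hτ.involutive j]
          have h1 : opK C z i * opL C (τ i) * opE C z (τ j) =
              (v ^ C (τ i) j * v ^ (-C i j)) • (opE C z (τ j) * (opK C z i * opL C (τ i))) := by
            rw [mul_assoc, hP.LE, mul_smul_comm, ← mul_assoc, hP.KE, smul_mul_assoc, smul_smul,
              e1, e2, mul_comm, mul_assoc]
          have h2 : opL C j * (opK C z i * opL C (τ i)) =
              opK C z i * opL C (τ i) * opL C j := by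
            rw [← mul_assoc, ← hP.KL, mul_assoc, hP.LL j, mul_assoc]
          have h3 : (v ^ C i j * v ^ (-C (τ i) j)) * (v ^ C (τ i) j * v ^ (-C i j)) = (1 : Qv) := by
            rw [zpow_neg, zpow_neg]
            have a1 : (v : Qv) ^ C i j ≠ 0 := zpow_ne_zero _ v_ne_zero
            have a2 : (v : Qv) ^ C (τ i) j ≠ 0 := zpow_ne_zero _ v_ne_zero
            field_simp
          rw [← mul_assoc (opK C z i * opL C (τ i)), h1, smul_mul_assoc, smul_smul, h3, one_smul,
            mul_assoc, h2]
          simp only [mul_assoc]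
        have hF' := LinearMap.congr_fun hF (Finsupp.single w 1)
        have hX' := LinearMap.congr_fun hX (Finsupp.single w 1)
        simp only [Module.End.mul_apply, LinearMap.smul_apply] at hF' hX'
        rw [LinearMap.mem_eqLocus, ← opF_single]
        simp only [LinearMap.comp_apply, LinearMap.smul_apply, smul_eq_mul]
        have hmem : opE C z (τ j) (opL C j (Finsupp.single w 1)) ∈ filtration I n :=
          opE_mem_filtration C z _ (diag_mem_filtration _ _
            (single_mem_filtration (Nat.le_of_succ_le_succ hw)))
        rw [hF', map_smul, phi_opF, hX', map_smul, ih _ hmem, phi_opF]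
        have h3 : (v ^ (-C i j) * v ^ C (τ i) j) * (v ^ C i j * v ^ (-C (τ i) j)) = (1 : Qv) := by
          rw [zpow_neg, zpow_neg]
          have a1 : (v : Qv) ^ C i j ≠ 0 := zpow_ne_zero _ v_ne_zero
          have a2 : (v : Qv) ^ C (τ i) j ≠ 0 := zpow_ne_zero _ v_ne_zero
          field_simp
        simp only [smul_eq_mul]
        linear_combination (-s j * (z i * phi C τ s z (opE C z (τ j) (opL C j
          (Finsupp.single w 1))))) * h3
  have htop : ∀ w : List I, (Finsupp.single w 1 : Words I) ∈ LinearMap.eqLocus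
      (phi C τ s z ∘ₗ opK C z i ∘ₗ opL C (τ i)) (z i • phi C τ s z) := fun w =>
    key w.length _ (single_mem_filtration le_rfl)
  have := end_ext (f := phi C τ s z ∘ₗ opK C z i ∘ₗ opL C (τ i)) (g := z i • phi C τ s z) htop
  exact LinearMap.congr_fun this u

/-- The functional vanishes on the quantum Serre expressions, by `PreDJ.serre_F_mem` for the right
ideal of all operators `T` with `φ ∘ T = 0`. -/
theorem phi_serre (hz0 : ∀ i, z i ≠ 0) (hs : ∀ i, C i (τ i) = 0 → s i = s (τ i))
    (hz : ∀ i, C i (τ i) = 0 → z i = z (τ i)) {i j : I} (hij : i ≠ j) (u : Words I) :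
    phi C τ s z (serre (1 - C i j).toNat (opF i) (opF j) u) = 0 := by
  let N : Submodule Qv (Module.End Qv (Words I)) :=
    { carrier := {T | ∀ u, phi C τ s z (T u) = 0}
      add_mem' := fun {S T} hS hT u => by rw [LinearMap.add_apply, map_add, hS, hT, add_zero]
      zero_mem' := fun u => by rw [LinearMap.zero_apply, map_zero]
      smul_mem' := fun r T hT u => by rw [LinearMap.smul_apply, map_smul, hT, smul_zero] }
  refine (preDJ C z).serre_F_mem hτ s z N (fun T hT S u => hT (S u)) (fun i u => ?_)
    (fun i T u => ?_) (fun i j => serre_opE C z hz0) hs hz hij u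
  · rw [LinearMap.add_apply, map_add, LinearMap.smul_apply, map_smul, Module.End.mul_apply,
      phi_opF, smul_eq_mul]
    ring
  · rw [LinearMap.sub_apply, map_sub, LinearMap.smul_apply, map_smul, Module.End.mul_apply,
      Module.End.mul_apply, phi_opK_opL s z hτ, smul_eq_mul, sub_self]

end Functional

/-! ### The Serre ideal -/

section SerreIdeal

variable (C : SymmetricGCM I)

/-- The part of the ideal generated by the quantum Serre expressions in the `F i` in which at most
`n` factors `F k` stand to the left of the Serre expression. -/
def serrePart : ℕ → Submodule Qv (Words I)
  | 0 => Submodule.span Qv {x | ∃ i j u, i ≠ j ∧ x = serre (1 - C i j).toNat (opF i) (opF j) u}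
  | n + 1 => serrePart n ⊔ ⨆ k, (serrePart n).map (opF k)

theorem serrePart_mono : Monotone (serrePart C) :=
  monotone_nat_of_le_succ fun _ => le_sup_left

theorem opF_mem_serrePart (k : I) {n : ℕ} {x : Words I} (hx : x ∈ serrePart C n) :
    opF k x ∈ serrePart C (n + 1) :=
  (le_trans (le_iSup (fun k => (serrePart C n).map (opF k)) k) le_sup_right :
    (serrePart C n).map (opF k) ≤ serrePart C (n + 1)) (Submodule.mem_map_of_mem hx)

theorem serrePart_induction {n : ℕ} {N : Submodule Qv (Words I)} (h0 : serrePart C n ≤ N)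
    (h1 : ∀ k, ∀ x ∈ serrePart C n, opF k x ∈ N) : serrePart C (n + 1) ≤ N :=
  sup_le h0 (iSup_le fun k => Submodule.map_le_iff_le_comap.2 (h1 k))

theorem serrePart_zero_le {N : Submodule Qv (Words I)}
    (h : ∀ i j u, i ≠ j → serre (1 - C i j).toNat (opF i) (opF j) u ∈ N) : serrePart C 0 ≤ N := by
  rw [serrePart, Submodule.span_le]
  rintro _ ⟨i, j, u, hij, rfl⟩
  exact h i j u hij

theorem serre_mem_serrePart {i j : I} (hij : i ≠ j) (u : Words I) :
    serre (1 - C i j).toNat (opF i) (opF j) u ∈ serrePart C 0 :=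
  Submodule.subset_span ⟨i, j, u, hij, rfl⟩

theorem diag_mem_serrePart (c : Qv) (μ : I → ℤ) (n : ℕ) :
    serrePart C n ≤ (serrePart C n).comap (diag c μ) := by
  induction n with
  | zero =>
    refine serrePart_zero_le C fun i j u hij => ?_
    have h := qcomm_skew (A := Module.End Qv (Words I)) (w := v)
      (t := v ^ (1 - ((1 - C i j).toNat : ℤ))) (diag_mul_opF c μ i) (diag_mul_opF c μ j) (1 - C i j).toNat
    rw [← serre_eq_skew] at h
    rw [Submodule.mem_comap, ← Module.End.mul_apply, h, LinearMap.smul_apply]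
    exact Submodule.smul_mem _ _ (serre_mem_serrePart C hij _)
  | succ n ih =>
    refine serrePart_induction C (fun x hx => serrePart_mono C n.le_succ (ih hx)) fun k x hx => ?_
    rw [Submodule.mem_comap, ← Module.End.mul_apply, diag_mul_opF, LinearMap.smul_apply]
    exact Submodule.smul_mem _ _ (opF_mem_serrePart C k (ih hx))

theorem opE_mem_serrePart (z : I → Qv) (k : I) (n : ℕ) :
    serrePart C n ≤ (serrePart C n).comap (opE C z k) := by
  induction n with
  | zero =>
    refine serrePart_zero_le C fun i j u hij => ?_
    rw [Submodule.mem_comap, ← Module.End.mul_apply,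
      (preDJ C z).E_mul_serre_F (fun i => ⟨_, opL_mul_inv C i⟩) hij]
    exact serre_mem_serrePart C hij _
  | succ n ih =>
    refine serrePart_induction C (fun x hx => serrePart_mono C n.le_succ (ih hx)) fun j x hx => ?_
    rw [Submodule.mem_comap, ← Module.End.mul_apply]
    by_cases hkj : k = j
    · subst hkj
      rw [opE_mul_opF_same, LinearMap.add_apply, LinearMap.smul_apply, LinearMap.sub_apply]
      exact Submodule.add_mem _ (opF_mem_serrePart C k (ih hx)) (Submodule.smul_mem _ _
        (serrePart_mono C n.le_succ (Submodule.sub_mem _ (diag_mem_serrePart C _ _ n hx)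
          (diag_mem_serrePart C _ _ n hx))))
    · rw [opE_mul_opF_of_ne C z hkj]
      exact opF_mem_serrePart C j (ih hx)

theorem phi_serrePart {τ : I → I} (hτ : IsInvolution C τ) (s z : I → Qv) (hz0 : ∀ i, z i ≠ 0)
    (hs : ∀ i, C i (τ i) = 0 → s i = s (τ i)) (hz : ∀ i, C i (τ i) = 0 → z i = z (τ i)) (n : ℕ) :
    serrePart C n ≤ LinearMap.ker (phi C τ s z) := by
  induction n with
  | zero => exact serrePart_zero_le C fun i j u hij => phi_serre s z hτ hz0 hs hz hij u
  | succ n ih =>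
    refine serrePart_induction C ih fun k x hx => ?_
    rw [LinearMap.mem_ker, phi_opF]
    have : phi C τ s z (opE C z (τ k) (opL C k x)) = 0 :=
      ih (opE_mem_serrePart C z _ n (diag_mem_serrePart C _ _ n hx))
    rw [this, mul_zero]

/-- The two-sided ideal of the free algebra generated by the quantum Serre expressions, as the union
of the `serrePart C n`. -/
def serreIdeal : Submodule Qv (Words I) := ⨆ n, serrePart C n

theorem mem_serreIdeal {x : Words I} : x ∈ serreIdeal C ↔ ∃ n, x ∈ serrePart C n :=
  Submodule.mem_iSup_of_directed _ (serrePart_mono C).directed_le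

end SerreIdeal

/-! ### The representation on the quotient by the Serre ideal -/

/-- The algebra of endomorphisms preserving a submodule. -/
def stabilizer {M : Type*} [AddCommGroup M] [Module Qv M] (W : Submodule Qv M) :
    Subalgebra Qv (Module.End Qv M) where
  carrier := {T | ∀ x ∈ W, T x ∈ W}
  mul_mem' hS hT x hx := hS _ (hT x hx)
  one_mem' _ hx := hx
  add_mem' hS hT x hx := W.add_mem (hS x hx) (hT x hx)
  zero_mem' _ _ := W.zero_mem
  algebraMap_mem' r _ hx := W.smul_mem r hx

/-- Stated separately because for `M = Words I` the additive structures underlying the two sides of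
`Subalgebra.toRing` agree only after unfolding. -/
instance {M : Type*} [AddCommGroup M] [Module Qv M] (W : Submodule Qv M) : Ring (stabilizer W) :=
  Subalgebra.toRing _

/-- The action of the stabilizer of a submodule on the quotient module. -/
def quotientAction {M : Type*} [AddCommGroup M] [Module Qv M] (W : Submodule Qv M) :
    stabilizer W →ₐ[Qv] Module.End Qv (M ⧸ W) where
  toFun T := W.mapQ W T.1 T.2
  map_one' := by ext; rfl
  map_mul' S T := by ext; rfl
  map_zero' := by ext; rfl
  map_add' S T := by ext; rfl
  commutes' r := by ext; rfl

theorem stabilizer_coe_serre {M : Type*} [AddCommGroup M] [Module Qv M] (W : Submodule Qv M)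
    (m : ℕ) (S T : stabilizer W) :
    ((serre m S T : stabilizer W) : Module.End Qv M) = serre m S.1 T.1 :=
  serre_map (stabilizer W).val m S T

theorem quotientAction_serre {M : Type*} [AddCommGroup M] [Module Qv M] (W : Submodule Qv M)
    (m : ℕ) (S T : stabilizer W) :
    quotientAction W (serre m S T) = serre m (quotientAction W S) (quotientAction W T) :=
  serre_map (quotientAction W) m S T

section Representation

variable (C : SymmetricGCM I) (z : I → Qv)

theorem opF_mem_stabilizer (i : I) : opF i ∈ stabilizer (serreIdeal C) := by
  intro x hx
  obtain ⟨n, hn⟩ := (mem_serreIdeal C).1 hx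
  exact (mem_serreIdeal C).2 ⟨_, opF_mem_serrePart C i hn⟩

theorem opE_mem_stabilizer (i : I) : opE C z i ∈ stabilizer (serreIdeal C) := by
  intro x hx
  obtain ⟨n, hn⟩ := (mem_serreIdeal C).1 hx
  exact (mem_serreIdeal C).2 ⟨_, opE_mem_serrePart C z i n hn⟩

theorem diag_mem_stabilizer (c : Qv) (μ : I → ℤ) : diag c μ ∈ stabilizer (serreIdeal C) := by
  intro x hx
  obtain ⟨n, hn⟩ := (mem_serreIdeal C).1 hx
  exact (mem_serreIdeal C).2 ⟨_, diag_mem_serrePart C c μ n hn⟩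

/-- The operator `E i` as an element of the stabilizer of the Serre ideal. -/
def stabE (i : I) : stabilizer (serreIdeal C) := ⟨opE C z i, opE_mem_stabilizer C z i⟩

/-- The operator `F i` as an element of the stabilizer of the Serre ideal. -/
def stabF (i : I) : stabilizer (serreIdeal C) :=
  ⟨opF i, opF_mem_stabilizer C i⟩

/-- A diagonal operator as an element of the stabilizer of the Serre ideal. -/
def stabDiag (c : Qv) (μ : I → ℤ) : stabilizer (serreIdeal C) :=
  ⟨diag c μ, diag_mem_stabilizer C c μ⟩

theorem stab_preDJ : PreDJ C (stabE C z) (stabF C) (fun i => stabDiag C (z i) (fun k => -C i k))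
    (fun i => stabDiag C 1 (fun k => C i k)) where
  EF_same i := Subtype.ext ((preDJ C z).EF_same i)
  EF_diff i j hij := Subtype.ext ((preDJ C z).EF_diff i j hij)
  KK i j := Subtype.ext ((preDJ C z).KK i j)
  KL i j := Subtype.ext ((preDJ C z).KL i j)
  LL i j := Subtype.ext ((preDJ C z).LL i j)
  KE i j := Subtype.ext ((preDJ C z).KE i j)
  KF i j := Subtype.ext ((preDJ C z).KF i j)
  LE i j := Subtype.ext ((preDJ C z).LE i j)
  LF i j := Subtype.ext ((preDJ C z).LF i j)

/-- The Verma module of `Ũ`: the quotient of the free algebra on the `F i` by the Serre ideal. -/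
def representation (hz : ∀ i, z i ≠ 0) :
    UTilde C →ₐ[Qv] Module.End Qv (Words I ⧸ serreIdeal C) :=
  UTilde.lift C (fun i => quotientAction _ (stabE C z i)) (fun i => quotientAction _ (stabF C i))
    (fun i => quotientAction _ (stabDiag C (z i) (fun k => -C i k)))
    (fun i => quotientAction _ (stabDiag C (z i)⁻¹ (fun k => C i k)))
    (fun i => quotientAction _ (stabDiag C 1 (fun k => C i k)))
    (fun i => quotientAction _ (stabDiag C 1 (fun k => -C i k)))
    (fun i => by
      rw [← map_mul, ← map_one (quotientAction (serreIdeal C))]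
      exact congrArg _ (Subtype.ext (opK_mul_inv C z hz i)))
    (fun i => by
      rw [← map_mul, ← map_one (quotientAction (serreIdeal C))]
      exact congrArg _ (Subtype.ext (opK_inv_mul C z hz i)))
    (fun i => by
      rw [← map_mul, ← map_one (quotientAction (serreIdeal C))]
      exact congrArg _ (Subtype.ext (opL_mul_inv C i)))
    (fun i => by
      rw [← map_mul, ← map_one (quotientAction (serreIdeal C))]
      exact congrArg _ (Subtype.ext (opL_inv_mul C i)))
    (((stab_preDJ C z).map (quotientAction (serreIdeal C))).eq_of_djRel
      (fun i j hij => by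
        have h : serre (1 - C i j).toNat (stabE C z i) (stabE C z j) = 0 :=
          Subtype.ext ((stabilizer_coe_serre _ _ _ _).trans (serre_opE C z hz hij))
        exact (quotientAction_serre _ _ _ _).symm.trans ((congrArg _ h).trans (map_zero _)))
      (fun i j hij => by
        refine (quotientAction_serre _ _ _ _).symm.trans
          (Submodule.linearMap_qext _ (LinearMap.ext fun x => ?_))
        change (serreIdeal C).mkQ
          ((serre (1 - C i j).toNat (stabF C i) (stabF C j) : stabilizer (serreIdeal C)).1 x) = 0
        rw [stabilizer_coe_serre, Submodule.mkQ_apply, Submodule.Quotient.mk_eq_zero]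
        exact (mem_serreIdeal C).2 ⟨0, serre_mem_serrePart C hij x⟩))

end Representation

end Verma

/-- A linear functional on `Ũ` that behaves like a character on the left: it is multiplicative with
respect to left multiplication by the generators `F i + s i E (τ i) K' i`, which it sends to `0`,
and `k i`, which it sends to `z i`. -/
theorem exists_functional {I : Type*} {C : SymmetricGCM I} {τ : I → I} (hτ : IsInvolution C τ)
    (s z : I → Qv) (hz0 : ∀ i, z i ≠ 0) (hs : ∀ i, C i (τ i) = 0 → s i = s (τ i))
    (hz : ∀ i, C i (τ i) = 0 → z i = z (τ i)) :
    ∃ φ : UTilde C →ₗ[Qv] Qv, φ 1 = 1 ∧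
      (∀ i u, φ ((UTilde.F C i + s i • (UTilde.E C (τ i) * UTilde.L C i)) * u) = 0) ∧
      ∀ i u, φ (kTilde C τ i * u) = z i * φ u := by
  let W := Verma.serreIdeal C
  have hW : W ≤ LinearMap.ker (Verma.phi C τ s z) :=
    iSup_le fun n => Verma.phi_serrePart C hτ s z hz0 hs hz n
  let ψ : (Verma.Words I ⧸ W) →ₗ[Qv] Qv := W.liftQ (Verma.phi C τ s z) hW
  have hψ : ∀ x, ψ (W.mkQ x) = Verma.phi C τ s z x := fun x => W.liftQ_apply _ x
  let ρ := Verma.representation C z hz0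
  have hE : ∀ i x, ρ (UTilde.E C i) (W.mkQ x) = W.mkQ (Verma.opE C z i x) := fun i x => by
    have : ρ (UTilde.E C i) = _ := UTilde.lift_of ..
    rw [this]; rfl
  have hF : ∀ i x, ρ (UTilde.F C i) (W.mkQ x) = W.mkQ (Verma.opF i x) := fun i x => by
    have : ρ (UTilde.F C i) = _ := UTilde.lift_of ..
    rw [this]; rfl
  have hK : ∀ i x, ρ (UTilde.K C i) (W.mkQ x) = W.mkQ (Verma.opK C z i x) := fun i x => by
    have : ρ (UTilde.K C i) = _ := UTilde.lift_of ..
    rw [this]; rfl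
  have hL : ∀ i x, ρ (UTilde.L C i) (W.mkQ x) = W.mkQ (Verma.opL C i x) := fun i x => by
    have : ρ (UTilde.L C i) = _ := UTilde.lift_of ..
    rw [this]; rfl
  refine ⟨ψ ∘ₗ LinearMap.applyₗ (W.mkQ (Finsupp.single [] 1)) ∘ₗ ρ.toLinearMap, ?_, ?_, ?_⟩
  · simp only [LinearMap.comp_apply, AlgHom.toLinearMap_apply, map_one, LinearMap.applyₗ_apply_apply,
      Module.End.one_apply]
    rw [hψ, Verma.phi_nil]
  · intro i u
    simp only [LinearMap.comp_apply, AlgHom.toLinearMap_apply, map_mul, map_add, map_smul,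
      LinearMap.applyₗ_apply_apply, Module.End.mul_apply, LinearMap.add_apply,
      LinearMap.smul_apply]
    obtain ⟨x, hx⟩ := W.mkQ_surjective (ρ u (W.mkQ (Finsupp.single [] 1)))
    rw [← hx, hL, hE, hF, hψ, hψ, Verma.phi_opF, smul_eq_mul]
    ring
  · intro i u
    simp only [kTilde, LinearMap.comp_apply, AlgHom.toLinearMap_apply, map_mul,
      LinearMap.applyₗ_apply_apply, Module.End.mul_apply]
    obtain ⟨x, hx⟩ := W.mkQ_surjective (ρ u (W.mkQ (Finsupp.single [] 1)))
    rw [← hx, hL, hK, hψ, hψ, Verma.phi_opK_opL s z hτ]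

/-! ### The coideal property -/

section Twist

variable {I : Type*} {C : SymmetricGCM I} {τ : I → I}

theorem UTilde.preDJ (C : SymmetricGCM I) :
    PreDJ C (UTilde.E C) (UTilde.F C) (UTilde.K C) (UTilde.L C) where
  EF_same i := by rw [← UTilde.rel C (DJRel.EF_same i), add_sub_cancel]
  EF_diff i j hij := sub_eq_zero.1 (UTilde.rel C (DJRel.EF_diff i j hij))
  KK i j := UTilde.rel C (DJRel.KK i j)
  KL i j := UTilde.rel C (DJRel.KL i j)
  LL i j := UTilde.rel C (DJRel.LL i j)
  KE i j := UTilde.rel C (DJRel.KE i j)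
  KF i j := UTilde.rel C (DJRel.KF i j)
  LE i j := UTilde.rel C (DJRel.LE i j)
  LF i j := UTilde.rel C (DJRel.LF i j)

theorem kTilde_mul_kTildeInv (C : SymmetricGCM I) (τ : I → I) (i : I) :
    kTilde C τ i * kTildeInv C τ i = 1 := by
  rw [kTilde, kTildeInv, mul_assoc, ← mul_assoc (UTilde.L C (τ i)), UTilde.L_Linv, one_mul,
    UTilde.K_Kinv]

theorem kTildeInv_mul_kTilde (C : SymmetricGCM I) (τ : I → I) (i : I) :
    kTildeInv C τ i * kTilde C τ i = 1 := by
  rw [kTilde, kTildeInv, mul_assoc, ← mul_assoc (UTilde.Kinv C i), UTilde.Kinv_K, one_mul,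
    UTilde.Linv_L]

theorem comul_kTilde (i : I) :
    UTilde.comul C (kTilde C τ i) = kTilde C τ i ⊗ₜ[Qv] kTilde C τ i := by
  rw [kTilde, map_mul, UTilde.comul_K, UTilde.comul_L, Algebra.TensorProduct.tmul_mul_tmul]

theorem comul_kTildeInv (i : I) :
    UTilde.comul C (kTildeInv C τ i) = kTildeInv C τ i ⊗ₜ[Qv] kTildeInv C τ i := by
  refine left_inv_eq_right_inv (a := UTilde.comul C (kTilde C τ i)) ?_ ?_
  · rw [← map_mul, kTildeInv_mul_kTilde, map_one]
  · rw [comul_kTilde, Algebra.TensorProduct.tmul_mul_tmul, kTilde_mul_kTildeInv,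
      Algebra.TensorProduct.one_def]

theorem comul_F_add_smul (hτ : IsInvolution C τ) (c : Qv) (i : I) :
    UTilde.comul C (UTilde.F C i + c • (UTilde.E C (τ i) * UTilde.L C i)) =
      (UTilde.F C i + c • (UTilde.E C (τ i) * UTilde.L C i)) ⊗ₜ[Qv] UTilde.L C i +
        1 ⊗ₜ[Qv] UTilde.F C i +
        kTilde C τ (τ i) ⊗ₜ[Qv] (c • (UTilde.E C (τ i) * UTilde.L C i)) := by
  rw [map_add, map_smul, map_mul, UTilde.comul_F, UTilde.comul_E, UTilde.comul_L, add_mul,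
    Algebra.TensorProduct.tmul_mul_tmul, Algebra.TensorProduct.tmul_mul_tmul, one_mul, kTilde,
    hτ.involutive i, TensorProduct.add_tmul, TensorProduct.tmul_smul, smul_add,
    TensorProduct.smul_tmul']
  abel

theorem comul_BTilde (hτ : IsInvolution C τ) (i : I) :
    UTilde.comul C (BTilde C τ i) = BTilde C τ i ⊗ₜ[Qv] UTilde.L C i + 1 ⊗ₜ[Qv] UTilde.F C i +
        kTilde C τ (τ i) ⊗ₜ[Qv] (UTilde.E C (τ i) * UTilde.L C i) := by
  simpa only [one_smul, BTilde] using comul_F_add_smul hτ 1 i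

theorem BTilde_mem (i : I) : BTilde C τ i ∈ UiTilde C τ :=
  Algebra.subset_adjoin (Or.inl (Or.inl ⟨i, rfl⟩))

theorem kTilde_mem (i : I) : kTilde C τ i ∈ UiTilde C τ :=
  Algebra.subset_adjoin (Or.inl (Or.inr ⟨i, rfl⟩))

theorem kTildeInv_mem (i : I) : kTildeInv C τ i ∈ UiTilde C τ :=
  Algebra.subset_adjoin (Or.inr ⟨i, rfl⟩)

theorem isRightCoideal_UiTilde (hτ : IsInvolution C τ) : IsRightCoideal C (UiTilde C τ) := by
  have key : UiTilde C τ ≤ (Algebra.TensorProduct.map (UiTilde C τ).val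
      (AlgHom.id Qv (UTilde C))).range.comap (UTilde.comul C) := by
    have tmul_mem : ∀ a ∈ UiTilde C τ, ∀ b, a ⊗ₜ[Qv] b ∈
        (Algebra.TensorProduct.map (UiTilde C τ).val (AlgHom.id Qv (UTilde C))).range :=
      fun a ha b => ⟨⟨a, ha⟩ ⊗ₜ[Qv] b, rfl⟩
    refine Algebra.adjoin_le ?_
    rintro _ ((⟨i, rfl⟩ | ⟨i, rfl⟩) | ⟨i, rfl⟩)
    · rw [SetLike.mem_coe, Subalgebra.mem_comap, comul_BTilde hτ]
      exact add_mem (add_mem (tmul_mem _ (BTilde_mem i) _) (tmul_mem _ (one_mem _) _))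
        (tmul_mem _ (kTilde_mem _) _)
    · rw [SetLike.mem_coe, Subalgebra.mem_comap, comul_kTilde]
      exact tmul_mem _ (kTilde_mem _) _
    · rw [SetLike.mem_coe, Subalgebra.mem_comap, comul_kTildeInv]
      exact tmul_mem _ (kTildeInv_mem _) _
  exact fun x hx => key hx

/-! ### The twist -/

/-- A linear endomorphism `Θ` of `Ũ` that, with respect to left multiplication, sends
`F i + s i E (τ i) K' i` to `F i + s i z (τ i) E (τ i) K' i` and `k̃ i` to `z i k̃ i`.
For `s = 1` it restricts to a homomorphism on `Ũ^ı`. -/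
structure IsTwist (C : SymmetricGCM I) (τ : I → I) (s z : I → Qv)
    (Θ : UTilde C →ₗ[Qv] UTilde C) : Prop where
  map_one : Θ 1 = 1
  map_B_mul : ∀ i u, Θ ((UTilde.F C i + s i • (UTilde.E C (τ i) * UTilde.L C i)) * u) =
    (UTilde.F C i + (s i * z (τ i)) • (UTilde.E C (τ i) * UTilde.L C i)) * Θ u
  map_k_mul : ∀ i u, Θ (kTilde C τ i * u) = z i • (kTilde C τ i * Θ u)

/-- The twist is `(φ ⊗ id) Δ` for the functional `φ` of `exists_functional`. -/
theorem exists_isTwist (hτ : IsInvolution C τ) (s z : I → Qv) (hz0 : ∀ i, z i ≠ 0)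
    (hs : ∀ i, C i (τ i) = 0 → s i = s (τ i)) (hz : ∀ i, C i (τ i) = 0 → z i = z (τ i)) :
    ∃ Θ, IsTwist C τ s z Θ := by
  obtain ⟨φ, h1, hB, hk⟩ := exists_functional hτ s z hz0 hs hz
  let M : UTilde C ⊗[Qv] UTilde C →ₗ[Qv] UTilde C :=
    TensorProduct.lift ((LinearMap.lsmul Qv (UTilde C)).comp φ)
  have hM : ∀ a b, M (a ⊗ₜ b) = φ a • b := fun a b => by
    rw [TensorProduct.lift.tmul]; rfl
  -- if `φ (a * u) = c φ u` for all `u`, then left multiplication by `a ⊗ b` becomes that by `c b`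
  have key : ∀ (a : UTilde C) (c : Qv), (∀ u, φ (a * u) = c * φ u) → ∀ b t,
      M ((a ⊗ₜ[Qv] b) * t) = (c • b) * M t := by
    intro a c hac b t
    induction t with
    | zero => rw [mul_zero, map_zero, mul_zero]
    | add x y hx hy => rw [mul_add, map_add, hx, hy, map_add, mul_add]
    | tmul x y =>
      rw [Algebra.TensorProduct.tmul_mul_tmul, hM, hM, hac, smul_mul_smul_comm]
  refine ⟨M ∘ₗ (UTilde.comul C).toLinearMap, ?_, fun i u => ?_, fun i u => ?_⟩
  · rw [LinearMap.comp_apply, AlgHom.toLinearMap_apply, map_one, Algebra.TensorProduct.one_def, hM,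
      h1, one_smul]
  · simp only [LinearMap.comp_apply, AlgHom.toLinearMap_apply]
    rw [map_mul, comul_F_add_smul hτ, add_mul, add_mul, map_add, map_add,
      key _ 0 (fun u => by rw [hB, zero_mul]), key _ 1 (fun u => by rw [one_mul, one_mul]),
      key _ (z (τ i)) (hk (τ i)), zero_smul, zero_mul, zero_add, one_smul, ← add_mul, smul_smul,
      mul_comm (z (τ i))]
  · simp only [LinearMap.comp_apply, AlgHom.toLinearMap_apply]
    rw [map_mul, comul_kTilde, key _ (z i) (hk i), smul_mul_assoc]

namespace IsTwist

variable {s z : I → Qv} {Θ : UTilde C →ₗ[Qv] UTilde C}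

theorem map_kInv_mul (h : IsTwist C τ s z Θ) (hz0 : ∀ i, z i ≠ 0) (i : I) (u : UTilde C) :
    Θ (kTildeInv C τ i * u) = (z i)⁻¹ • (kTildeInv C τ i * Θ u) := by
  have := h.map_k_mul i (kTildeInv C τ i * u)
  rw [← mul_assoc, kTilde_mul_kTildeInv, one_mul] at this
  rw [this, mul_smul_comm, ← mul_assoc, kTildeInv_mul_kTilde, one_mul, smul_smul,
    inv_mul_cancel₀ (hz0 i), one_smul]

theorem map_BTilde_mul (h : IsTwist C τ 1 z Θ) (i : I) (u : UTilde C) :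
    Θ (BTilde C τ i * u) =
      (UTilde.F C i + z (τ i) • (UTilde.E C (τ i) * UTilde.L C i)) * Θ u := by
  simpa only [Pi.one_apply, one_smul, one_mul, BTilde] using h.map_B_mul i u

/-- The twist intertwines left multiplication by a generator of `Ũ^ı` with left multiplication by some
element, and is therefore multiplicative on `Ũ^ı`. -/
theorem map_mul (h : IsTwist C τ 1 z Θ) (hz0 : ∀ i, z i ≠ 0) {a : UTilde C}
    (ha : a ∈ UiTilde C τ) (u : UTilde C) : Θ (a * u) = Θ a * Θ u := by
  -- a generator acts on the left through the image of `1`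
  have gen : ∀ a b : UTilde C, (∀ u, Θ (a * u) = b * Θ u) → ∀ u, Θ (a * u) = Θ a * Θ u := by
    intro a b hab u
    have := hab 1
    rw [mul_one, h.map_one, mul_one] at this
    rw [hab, this]
  induction ha using Algebra.adjoin_induction generalizing u with
  | mem x hx =>
    rcases hx with (⟨i, rfl⟩ | ⟨i, rfl⟩) | ⟨i, rfl⟩
    · exact gen _ _ (h.map_BTilde_mul i) u
    · exact gen _ (z i • kTilde C τ i) (fun u => by rw [h.map_k_mul, smul_mul_assoc]) u
    · exact gen _ ((z i)⁻¹ • kTildeInv C τ i)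
        (fun u => by rw [h.map_kInv_mul hz0, smul_mul_assoc]) u
  | algebraMap r =>
    rw [Algebra.algebraMap_eq_smul_one, smul_mul_assoc, one_mul, map_smul, map_smul, h.map_one,
      smul_mul_assoc, one_mul]
  | add x y _ _ hx hy => rw [add_mul, map_add, hx, hy, map_add, add_mul]
  | mul x y _ _ hx hy => rw [mul_assoc, hx, hy, hx, mul_assoc]

/-- The twist is injective on `Ũ^ı`, a left inverse being the twist with inverse parameters. -/
theorem injective (hτ : IsInvolution C τ) (h : IsTwist C τ 1 z Θ) (hz0 : ∀ i, z i ≠ 0)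
    (hz : ∀ i, C i (τ i) = 0 → z i = z (τ i)) {a : UTilde C} (ha : a ∈ UiTilde C τ)
    (h0 : Θ a = 0) : a = 0 := by
  obtain ⟨Θ', h'⟩ := exists_isTwist hτ (fun i => z (τ i)) (fun i => (z i)⁻¹)
    (fun i => inv_ne_zero (hz0 i)) (fun i hi => by rw [hτ.involutive, hz i hi])
    (fun i hi => by rw [hz i hi])
  have key : ∀ u, Θ' (Θ (a * u)) = a * Θ' (Θ u) := by
    clear h0
    intro u
    induction ha using Algebra.adjoin_induction generalizing u with
    | mem x hx =>
      rcases hx with (⟨i, rfl⟩ | ⟨i, rfl⟩) | ⟨i, rfl⟩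
      · rw [h.map_BTilde_mul, h'.map_B_mul, mul_inv_cancel₀ (hz0 _), one_smul, BTilde]
      · rw [h.map_k_mul, map_smul, h'.map_k_mul, smul_smul, mul_inv_cancel₀ (hz0 _), one_smul]
      · rw [h.map_kInv_mul hz0, map_smul, h'.map_kInv_mul fun i => inv_ne_zero (hz0 i), smul_smul,
          inv_inv, inv_mul_cancel₀ (hz0 _), one_smul]
    | algebraMap r => simp only [Algebra.algebraMap_eq_smul_one, smul_mul_assoc, one_mul, map_smul]
    | add x y _ _ hx hy => rw [add_mul, map_add, map_add, hx, hy, add_mul]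
    | mul x y _ _ hx hy => rw [mul_assoc, hx, hy, mul_assoc]
  have := key 1
  rwa [h.map_one, h'.map_one, mul_one, h0, LinearMap.map_zero, eq_comm] at this

end IsTwist

end Twist

section TwistHom

variable {I : Type*} {C : SymmetricGCM I} {τ : I → I}

/-- The twist as an injective homomorphism on `Ũ^ı`; the specialization `K̃' i ↦ (K̃ i)⁻¹` turns
the images of the `B i` into the generators of `U^ı_ς`. -/
theorem exists_twistHom (hτ : IsInvolution C τ) (ς : I → Qv) (hς0 : ∀ i, ς i ≠ 0)
    (hς : ∀ i, C i (τ i) = 0 → ς i = ς (τ i)) :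
    ∃ Θ : UiTilde C τ →ₐ[Qv] UTilde C, Function.Injective Θ ∧
      (∀ i, Θ (UiTilde.B C τ i) =
        UTilde.F C i + ς i • (UTilde.E C (τ i) * UTilde.L C i)) ∧
      ∀ i, Θ (UiTilde.k C τ i) = ς (τ i) • kTilde C τ i := by
  have hz0 : ∀ i, ς (τ i) ≠ 0 := fun i => hς0 _
  have hz : ∀ i, C i (τ i) = 0 → ς (τ i) = ς (τ (τ i)) := fun i hi => by
    rw [hτ.involutive, hς i hi]
  obtain ⟨Θ, h⟩ := exists_isTwist hτ 1 (fun i => ς (τ i)) hz0 (fun _ _ => rfl) hz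
  refine ⟨AlgHom.ofLinearMap (Θ ∘ₗ (UiTilde C τ).val.toLinearMap) h.map_one
    (fun a b => h.map_mul hz0 a.2 b), ?_, fun i => ?_, fun i => ?_⟩
  · rw [injective_iff_map_eq_zero]
    exact fun a ha => Subtype.ext (h.injective hτ hz0 hz a.2 ha)
  · have := h.map_BTilde_mul i 1
    rw [mul_one, h.map_one, mul_one, hτ.involutive] at this
    exact this
  · have := h.map_k_mul i 1
    rw [mul_one, h.map_one, mul_one] at this
    exact this

end TwistHom

/-! ### The specialization to `U` -/

section Specialization

variable {I : Type*} (C : SymmetricGCM I)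

theorem U.rel {x y : U C} (h : DJRel C (U.E C) (U.F C) (U.K C) (U.Kinv C) x y) : x = y := by
  let φ : FreeAlgebra Qv (UGen I) →ₐ[Qv] U C := RingQuot.mkAlgHom Qv (URel C)
  have hφ : ∀ a b, DJRel C (fun i => FreeAlgebra.ι Qv (UGen.E i))
      (fun i => FreeAlgebra.ι Qv (UGen.F i)) (fun i => FreeAlgebra.ι Qv (UGen.K i))
      (fun i => FreeAlgebra.ι Qv (UGen.Kinv i)) a b → φ a = φ b :=
    fun a b hab => RingQuot.mkAlgHom_rel Qv (URel.dj a b hab)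
  have hE : ∀ i, U.E C i = φ (FreeAlgebra.ι Qv (UGen.E i)) := fun _ => rfl
  have hF : ∀ i, U.F C i = φ (FreeAlgebra.ι Qv (UGen.F i)) := fun _ => rfl
  have hK : ∀ i, U.K C i = φ (FreeAlgebra.ι Qv (UGen.K i)) := fun _ => rfl
  have hL : ∀ i, U.Kinv C i = φ (FreeAlgebra.ι Qv (UGen.Kinv i)) := fun _ => rfl
  cases h with
  | EF_same i =>
    simpa only [hE, hF, hK, hL, map_mul, map_sub, map_smul] using hφ _ _ (DJRel.EF_same i)
  | EF_diff i j h =>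
    simpa only [hE, hF, map_mul, map_sub, map_zero] using hφ _ _ (DJRel.EF_diff i j h)
  | KK i j => simpa only [hK, map_mul] using hφ _ _ (DJRel.KK i j)
  | KL i j => simpa only [hK, hL, map_mul] using hφ _ _ (DJRel.KL i j)
  | LL i j => simpa only [hL, map_mul] using hφ _ _ (DJRel.LL i j)
  | KE i j => simpa only [hE, hK, map_mul, map_smul] using hφ _ _ (DJRel.KE i j)
  | KF i j => simpa only [hF, hK, map_mul, map_smul] using hφ _ _ (DJRel.KF i j)
  | LE i j => simpa only [hE, hL, map_mul, map_smul] using hφ _ _ (DJRel.LE i j)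
  | LF i j => simpa only [hF, hL, map_mul, map_smul] using hφ _ _ (DJRel.LF i j)
  | serreE i j h =>
    simpa only [hE, serre_map, map_zero] using hφ _ _ (DJRel.serreE i j h)
  | serreF i j h =>
    simpa only [hF, serre_map, map_zero] using hφ _ _ (DJRel.serreF i j h)

theorem U.K_mul_Kinv (i : I) : U.K C i * U.Kinv C i = 1 := by
  have h : RingQuot.mkAlgHom Qv (URel C) _ = RingQuot.mkAlgHom Qv (URel C) _ :=
    RingQuot.mkAlgHom_rel Qv (URel.K_Kinv i)
  rw [map_mul, map_one] at h
  exact h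

theorem U.Kinv_mul_K (i : I) : U.Kinv C i * U.K C i = 1 := by
  have h : RingQuot.mkAlgHom Qv (URel C) _ = RingQuot.mkAlgHom Qv (URel C) _ :=
    RingQuot.mkAlgHom_rel Qv (URel.Kinv_K i)
  rw [map_mul, map_one] at h
  exact h

/-- The specialization `Ũ → U` sending `K̃' i` to `(K i)⁻¹`. -/
def specialize : UTilde C →ₐ[Qv] U C :=
  UTilde.lift C (U.E C) (U.F C) (U.K C) (U.Kinv C) (U.Kinv C) (U.K C) (U.K_mul_Kinv C)
    (U.Kinv_mul_K C) (U.Kinv_mul_K C) (U.K_mul_Kinv C) fun _ _ h => U.rel C h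

theorem specialize_E (i : I) : specialize C (UTilde.E C i) = U.E C i := UTilde.lift_of ..
theorem specialize_F (i : I) : specialize C (UTilde.F C i) = U.F C i := UTilde.lift_of ..
theorem specialize_K (i : I) : specialize C (UTilde.K C i) = U.K C i := UTilde.lift_of ..
theorem specialize_L (i : I) : specialize C (UTilde.L C i) = U.Kinv C i := UTilde.lift_of ..

/-- Two algebra homomorphisms on `Ũ` agree if they agree on the `E i`, `F i`, `K̃ i`, `K̃' i`. -/
theorem UTilde.hom_ext {A : Type*} [Ring A] [Algebra Qv A] {f g : UTilde C →ₐ[Qv] A}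
    (hE : ∀ i, f (UTilde.E C i) = g (UTilde.E C i)) (hF : ∀ i, f (UTilde.F C i) = g (UTilde.F C i))
    (hK : ∀ i, f (UTilde.K C i) = g (UTilde.K C i))
    (hL : ∀ i, f (UTilde.L C i) = g (UTilde.L C i)) : f = g := by
  have inv : ∀ {a b : UTilde C}, a * b = 1 → b * a = 1 → f a = g a → f b = g b := by
    intro a b hab hba h
    refine left_inv_eq_right_inv (a := f a) ?_ ?_
    · rw [← map_mul, hba, map_one]
    · rw [h, ← map_mul, hab, map_one]
  refine RingQuot.ringQuot_ext' Qv f g (FreeAlgebra.hom_ext (funext fun x => ?_))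
  cases x with
  | E i => exact hE i
  | F i => exact hF i
  | K i => exact hK i
  | Kinv i => exact inv (UTilde.K_Kinv C i) (UTilde.Kinv_K C i) (hK i)
  | L i => exact hL i
  | Linv i => exact inv (UTilde.L_Linv C i) (UTilde.Linv_L C i) (hL i)

/-- The kernel of the specialization is generated by the elements `K̃ i K̃' i - 1`: every
homomorphism sending all `K̃ i K̃' i` to `1` factors through `U`. -/
theorem map_eq_zero_of_specialize_eq_zero {A : Type*} [Ring A] [Algebra Qv A] (m : UTilde C →ₐ[Qv] A)
    (hm : ∀ i, m (UTilde.K C i * UTilde.L C i) = 1) {b : UTilde C} (hb : specialize C b = 0) :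
    m b = 0 := by
  have hKL : ∀ i, m (UTilde.K C i) * m (UTilde.L C i) = 1 := fun i => by rw [← map_mul, hm]
  have hLK : ∀ i, m (UTilde.L C i) * m (UTilde.K C i) = 1 := fun i => by
    rw [← map_mul, ← (UTilde.preDJ C).KL, hm]
  let gen : UGen I → A
    | UGen.E i => m (UTilde.E C i)
    | UGen.F i => m (UTilde.F C i)
    | UGen.K i => m (UTilde.K C i)
    | UGen.Kinv i => m (UTilde.L C i)
  let σ : U C →ₐ[Qv] A := RingQuot.liftAlgHom Qv ⟨FreeAlgebra.lift Qv gen, by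
    intro x y hxy
    cases hxy with
    | K_Kinv i => simpa [gen] using hKL i
    | Kinv_K i => simpa [gen] using hLK i
    | dj x y hd =>
      have := hd.map (FreeAlgebra.lift Qv gen)
      simp only [FreeAlgebra.lift_ι_apply, gen] at this
      exact ((UTilde.preDJ C).map m).eq_of_djRel
        (fun i j hij => by rw [← serre_map, UTilde.rel C (DJRel.serreE i j hij), map_zero])
        (fun i j hij => by rw [← serre_map, UTilde.rel C (DJRel.serreF i j hij), map_zero]) _ _
        this⟩
  have hσ : ∀ g, σ (U.of C g) = gen g := by
    intro g
    change RingQuot.liftAlgHom Qv _ (RingQuot.mkAlgHom Qv (URel C) _) = _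
    rw [RingQuot.liftAlgHom_mkAlgHom_apply, FreeAlgebra.lift_ι_apply]
  have : σ.comp (specialize C) = m := UTilde.hom_ext C
    (fun i => by rw [AlgHom.comp_apply, specialize_E]; exact hσ _)
    (fun i => by rw [AlgHom.comp_apply, specialize_F]; exact hσ _)
    (fun i => by rw [AlgHom.comp_apply, specialize_K]; exact hσ _)
    (fun i => by rw [AlgHom.comp_apply, specialize_L]; exact hσ _)
  rw [← this, AlgHom.comp_apply, hb, map_zero]

end Specialization

/-! ### The weight grading -/

section Grading

variable {I : Type*} (C : SymmetricGCM I) (τ : I → I)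

/-- The group of weights by which `Ũ` is graded in `coaction`. -/
abbrev Weight (I : Type*) : Type _ := (I → ℤ) × (I → ℤ)

theorem serre_single {A H : Type*} [Ring A] [Algebra Qv A] [AddCommMonoid H] (m : ℕ) (a b : H)
    (x y : A) : serre m (AddMonoidAlgebra.single a x) (AddMonoidAlgebra.single b y) =
      AddMonoidAlgebra.single (m • a + b) (serre m x y) := by
  rw [serre, serre, ← AddMonoidAlgebra.singleAddHom_apply (m := m • a + b), map_sum]
  refine Finset.sum_congr rfl fun r hr => ?_
  rw [AddMonoidAlgebra.singleAddHom_apply, AddMonoidAlgebra.single_pow, AddMonoidAlgebra.single_pow,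
    AddMonoidAlgebra.single_mul_single, AddMonoidAlgebra.single_mul_single,
    AddMonoidAlgebra.smul_single]
  congr 1
  obtain ⟨d, rfl⟩ := Nat.exists_eq_add_of_le (Nat.le_of_lt_succ (Finset.mem_range.1 hr))
  rw [Nat.add_sub_cancel_left, add_smul]
  abel

open Classical in
/-- The vector `σ i = ι (τ i) - ι i`, where `ι i` is the basis vector of `I → ℤ`. -/
def sigma (i : I) : I → ℤ := Pi.single (τ i) 1 - Pi.single i 1

open Classical in
/-- The coaction `Ũ → Ũ[H]`, `u ↦ u e^h` for `u` homogeneous of weight `h`, of the grading of `Ũ` by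
`H = Weight I` in which `F i` has the weight `(ι i, σ i)`, `E i` the weight `(0, -σ i)`, and `K̃ i` and
`K̃' i` the weight `(ι i, 0)`. Both summands of `B i` then have the weight `(ι i, σ i)`. -/
def coaction : UTilde C →ₐ[Qv] AddMonoidAlgebra (UTilde C) (Weight I) :=
  UTilde.lift C (fun i => .single (0, -sigma τ i) (UTilde.E C i))
    (fun i => .single (Pi.single i 1, sigma τ i) (UTilde.F C i))
    (fun i => .single (Pi.single i 1, 0) (UTilde.K C i))
    (fun i => .single (-Pi.single i 1, 0) (UTilde.Kinv C i))
    (fun i => .single (Pi.single i 1, 0) (UTilde.L C i))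
    (fun i => .single (-Pi.single i 1, 0) (UTilde.Linv C i))
    (fun i => by
      rw [AddMonoidAlgebra.single_mul_single, UTilde.K_Kinv, AddMonoidAlgebra.one_def]; simp; rfl)
    (fun i => by
      rw [AddMonoidAlgebra.single_mul_single, UTilde.Kinv_K, AddMonoidAlgebra.one_def]; simp; rfl)
    (fun i => by
      rw [AddMonoidAlgebra.single_mul_single, UTilde.L_Linv, AddMonoidAlgebra.one_def]; simp; rfl)
    (fun i => by
      rw [AddMonoidAlgebra.single_mul_single, UTilde.Linv_L, AddMonoidAlgebra.one_def]; simp; rfl)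
    (PreDJ.eq_of_djRel
      { EF_same := fun i => by
          rw [AddMonoidAlgebra.single_mul_single, AddMonoidAlgebra.single_mul_single,
            (UTilde.preDJ C).EF_same, ← AddMonoidAlgebra.single_sub, AddMonoidAlgebra.smul_single,
            AddMonoidAlgebra.single_add]
          simp
        EF_diff := fun i j hij => by
          rw [AddMonoidAlgebra.single_mul_single, AddMonoidAlgebra.single_mul_single,
            (UTilde.preDJ C).EF_diff i j hij, add_comm]
        KK := fun i j => by
          rw [AddMonoidAlgebra.single_mul_single, AddMonoidAlgebra.single_mul_single,
            (UTilde.preDJ C).KK, add_comm]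
        KL := fun i j => by
          rw [AddMonoidAlgebra.single_mul_single, AddMonoidAlgebra.single_mul_single,
            (UTilde.preDJ C).KL, add_comm]
        LL := fun i j => by
          rw [AddMonoidAlgebra.single_mul_single, AddMonoidAlgebra.single_mul_single,
            (UTilde.preDJ C).LL, add_comm]
        KE := fun i j => by
          rw [AddMonoidAlgebra.single_mul_single, AddMonoidAlgebra.single_mul_single,
            (UTilde.preDJ C).KE, add_comm, AddMonoidAlgebra.smul_single]
        KF := fun i j => by
          rw [AddMonoidAlgebra.single_mul_single, AddMonoidAlgebra.single_mul_single,
            (UTilde.preDJ C).KF, add_comm, AddMonoidAlgebra.smul_single]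
        LE := fun i j => by
          rw [AddMonoidAlgebra.single_mul_single, AddMonoidAlgebra.single_mul_single,
            (UTilde.preDJ C).LE, add_comm, AddMonoidAlgebra.smul_single]
        LF := fun i j => by
          rw [AddMonoidAlgebra.single_mul_single, AddMonoidAlgebra.single_mul_single,
            (UTilde.preDJ C).LF, add_comm, AddMonoidAlgebra.smul_single] }
      (fun i j hij => by
        rw [serre_single, UTilde.rel C (DJRel.serreE i j hij), AddMonoidAlgebra.single_zero])
      (fun i j hij => by
        rw [serre_single, UTilde.rel C (DJRel.serreF i j hij), AddMonoidAlgebra.single_zero]))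

theorem coaction_E (i : I) :
    coaction C τ (UTilde.E C i) = .single (0, -sigma τ i) (UTilde.E C i) := UTilde.lift_of ..

theorem coaction_F [DecidableEq I] (i : I) :
    coaction C τ (UTilde.F C i) = .single (Pi.single i 1, sigma τ i) (UTilde.F C i) := by
  refine (UTilde.lift_of ..).trans ?_
  rw [UTilde.genMap]; congr!

theorem coaction_K [DecidableEq I] (i : I) :
    coaction C τ (UTilde.K C i) = .single (Pi.single i 1, 0) (UTilde.K C i) := by
  refine (UTilde.lift_of ..).trans ?_
  rw [UTilde.genMap]; congr!

theorem coaction_L [DecidableEq I] (i : I) :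
    coaction C τ (UTilde.L C i) = .single (Pi.single i 1, 0) (UTilde.L C i) := by
  refine (UTilde.lift_of ..).trans ?_
  rw [UTilde.genMap]; congr!

end Grading

/-! ### Central monomials -/

section Center

variable {I : Type*} (C : SymmetricGCM I)

theorem UTilde.mem_of_generators {S : Subalgebra Qv (UTilde C)} (hS : ∀ g, UTilde.of C g ∈ S)
    (u : UTilde C) : u ∈ S := by
  obtain ⟨x, rfl⟩ := RingQuot.mkAlgHom_surjective Qv (DRel C) u
  induction x using FreeAlgebra.induction with
  | grade0 r => rw [AlgHom.commutes]; exact S.algebraMap_mem r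
  | grade1 g => exact hS g
  | mul x y hx hy => rw [map_mul]; exact S.mul_mem hx hy
  | add x y hx hy => rw [map_add]; exact S.add_mem hx hy

theorem commute_K_mul_L (i : I) (u : UTilde C) :
    (UTilde.K C i * UTilde.L C i) * u = u * (UTilde.K C i * UTilde.L C i) := by
  have hP := UTilde.preDJ C
  have inv : ∀ {a b : UTilde C}, a * b = 1 → b * a = 1 →
      Commute (UTilde.K C i * UTilde.L C i) a → Commute (UTilde.K C i * UTilde.L C i) b :=
    fun {a b} hab hba h => (show Commute _ ((Units.mk a b hab hba)⁻¹ : (UTilde C)ˣ).1 from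
      Commute.units_inv_right h)
  have hK : ∀ j, Commute (UTilde.K C i * UTilde.L C i) (UTilde.K C j) := fun j =>
    Commute.mul_left (hP.KK i j) (hP.KL j i).symm
  have hL : ∀ j, Commute (UTilde.K C i * UTilde.L C i) (UTilde.L C j) := fun j =>
    Commute.mul_left (hP.KL i j) (hP.LL i j)
  have := UTilde.mem_of_generators C
    (S := Subalgebra.centralizer Qv {UTilde.K C i * UTilde.L C i}) (fun g => by
      rw [Subalgebra.mem_centralizer_iff]
      rintro _ rfl
      cases g with
      | E j => exact hP.KL_mul_E i j
      | F j => exact hP.KL_mul_F i j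
      | K j => exact hK j
      | Kinv j => exact inv (UTilde.K_Kinv C j) (UTilde.Kinv_K C j) (hK j)
      | L j => exact hL j
      | Linv j => exact inv (UTilde.L_Linv C j) (UTilde.Linv_L C j) (hL j)) u
  exact (Subalgebra.mem_centralizer_iff Qv).1 this _ rfl

/-- The invertible central element `K̃ i K̃' i`. -/
def centralUnit (i : I) : (Subalgebra.center Qv (UTilde C))ˣ where
  val := ⟨UTilde.K C i * UTilde.L C i,
    Subalgebra.mem_center_iff.2 fun u => (commute_K_mul_L C i u).symm⟩
  inv := ⟨UTilde.Linv C i * UTilde.Kinv C i, Subalgebra.mem_center_iff.2 fun u => by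
    have h1 : UTilde.K C i * UTilde.L C i * (UTilde.Linv C i * UTilde.Kinv C i) = 1 := by
      rw [mul_assoc, ← mul_assoc (UTilde.L C i), UTilde.L_Linv, one_mul, UTilde.K_Kinv]
    have h2 : UTilde.Linv C i * UTilde.Kinv C i * (UTilde.K C i * UTilde.L C i) = 1 := by
      rw [mul_assoc, ← mul_assoc (UTilde.Kinv C i), UTilde.Kinv_K, one_mul, UTilde.Linv_L]
    exact (Commute.units_inv_right (u := Units.mk _ _ h1 h2) (commute_K_mul_L C i u).symm).eq⟩
  val_inv := Subtype.ext <| by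
    change UTilde.K C i * UTilde.L C i * (UTilde.Linv C i * UTilde.Kinv C i) = 1
    rw [mul_assoc, ← mul_assoc (UTilde.L C i), UTilde.L_Linv, one_mul, UTilde.K_Kinv]
  inv_val := Subtype.ext <| by
    change UTilde.Linv C i * UTilde.Kinv C i * (UTilde.K C i * UTilde.L C i) = 1
    rw [mul_assoc, ← mul_assoc (UTilde.Kinv C i), UTilde.Kinv_K, one_mul, UTilde.Linv_L]

variable [Fintype I]

/-- The central element `∏ (K̃ i K̃' i) ^ n i`. -/
def centralMonomial (n : I → ℤ) : UTilde C :=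
  ((∏ i, centralUnit C i ^ n i : (Subalgebra.center Qv (UTilde C))ˣ) :
    Subalgebra.center Qv (UTilde C))

theorem centralMonomial_zero : centralMonomial C 0 = 1 := by
  simp [centralMonomial]

theorem centralMonomial_add (m n : I → ℤ) :
    centralMonomial C (m + n) = centralMonomial C m * centralMonomial C n := by
  simp only [centralMonomial, Pi.add_apply, zpow_add, Finset.prod_mul_distrib, Units.val_mul,
    MulMemClass.coe_mul]

theorem centralMonomial_single [DecidableEq I] (i : I) :
    centralMonomial C (Pi.single i 1) = UTilde.K C i * UTilde.L C i := by
  have : ∏ j, centralUnit C j ^ (Pi.single i 1 : I → ℤ) j = centralUnit C i := by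
    rw [Finset.prod_eq_single i]
    · rw [Pi.single_eq_same, zpow_one]
    · intro j _ hj; rw [Pi.single_eq_of_ne hj, zpow_zero]
    · intro h; exact absurd (Finset.mem_univ i) h
  rw [centralMonomial, this]; rfl

theorem centralMonomial_neg_mul (n : I → ℤ) :
    centralMonomial C (-n) * centralMonomial C n = 1 := by
  rw [← centralMonomial_add, neg_add_cancel, centralMonomial_zero]

end Center

/-! ### Normalization of homogeneous components -/

section Normalization

variable {I : Type*} (C : SymmetricGCM I) (τ : I → I) (J : Set I)

open Classical in
/-- The exponents of the central monomial extracted from an element of weight `h`. They are chosen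
such that adding the weight of `K̃ i K̃' i` to `h` adds `1` to the exponent at `i`, and that they
are `τ`-symmetric for the weights of products of generators of `Ũ^ı`. -/
def exponent (h : Weight I) (i : I) : ℤ :=
  if i ∈ J then h.1 i / 2 else (h.1 i + h.2 i) / 2

theorem exponent_add [DecidableEq I] (h : Weight I) (i : I) :
    exponent J ((Pi.single i 1, 0) + (Pi.single i 1, 0) + h) = Pi.single i 1 + exponent J h := by
  funext k
  simp only [exponent, Prod.fst_add, Prod.snd_add, Pi.add_apply, Pi.zero_apply, zero_add]
  rcases eq_or_ne k i with rfl | hk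
  · rw [Pi.single_eq_same]; split_ifs <;> omega
  · rw [Pi.single_eq_of_ne hk]; split_ifs <;> omega

variable [Fintype I]

/-- The map `Ũ[H] → Ũ` that multiplies the component of weight `h` by the central monomial with
exponents `-exponent J h`. -/
def collect : AddMonoidAlgebra (UTilde C) (Weight I) →ₗ[Qv] UTilde C :=
  Finsupp.lsum Qv (fun h => LinearMap.mulLeft Qv (centralMonomial C (-exponent J h))) ∘ₗ
    (AddMonoidAlgebra.coeffLinearEquiv Qv).toLinearMap

theorem collect_single (h : Weight I) (u : UTilde C) :
    collect C J (.single h u) = centralMonomial C (-exponent J h) * u := by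
  rw [collect, LinearMap.comp_apply]
  exact Finsupp.lsum_single ..

/-- The linear map that multiplies the homogeneous components by central monomials so as to
identify `K̃ i K̃' i` with `1`. -/
def normalize : UTilde C →ₗ[Qv] UTilde C := collect C J ∘ₗ (coaction C τ).toLinearMap

theorem normalize_K_mul_L_mul (i : I) (u : UTilde C) :
    normalize C τ J (UTilde.K C i * UTilde.L C i * u) = normalize C τ J u := by
  classical
  rw [normalize, LinearMap.comp_apply, LinearMap.comp_apply, AlgHom.toLinearMap_apply,
    AlgHom.toLinearMap_apply, map_mul (coaction C τ), map_mul (coaction C τ), coaction_K, coaction_L,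
    AddMonoidAlgebra.single_mul_single]
  generalize coaction C τ u = x
  induction x using AddMonoidAlgebra.induction_linear with
  | zero => rw [mul_zero]
  | add x y hx hy => rw [mul_add, map_add, hx, hy, map_add]
  | single h a =>
    rw [AddMonoidAlgebra.single_mul_single, collect_single, collect_single, exponent_add, neg_add,
      add_comm, centralMonomial_add, ← centralMonomial_single, mul_assoc,
      ← mul_assoc (centralMonomial C (-Pi.single i 1)), centralMonomial_neg_mul, one_mul]

/-- The kernel of the specialization is killed by the normalization: it lies in the largest two-sided
ideal killed by the normalization, which contains the `K̃ i K̃' i - 1`. -/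
theorem normalize_eq_zero {b : UTilde C} (hb : specialize C b = 0) : normalize C τ J b = 0 := by
  let N : TwoSidedIdeal (UTilde C) := TwoSidedIdeal.mk'
    {b | ∀ x y, normalize C τ J (x * b * y) = 0}
    (fun x y => by rw [mul_zero, zero_mul, map_zero])
    (fun {a b} ha hb x y => by rw [mul_add, add_mul, map_add, ha, hb, add_zero])
    (fun {a} ha x y => by rw [mul_neg, neg_mul, map_neg, ha, neg_zero])
    (fun {a b} hb x y => by rw [← mul_assoc x a b]; exact hb (x * a) y)
    (fun {a b} ha x y => by rw [← mul_assoc x a b, mul_assoc _ b y]; exact ha x (b * y))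
  have hmem : ∀ b, b ∈ N ↔ ∀ x y, normalize C τ J (x * b * y) = 0 := fun b =>
    TwoSidedIdeal.mem_mk' ..
  have hN : N.ringCon b 0 := by
    have := map_eq_zero_of_specialize_eq_zero C (N.ringCon.mkₐ Qv) (fun i => by
      rw [← map_one (N.ringCon.mkₐ Qv)]
      refine (RingCon.eq _).2 ((TwoSidedIdeal.rel_iff ..).2 ((hmem _).2 fun x y => ?_))
      rw [mul_sub, sub_mul, mul_one, map_sub, ← commute_K_mul_L, mul_assoc _ x y,
        normalize_K_mul_L_mul, sub_self]) hb
    rw [← map_zero (N.ringCon.mkₐ Qv)] at this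
    exact (RingCon.eq _).1 this
  have := (hmem b).1 ((TwoSidedIdeal.mem_iff ..).2 hN) 1 1
  rwa [one_mul, mul_one] at this

end Normalization

/-! ### Homogeneous elements -/

section Homogeneous

variable {I : Type*} {C : SymmetricGCM I} {τ : I → I}

/-- Homogeneous elements of `Ũ` whose weight is of the form `(ν, ν ∘ τ - ν)`, as are the weights of
products of generators of `Ũ^ı`. -/
def IsHomogeneous (C : SymmetricGCM I) (τ : I → I) (u : UTilde C) : Prop :=
  ∃ ν : I → ℤ, coaction C τ u = .single (ν, ν ∘ τ - ν) u

theorem isHomogeneous_one : IsHomogeneous C τ 1 := by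
  refine ⟨0, ?_⟩
  rw [map_one, AddMonoidAlgebra.one_def]
  congr 1

theorem IsHomogeneous.smul {u : UTilde C} (hu : IsHomogeneous C τ u) (c : Qv) :
    IsHomogeneous C τ (c • u) := by
  obtain ⟨ν, h⟩ := hu
  exact ⟨ν, by rw [map_smul, h, AddMonoidAlgebra.smul_single]⟩

theorem IsHomogeneous.mul {u w : UTilde C} (hu : IsHomogeneous C τ u)
    (hw : IsHomogeneous C τ w) : IsHomogeneous C τ (u * w) := by
  obtain ⟨μ, hμ⟩ := hu
  obtain ⟨ν, hν⟩ := hw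
  refine ⟨μ + ν, ?_⟩
  rw [map_mul, hμ, hν, AddMonoidAlgebra.single_mul_single]
  congr 1
  rw [Prod.mk_add_mk]
  congr 1
  funext k
  simp only [Pi.add_apply, Pi.sub_apply, Function.comp_apply]
  ring

theorem IsHomogeneous.inv {u w : UTilde C} (hu : IsHomogeneous C τ u) (h1 : u * w = 1)
    (h2 : w * u = 1) : IsHomogeneous C τ w := by
  obtain ⟨ν, hν⟩ := hu
  refine ⟨-ν, left_inv_eq_right_inv (a := coaction C τ u) ?_ ?_⟩
  · rw [← map_mul, h2, map_one]
  · rw [hν, AddMonoidAlgebra.single_mul_single, h1, AddMonoidAlgebra.one_def]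
    congr 1
    ext k <;> simp

theorem isHomogeneous_F_add_smul (hτ : IsInvolution C τ) (c : Qv) (i : I) :
    IsHomogeneous C τ (UTilde.F C i + c • (UTilde.E C (τ i) * UTilde.L C i)) := by
  classical
  refine ⟨Pi.single i 1, ?_⟩
  have h1 : sigma τ i = (Pi.single i 1 : I → ℤ) ∘ τ - Pi.single i 1 := by
    funext k
    simp only [sigma, Pi.sub_apply, Function.comp_apply, Pi.single_apply,
      hτ.involutive.eq_iff (x := k)]
  have h2 : -sigma τ (τ i) = sigma τ i := by
    rw [sigma, sigma, hτ.involutive, neg_sub]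
  rw [map_add, map_smul, map_mul, coaction_F, coaction_E, coaction_L,
    AddMonoidAlgebra.single_mul_single, AddMonoidAlgebra.smul_single, Prod.mk_add_mk, zero_add,
    add_zero, h2, ← h1, AddMonoidAlgebra.single_add]

theorem isHomogeneous_kTilde (hτ : IsInvolution C τ) (i : I) :
    IsHomogeneous C τ (kTilde C τ i) := by
  classical
  refine ⟨Pi.single i 1 + Pi.single (τ i) 1, ?_⟩
  rw [kTilde, map_mul, coaction_K, coaction_L, AddMonoidAlgebra.single_mul_single,
    Prod.mk_add_mk, add_zero]
  congr 2
  funext k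
  simp only [Pi.add_apply, Pi.sub_apply, Pi.zero_apply, Function.comp_apply, Pi.single_apply,
    hτ.involutive.eq_iff (x := k), hτ.involutive i]
  ring

/-- `k̃ i` as a unit of `Ũ^ı`. -/
def UiTilde.kUnit (C : SymmetricGCM I) (τ : I → I) (i : I) : (UiTilde C τ)ˣ where
  val := UiTilde.k C τ i
  inv := ⟨kTildeInv C τ i, kTildeInv_mem i⟩
  val_inv := Subtype.ext (kTilde_mul_kTildeInv C τ i)
  inv_val := Subtype.ext (kTildeInv_mul_kTilde C τ i)

end Homogeneous

/-! ### Orbits of the involution -/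

section Orbits

variable {I : Type*} {τ : I → I} {J : Set I}

/-- The weights of products of generators of `Ũ^ı` have `τ`-symmetric exponents. -/
theorem exponent_symm (hτ : Function.Involutive τ) (hJ : IsOrbitReps τ J) (ν : I → ℤ) (i : I) :
    exponent J (ν, ν ∘ τ - ν) (τ i) = exponent J (ν, ν ∘ τ - ν) i := by
  obtain ⟨j, ⟨hj, hji⟩, huniq⟩ := hJ i
  by_cases h1 : i ∈ J <;> by_cases h2 : τ i ∈ J
  · rw [← (huniq i ⟨h1, Or.inl rfl⟩).trans (huniq (τ i) ⟨h2, Or.inr rfl⟩).symm]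
  · simp [exponent, h1, h2, hτ i]
  · simp [exponent, h1, h2]
  · rcases hji with rfl | rfl
    · exact absurd hj h1
    · exact absurd hj h2

open Classical in
/-- A `τ`-symmetric vector is an integral combination of the indicators of the orbits. -/
theorem eq_sum_orbits [Fintype I] (hτ : Function.Involutive τ) (hJ : IsOrbitReps τ J) {n : I → ℤ}
    (hn : ∀ i, n (τ i) = n i) :
    n = ∑ i, (if i ∈ J then n i else 0) • fun k => if k = i ∨ k = τ i then (1 : ℤ) else 0 := by
  funext k
  obtain ⟨j, ⟨hj, hjk⟩, huniq⟩ := hJ k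
  have hkj : k = j ∨ k = τ j := by
    rcases hjk with rfl | rfl
    · exact Or.inl rfl
    · exact Or.inr (hτ k).symm
  rw [Finset.sum_apply, Finset.sum_eq_single j]
  · rw [if_pos hj, Pi.smul_apply, if_pos hkj, smul_eq_mul, mul_one]
    rcases hjk with rfl | rfl
    · rfl
    · exact (hn k).symm
  · intro i _ hij
    rw [Pi.smul_apply]
    split_ifs with h1 h2
    · refine absurd (huniq i ⟨h1, ?_⟩) hij
      rcases h2 with rfl | rfl
      · exact Or.inl rfl
      · exact Or.inr (hτ i).symm
    all_goals simp
  · intro h; exact absurd (Finset.mem_univ j) h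

end Orbits

/-! ### The kernel of the specialized twist -/

section Kernel

variable {I : Type*} {C : SymmetricGCM I} {τ : I → I} {J : Set I} {ς : I → Qv}

theorem mk_k_of_eq {i : I} (hi : τ i = i) :
    CentralReduction.mk C τ ς (UiTilde.k C τ i) = algebraMap Qv _ (ς i) := by
  rw [← AlgHom.commutes (CentralReduction.mk C τ ς)]
  exact (RingCon.eq _).2 ((TwoSidedIdeal.rel_iff ..).2
    (TwoSidedIdeal.subset_span (Or.inl ⟨i, hi, rfl⟩)))

theorem mk_k_mul_k_of_ne {i : I} (hi : τ i ≠ i) :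
    CentralReduction.mk C τ ς (UiTilde.k C τ i * UiTilde.k C τ (τ i)) =
      algebraMap Qv _ (ς i * ς (τ i)) := by
  rw [← AlgHom.commutes (CentralReduction.mk C τ ς)]
  exact (RingCon.eq _).2 ((TwoSidedIdeal.rel_iff ..).2
    (TwoSidedIdeal.subset_span (Or.inr ⟨i, hi, rfl⟩)))

theorem mk_k_mul_k (i : I) :
    CentralReduction.mk C τ ς (UiTilde.k C τ i * UiTilde.k C τ (τ i)) =
      algebraMap Qv _ (ς i * ς (τ i)) := by
  by_cases hi : τ i = i
  · rw [map_mul, mk_k_of_eq hi, hi, mk_k_of_eq hi, ← map_mul]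
  · exact mk_k_mul_k_of_ne hi

variable [Fintype I] {Θ : UiTilde C τ →ₐ[Qv] UTilde C}

/-- The exponents of the central monomials that are images under `Θ` of units of `Ũ^ı` which the
central reduction sends to `1`. -/
def liftableExponents (ς : I → Qv) (Θ : UiTilde C τ →ₐ[Qv] UTilde C) : AddSubgroup (I → ℤ) where
  carrier := {n | ∃ ζ : (UiTilde C τ)ˣ, Θ ζ = centralMonomial C n ∧
    CentralReduction.mk C τ ς ζ = 1}
  zero_mem' := ⟨1, by rw [Units.val_one, map_one, centralMonomial_zero],
    by rw [Units.val_one, map_one]⟩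
  add_mem' := by
    rintro m n ⟨ζ, h1, h2⟩ ⟨ξ, h3, h4⟩
    exact ⟨ζ * ξ, by rw [Units.val_mul, map_mul, h1, h3, centralMonomial_add],
      by rw [Units.val_mul, map_mul, h2, h4, one_mul]⟩
  neg_mem' := by
    rintro n ⟨ζ, h1, h2⟩
    refine ⟨ζ⁻¹, ?_, ?_⟩
    · refine (left_inv_eq_right_inv (centralMonomial_neg_mul C n) ?_).symm
      rw [← h1, ← map_mul, Units.mul_inv, map_one]
    · rw [← one_mul (CentralReduction.mk C τ ς _), ← h2, ← map_mul, Units.mul_inv, map_one, h2]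

theorem mem_liftableExponents (hτ : IsInvolution C τ) (hJ : IsOrbitReps τ J)
    (hς0 : ∀ i, ς i ≠ 0) (hk : ∀ i, Θ (UiTilde.k C τ i) = ς (τ i) • kTilde C τ i)
    {n : I → ℤ} (hn : ∀ i, n (τ i) = n i) : n ∈ liftableExponents ς Θ := by
  classical
  have scal : ∀ c : Qv, c ≠ 0 → ∃ r : (UiTilde C τ)ˣ, (r : UiTilde C τ) = algebraMap Qv _ c :=
    fun c hc => ⟨Units.map (algebraMap Qv (UiTilde C τ)).toMonoidHom (Units.mk0 c hc), rfl⟩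
  rw [eq_sum_orbits hτ.involutive hJ hn]
  refine AddSubgroup.sum_mem _ fun i _ => AddSubgroup.zsmul_mem _ ?_ _
  by_cases hi : τ i = i
  · obtain ⟨r, hr⟩ := scal (ς i)⁻¹ (inv_ne_zero (hς0 i))
    refine ⟨r * UiTilde.kUnit C τ i, ?_, ?_⟩
    · have : (fun k => if k = i ∨ k = τ i then (1 : ℤ) else 0) = Pi.single i 1 := by
        funext k; simp only [hi, or_self, Pi.single_apply]
      rw [this, centralMonomial_single, Units.val_mul, hr, ← Algebra.smul_def, map_smul]
      change _ • Θ (UiTilde.k C τ i) = _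
      rw [hk, kTilde, hi, smul_smul, inv_mul_cancel₀ (hς0 i), one_smul]
    · rw [Units.val_mul, hr, ← Algebra.smul_def, map_smul]
      change _ • CentralReduction.mk C τ ς (UiTilde.k C τ i) = 1
      rw [mk_k_of_eq hi, Algebra.smul_def, ← map_mul, inv_mul_cancel₀ (hς0 i), map_one]
  · have h0 : ς i * ς (τ i) ≠ 0 := mul_ne_zero (hς0 _) (hς0 _)
    obtain ⟨r, hr⟩ := scal (ς i * ς (τ i))⁻¹ (inv_ne_zero h0)
    refine ⟨r * (UiTilde.kUnit C τ i * UiTilde.kUnit C τ (τ i)), ?_, ?_⟩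
    · have : (fun k => if k = i ∨ k = τ i then (1 : ℤ) else 0) =
          Pi.single i 1 + Pi.single (τ i) 1 := by
        funext k
        rw [Pi.add_apply, Pi.single_apply, Pi.single_apply]
        rcases eq_or_ne k i with rfl | hki
        · simp [Ne.symm hi]
        · simp [hki]
      rw [this, centralMonomial_add, centralMonomial_single, centralMonomial_single,
        Units.val_mul, hr, ← Algebra.smul_def, map_smul, Units.val_mul, map_mul]
      change _ • (Θ (UiTilde.k C τ i) * Θ (UiTilde.k C τ (τ i))) = _
      have hP := UTilde.preDJ C
      rw [hk, hk, smul_mul_smul_comm, smul_smul, hτ.involutive, mul_comm (ς (τ i)),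
        inv_mul_cancel₀ h0, one_smul, kTilde, kTilde, hτ.involutive, mul_assoc, mul_assoc,
        ← mul_assoc (UTilde.L C (τ i)), ← hP.KL, mul_assoc, hP.LL,
        ← mul_assoc (UTilde.K C (τ i)), hP.KL, mul_assoc]
    · rw [Units.val_mul, hr, ← Algebra.smul_def, map_smul, Units.val_mul]
      change _ • CentralReduction.mk C τ ς (UiTilde.k C τ i * UiTilde.k C τ (τ i)) = 1
      rw [mk_k_mul_k, Algebra.smul_def, ← map_mul, inv_mul_cancel₀ h0, map_one]

/-- The normalization preserves the image of `Ũ^ı`, and changes preimages only within their classes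
modulo the reduction ideal. -/
theorem exists_normalize_eq (hτ : IsInvolution C τ) (hJ : IsOrbitReps τ J)
    (hς0 : ∀ i, ς i ≠ 0)
    (hB : ∀ i, Θ (UiTilde.B C τ i) = UTilde.F C i + ς i • (UTilde.E C (τ i) * UTilde.L C i))
    (hk : ∀ i, Θ (UiTilde.k C τ i) = ς (τ i) • kTilde C τ i) (a : UiTilde C τ) :
    ∃ a', normalize C τ J (Θ a) = Θ a' ∧
      CentralReduction.mk C τ ς a = CentralReduction.mk C τ ς a' := by
  have hgen : ∀ x ∈ Set.range (BTilde C τ) ∪ Set.range (kTilde C τ) ∪ Set.range (kTildeInv C τ),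
      ∀ h : x ∈ UiTilde C τ, IsHomogeneous C τ (Θ ⟨x, h⟩) := by
    rintro _ ((⟨i, rfl⟩ | ⟨i, rfl⟩) | ⟨i, rfl⟩) h
    · exact (hB i).symm ▸ isHomogeneous_F_add_smul hτ (ς i) i
    · exact (hk i).symm ▸ (isHomogeneous_kTilde hτ i).smul _
    · refine ((hk i).symm ▸ (isHomogeneous_kTilde hτ i).smul _ :
        IsHomogeneous C τ (Θ (UiTilde.k C τ i))).inv ?_ ?_
      · rw [← map_mul]
        exact (congrArg Θ (Subtype.ext (kTilde_mul_kTildeInv C τ i))).trans (map_one Θ)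
      · rw [← map_mul]
        exact (congrArg Θ (Subtype.ext (kTildeInv_mul_kTilde C τ i))).trans (map_one Θ)
  have hmon : ∀ x ∈ Submonoid.closure (Set.range (BTilde C τ) ∪ Set.range (kTilde C τ) ∪
      Set.range (kTildeInv C τ)), ∃ h : x ∈ UiTilde C τ, IsHomogeneous C τ (Θ ⟨x, h⟩) := by
    intro x hx
    induction hx using Submonoid.closure_induction with
    | mem x hx => exact ⟨Algebra.subset_adjoin hx, hgen x hx _⟩
    | one => exact ⟨one_mem _, (map_one Θ).symm ▸ isHomogeneous_one⟩
    | mul x y _ _ hx hy =>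
      obtain ⟨h1, h2⟩ := hx
      obtain ⟨h3, h4⟩ := hy
      exact ⟨mul_mem h1 h3, (map_mul Θ ⟨x, h1⟩ ⟨y, h3⟩).symm ▸ h2.mul h4⟩
  obtain ⟨a, ha⟩ := a
  have hspan : a ∈ Submodule.span Qv (Submonoid.closure (Set.range (BTilde C τ) ∪
      Set.range (kTilde C τ) ∪ Set.range (kTildeInv C τ)) : Set (UTilde C)) := by
    rw [← Algebra.adjoin_eq_span]; exact ha
  suffices ∃ h : a ∈ UiTilde C τ, ∃ a', normalize C τ J (Θ ⟨a, h⟩) = Θ a' ∧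
      CentralReduction.mk C τ ς ⟨a, h⟩ = CentralReduction.mk C τ ς a' from this.2
  clear ha
  induction hspan using Submodule.span_induction with
  | mem x hx =>
    obtain ⟨h, ν, hν⟩ := hmon x hx
    refine ⟨h, ?_⟩
    obtain ⟨ζ, h1, h2⟩ := mem_liftableExponents (Θ := Θ) hτ hJ hς0 hk
      (n := -exponent J (ν, ν ∘ τ - ν))
      (fun i => congrArg Neg.neg (exponent_symm hτ.involutive hJ ν i))
    refine ⟨ζ * ⟨x, h⟩, ?_, ?_⟩
    · rw [normalize, LinearMap.comp_apply, AlgHom.toLinearMap_apply, hν, collect_single, map_mul,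
        h1]
    · rw [map_mul, h2, one_mul]
  | zero => exact ⟨zero_mem _, 0, by
      rw [show (⟨0, zero_mem _⟩ : UiTilde C τ) = 0 from rfl, map_zero, map_zero], rfl⟩
  | add x y _ _ hx hy =>
    obtain ⟨h1, a, h2, h3⟩ := hx
    obtain ⟨h4, b, h5, h6⟩ := hy
    refine ⟨add_mem h1 h4, a + b, ?_, ?_⟩
    · rw [show (⟨x + y, add_mem h1 h4⟩ : UiTilde C τ) = ⟨x, h1⟩ + ⟨y, h4⟩ from rfl, map_add, map_add,
        h2, h5, map_add]
    · rw [show (⟨x + y, add_mem h1 h4⟩ : UiTilde C τ) = ⟨x, h1⟩ + ⟨y, h4⟩ from rfl, map_add, h3, h6,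
        map_add]
  | smul r x _ hx =>
    obtain ⟨h1, a, h2, h3⟩ := hx
    refine ⟨Subalgebra.smul_mem _ h1 r, r • a, ?_, ?_⟩
    · rw [show (⟨r • x, Subalgebra.smul_mem _ h1 r⟩ : UiTilde C τ) = r • ⟨x, h1⟩ from rfl, map_smul,
        map_smul, h2, map_smul]
    · rw [show (⟨r • x, Subalgebra.smul_mem _ h1 r⟩ : UiTilde C τ) = r • ⟨x, h1⟩ from rfl, map_smul,
        h3, map_smul]

theorem mk_eq_zero_of_specialize_eq_zero (hτ : IsInvolution C τ) (hJ : IsOrbitReps τ J)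
    (hς0 : ∀ i, ς i ≠ 0) (hΘ : Function.Injective Θ)
    (hB : ∀ i, Θ (UiTilde.B C τ i) = UTilde.F C i + ς i • (UTilde.E C (τ i) * UTilde.L C i))
    (hk : ∀ i, Θ (UiTilde.k C τ i) = ς (τ i) • kTilde C τ i) {a : UiTilde C τ}
    (ha : specialize C (Θ a) = 0) : CentralReduction.mk C τ ς a = 0 := by
  obtain ⟨a', h1, h2⟩ := exists_normalize_eq (J := J) hτ hJ hς0 hB hk a
  rw [normalize_eq_zero C τ J ha, eq_comm, map_eq_zero_iff Θ hΘ] at h1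
  rw [h2, h1, map_zero]

end Kernel

/-! ### The image of the specialized twist -/

section Range

variable {I : Type*} {C : SymmetricGCM I} {τ : I → I} {J : Set I} {ς : I → Qv}
  {Θ : UiTilde C τ →ₐ[Qv] UTilde C}

theorem specialize_kTilde (i : I) : specialize C (kTilde C τ i) = kElt C τ i := by
  rw [kTilde, map_mul, specialize_K, specialize_L, kElt]

theorem kElt_apply_involution (hτ : Function.Involutive τ) (i : I) :
    kElt C τ (τ i) = kEltInv C τ i := by
  rw [kElt, kEltInv, hτ]

theorem kElt_mul_kEltInv (i : I) : kElt C τ i * kEltInv C τ i = 1 := by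
  rw [kElt, kEltInv, mul_assoc, ← mul_assoc (U.Kinv C (τ i)), U.Kinv_mul_K, one_mul, U.K_mul_Kinv]

/-- The image in `U` of the twisted subalgebra `Ũ^ı` is `U^ı_ς`. -/
theorem range_specialize_comp (hτ : IsInvolution C τ) (hJ : IsOrbitReps τ J)
    (hς0 : ∀ i, ς i ≠ 0)
    (hB : ∀ i, Θ (UiTilde.B C τ i) = UTilde.F C i + ς i • (UTilde.E C (τ i) * UTilde.L C i))
    (hk : ∀ i, Θ (UiTilde.k C τ i) = ς (τ i) • kTilde C τ i) :
    ((specialize C).comp Θ).range = Ui C τ ς J := by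
  have hB' : ∀ i, specialize C (Θ (UiTilde.B C τ i)) = BElt C τ ς i := fun i => by
    rw [hB, map_add, map_smul, map_mul, specialize_F, specialize_E, specialize_L, BElt]
  have hk' : ∀ i, specialize C (Θ (UiTilde.k C τ i)) = ς (τ i) • kElt C τ i := fun i => by
    rw [hk, map_smul, specialize_kTilde]
  have hkElt : ∀ i, kElt C τ i ∈ Ui C τ ς J := fun i => by
    obtain ⟨j, ⟨hj, hji⟩, -⟩ := hJ i
    rcases hji with rfl | rfl
    · exact Algebra.subset_adjoin (Or.inl (Or.inr ⟨j, hj, rfl⟩))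
    · refine Algebra.subset_adjoin (Or.inr ⟨τ i, hj, ?_⟩)
      rw [← kElt_apply_involution hτ.involutive, hτ.involutive]
  apply le_antisymm
  · rintro _ ⟨⟨a, ha⟩, rfl⟩
    change specialize C (Θ ⟨a, ha⟩) ∈ _
    induction ha using Algebra.adjoin_induction with
    | mem x hx =>
      rcases hx with (⟨i, rfl⟩ | ⟨i, rfl⟩) | ⟨i, rfl⟩
      · exact (hB' i).symm ▸ Algebra.subset_adjoin (Or.inl (Or.inl ⟨i, rfl⟩))
      · exact (hk' i).symm ▸ Subalgebra.smul_mem _ (hkElt i) _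
      · have h1 : ((specialize C).comp Θ) ⟨kTildeInv C τ i, kTildeInv_mem i⟩ =
            (ς (τ i))⁻¹ • kEltInv C τ i := by
          refine left_inv_eq_right_inv (a := specialize C (Θ (UiTilde.k C τ i))) ?_ ?_
          · rw [← AlgHom.comp_apply, ← map_mul]
            exact (congrArg _ (Subtype.ext (kTildeInv_mul_kTilde C τ i))).trans (map_one _)
          · rw [hk', smul_mul_smul_comm, kElt_mul_kEltInv, mul_inv_cancel₀ (hς0 _), one_smul]
        rw [← kElt_apply_involution hτ.involutive] at h1
        exact h1.symm ▸ Subalgebra.smul_mem _ (hkElt (τ i)) _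
    | algebraMap r =>
      have : ((specialize C).comp Θ) (algebraMap Qv _ r) = algebraMap Qv _ r := AlgHom.commutes _ r
      exact this.symm ▸ Subalgebra.algebraMap_mem _ r
    | add x y hx hy h1 h2 =>
      have : ((specialize C).comp Θ) (⟨x, hx⟩ + ⟨y, hy⟩) = _ := map_add _ _ _
      exact this.symm ▸ add_mem h1 h2
    | mul x y hx hy h1 h2 =>
      have : ((specialize C).comp Θ) (⟨x, hx⟩ * ⟨y, hy⟩) = _ := map_mul _ _ _
      exact this.symm ▸ mul_mem h1 h2
  · have hmem : ∀ i, kElt C τ i ∈ ((specialize C).comp Θ).range := fun i =>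
      ⟨(ς (τ i))⁻¹ • UiTilde.k C τ i, by
        change ((specialize C).comp Θ) _ = _
        rw [map_smul, AlgHom.comp_apply, hk', smul_smul, inv_mul_cancel₀ (hς0 _), one_smul]⟩
    refine Algebra.adjoin_le ?_
    rintro _ ((⟨i, rfl⟩ | ⟨i, -, rfl⟩) | ⟨i, -, rfl⟩)
    · exact ⟨UiTilde.B C τ i, hB' i⟩
    · exact hmem i
    · rw [SetLike.mem_coe, ← kElt_apply_involution hτ.involutive]
      exact hmem (τ i)

theorem specialize_eq_zero_of_mk_eq_zero (hτ : Function.Involutive τ)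
    (hk : ∀ i, Θ (UiTilde.k C τ i) = ς (τ i) • kTilde C τ i) {a : UiTilde C τ}
    (ha : CentralReduction.mk C τ ς a = 0) : specialize C (Θ a) = 0 := by
  have hk' : ∀ i, ((specialize C).comp Θ) (UiTilde.k C τ i) = ς (τ i) • kElt C τ i := fun i => by
    rw [AlgHom.comp_apply, hk, map_smul, specialize_kTilde]
  have hkk : ∀ i, kElt C τ i * kElt C τ (τ i) = 1 := fun i => by
    rw [kElt_apply_involution hτ, kElt_mul_kEltInv]
  have hle : reductionIdeal C τ ς ≤ TwoSidedIdeal.ker ((specialize C).comp Θ) := by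
    refine TwoSidedIdeal.span_le.2 ?_
    rintro _ (⟨i, hi, rfl⟩ | ⟨i, -, rfl⟩)
    · have : kElt C τ i = 1 := by rw [kElt, hi, U.K_mul_Kinv]
      rw [SetLike.mem_coe, TwoSidedIdeal.mem_ker, map_sub, hk', hi, this, AlgHom.commutes,
        Algebra.algebraMap_eq_smul_one, sub_self]
    · rw [SetLike.mem_coe, TwoSidedIdeal.mem_ker, map_sub, map_mul, hk', hk', hτ,
        smul_mul_smul_comm, hkk, AlgHom.commutes, Algebra.algebraMap_eq_smul_one,
        mul_comm (ς (τ i)), sub_self]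
  have hmem : a ∈ reductionIdeal C τ ς := by
    rw [← map_zero (CentralReduction.mk C τ ς)] at ha
    exact (TwoSidedIdeal.mem_iff ..).2 ((RingCon.eq _).1 ha)
  exact (TwoSidedIdeal.mem_ker ((specialize C).comp Θ)).1 (hle hmem)

/-- Surjective homomorphisms with the same kernel have isomorphic targets. -/
theorem exists_algEquiv_of_ker_eq {A X Y : Type*} [Ring A] [Algebra Qv A] [Ring X] [Algebra Qv X]
    [Ring Y] [Algebra Qv Y] (f : A →ₐ[Qv] X) (g : A →ₐ[Qv] Y) (hf : Function.Surjective f)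
    (hg : Function.Surjective g) (h : ∀ a, f a = 0 ↔ g a = 0) :
    ∃ e : X ≃ₐ[Qv] Y, ∀ a, e (f a) = g a := by
  have hker : RingHom.ker f = RingHom.ker g := Ideal.ext h
  refine ⟨((Ideal.quotientKerAlgEquivOfSurjective hf).symm.trans
    (Ideal.quotientEquivAlgOfEq Qv hker)).trans (Ideal.quotientKerAlgEquivOfSurjective hg),
    fun a => ?_⟩
  rw [AlgEquiv.trans_apply, AlgEquiv.trans_apply, Ideal.quotientKerAlgEquivOfSurjective_symm_apply]
  rfl

end Range

end IQG

end

theorem mainTheorem10 {I : Type*} [Finite I] (C : IQG.SymmetricGCM I) (τ : I → I)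
    (hτ : IQG.IsInvolution C τ) (J : Set I) (hJ : IQG.IsOrbitReps τ J) :
    (∀ ς : I → IQG.Qv, (∀ i, ς i ≠ 0) → (∀ i, C i (τ i) = 0 → ς i = ς (τ i)) →
      ∃ Φ : IQG.Ui C τ ς J ≃ₐ[IQG.Qv] IQG.CentralReduction C τ ς,
        (∀ i : I, Φ (IQG.Ui.B C τ ς J i) =
          IQG.CentralReduction.mk C τ ς (IQG.UiTilde.B C τ i)) ∧
        (∀ j : J, Φ (IQG.Ui.k C τ ς J j) =
          (ς (τ j))⁻¹ • IQG.CentralReduction.mk C τ ς (IQG.UiTilde.k C τ j)) ∧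
        (∀ j : J, Φ (IQG.Ui.kInv C τ ς J j) =
          (ς j)⁻¹ • IQG.CentralReduction.mk C τ ς (IQG.UiTilde.k C τ (τ j)))) ∧
    IQG.IsRightCoideal C (IQG.UiTilde C τ) := by
  refine ⟨fun ς hς0 hς => ?_, IQG.isRightCoideal_UiTilde hτ⟩
  have := Fintype.ofFinite I
  obtain ⟨Θ, hΘ, hB, hk⟩ := IQG.exists_twistHom hτ ς hς0 hς
  have hrange := IQG.range_specialize_comp hτ hJ hς0 hB hk
  have hmem : ∀ a, IQG.specialize C (Θ a) ∈ IQG.Ui C τ ς J := fun a => hrange ▸ ⟨a, rfl⟩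
  obtain ⟨Φ, hΦ⟩ := IQG.exists_algEquiv_of_ker_eq
    (((IQG.specialize C).comp Θ).codRestrict (IQG.Ui C τ ς J) hmem)
    (IQG.CentralReduction.mk C τ ς)
    (fun x => by
      obtain ⟨a, ha⟩ : x.1 ∈ ((IQG.specialize C).comp Θ).range := hrange.symm ▸ x.2
      exact ⟨a, Subtype.ext ha⟩)
    (RingCon.mkₐ_surjective _)
    (fun a => by
      refine ⟨fun h => IQG.mk_eq_zero_of_specialize_eq_zero hτ hJ hς0 hΘ hB hk
        (congrArg Subtype.val h), fun h => Subtype.ext ?_⟩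
      exact IQG.specialize_eq_zero_of_mk_eq_zero hτ.involutive hk h)
  have key : ∀ (x : IQG.Ui C τ ς J) (a : IQG.UiTilde C τ), IQG.specialize C (Θ a) = x →
      Φ x = IQG.CentralReduction.mk C τ ς a := fun x a h => by
    rw [← hΦ]
    exact congrArg Φ (Subtype.ext h.symm)
  refine ⟨Φ, fun i => key _ _ ?_, fun j => ?_, fun j => ?_⟩
  · rw [hB, map_add, map_smul, map_mul, IQG.specialize_F, IQG.specialize_E, IQG.specialize_L]
    rfl
  · rw [← map_smul]
    refine key _ _ ?_
    rw [map_smul, map_smul, hk, map_smul, smul_smul, inv_mul_cancel₀ (hς0 _), one_smul,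
      IQG.specialize_kTilde]
    rfl
  · rw [← map_smul]
    refine key _ _ ?_
    rw [map_smul, map_smul, hk, map_smul, smul_smul, hτ.involutive, inv_mul_cancel₀ (hς0 _),
      one_smul, IQG.specialize_kTilde, IQG.kElt_apply_involution hτ.involutive]
    rfl
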